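/- \textbf{Definitions.} A \emph{doctrine} on a category $\mathcal C$ with binary products is a functor $P:\mathcal C^{op}\to\mathrm{InfSL}$ to inf-semilattices with top; write $P_f$ for the action of $f$. It is \emph{elementary} if every $A$ has some $\delta_A\in P(A\times A)$ such that $\alpha\mapsto P_{pr_1}(\alpha)\wedge\delta_A$ is left adjoint to $P_{\langle id_A,id_A\rangle}$ and, for every $X$, $\alpha\mapsto P_{\langle pr_1,pr_2\rangle}(\alpha)\wedge P_{\langle pr_2,pr_3\rangle}(\delta_A)$ is left adjoint to $P_e$ for $e=\langle pr_1,pr_2,pr_2\rangle:X\times A\to X\times A\times A$. It is \emph{existential} if $P_{pr}$ has a left adjoint $\exists_{pr}$ for every product projection $pr$, satisfying the Beck--Chevalley condition for pullbacks of projections and Frobenius reciprocity. A \emph{comprehension} of $\alpha\in P(A)$ is $c:X\to A$ with $P_c(\alpha)=\top$ through which every $f:Z\to A$ with $P_f(\alpha)=\top$ factors uniquely; $P$ has \emph{full comprehensions} if every $\alpha$ has one and $\alpha\le\beta$ whenever a comprehension of $\alpha$ factors through one of $\beta$. $\mathrm{CEED}$ is the 2-category whose objects are the elementary existential doctrines with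 full comprehensions. A 1-arrow $P\to R$ is a pair $(F,b)$ of a functor $F$ between the bases preserving binary products and a natural family of inf-semilattice homomorphisms $b_A:P(A)\to R(FA)$ with $b_{A\times A}(\delta_A)=R_{\langle F pr_1,F pr_2\rangle}(\delta_{FA})$ and $b_B(\exists_{pr}\alpha)=\exists_{F(pr)}b_A(\alpha)$ for every projection $pr:A\to B$. A 2-arrow $(F,b)\to(G,c)$ is a natural transformation $\theta:F\to G$ with $b_A(\alpha)\le R_{\theta_A}(c_A(\alpha))$. $\mathrm{Sub}_{\mathcal X}$ is the doctrine of subobjects of $\mathcal X$, reindexing being pullback. An \emph{exact} category is a regular category (with finite limits) in which every equivalence relation is effective; a \emph{regular functor} preserves finite limits and regular epimorphisms. For an elementary existential doctrine $P$ on $\mathcal C$, the category $\mathrm{ER}(P)$ has as objects the pairs $(A,\rho)$ with $\rho\in P(A\times A)$ a reflexive, symmetric and transitive $P$-relation on $A$, and as arrows $(A,\rho)\to(B,\sigma)$ those $\phi\in P(A\times B)$ that are extensional with respect to $\rho$ and $\sigma$, single-valued (up to $\sigma$) and total ($\top_A\le\exists_{pr_1}\phi$). Composition is relational composition and the identity of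 $(A,\rho)$ is $\rho$. The functor $D:\mathcal C\to\mathrm{ER}(P)$ is $A\mapsto(A,\delta_A)$, $(f:A\to B)\mapsto P_{f\times id_B}(\delta_B)$. When $P$ has full comprehensions, $\iota_A:P(A)\to\mathrm{Sub}_{\mathrm{ER}(P)}(A,\delta_A)$ sends $\alpha$, with comprehension $c:X\to A$, to the subobject represented by the monomorphism $P_{c\times id_A}(\delta_A):(X,P_{c\times c}(\delta_A))\to(A,\delta_A)$. \textbf{Theorem.} Let $P:\mathcal C^{op}\to\mathrm{InfSL}$ be an elementary existential doctrine with full comprehensions. Then $\mathrm{ER}(P)$ has binary products and pullbacks, $\mathrm{Sub}_{\mathrm{ER}(P)}$ is an object of $\mathrm{CEED}$, every $\iota_A$ is bijective (so that $\iota$ identifies $P(A)$ with $\mathrm{Sub}_{\mathrm{ER}(P)}(A,\delta_A)$), and $(D,\iota):P\to\mathrm{Sub}_{\mathrm{ER}(P)}$ is a 1-arrow of $\mathrm{CEED}$. For every exact category $\mathcal X$, $\mathrm{Sub}_{\mathcal X}$ is an object of $\mathrm{CEED}$ and precomposition with $(D,\iota)$, $$-\circ(D,\iota):\mathrm{CEED}(\mathrm{Sub}_{\mathrm{ER}(P)},\mathrm{Sub}_{\mathcal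 X})\longrightarrow\mathrm{CEED}(P,\mathrm{Sub}_{\mathcal X}),$$ is an equivalence of categories (fully faithful and essentially surjective). If moreover $\mathcal C$ has a terminal object, then $\mathrm{ER}(P)$ is exact, $D$ preserves the terminal object, and, for every exact $\mathcal X$: a 1-arrow $(G,b):\mathrm{Sub}_{\mathrm{ER}(P)}\to\mathrm{Sub}_{\mathcal X}$ preserves the terminal object (i.e. $G$ does) if and only if $(G,b)\circ(D,\iota)$ does; the functor $(G,b)\mapsto G$ from $\mathrm{CEED}(\mathrm{Sub}_{\mathrm{ER}(P)},\mathrm{Sub}_{\mathcal X})$ to functors $\mathrm{ER}(P)\to\mathcal X$ is fully faithful; and the functors underlying terminal-preserving 1-arrows are exactly the regular functors. Hence $\mathrm{ER}(P)$ is the free exact category on $P$: regular functors $\mathrm{ER}(P)\to\mathcal X$ are equivalent, by precomposition with $(D,\iota)$, to the 1-arrows $P\to\mathrm{Sub}_{\mathcal X}$ that preserve finite products on the base. -/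

import Mathlib

open CategoryTheory Limits Opposite

universe w w₁ w₂ w₃ v v₁ v₂ v₃ u u₁ u₂ u₃

namespace EED

noncomputable section

/-! ### Indexed inf-semilattices -/

/-- An indexed inf-semilattice on `C`: a functor from `Cᵒᵖ` to inf-semilattices (with top element)
and homomorphisms preserving finite meets. -/
abbrev Doctrine (C : Type u) [Category.{v} C] := Cᵒᵖ ⥤ SemilatInfCat.{w}

namespace Doctrine

section Basic

variable {C : Type u} [Category.{v} C] (P : Doctrine.{w} C)

/-- The fibre `P(A)`. -/
abbrev Fib (A : C) : Type w := (P.obj (op A)).X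

/-- The reindexing homomorphism `P_f : P(B) → P(A)` of an arrow `f : A ⟶ B`. -/
def re {A B : C} (f : A ⟶ B) : InfTopHom (Fib P B) (Fib P A) := P.map f.op

theorem re_id {A : C} (α : Fib P A) : re P (𝟙 A) α = α := by
  have h : P.map (𝟙 A).op = 𝟙 (P.obj (op A)) := P.map_id (op A)
  exact congrArg (fun k : InfTopHom (Fib P A) (Fib P A) => k α) h

theorem re_comp {A B E : C} (f : A ⟶ B) (g : B ⟶ E) (α : Fib P E) :
    re P f (re P g α) = re P (f ≫ g) α := by
  have h : P.map (f ≫ g).op = P.map g.op ≫ P.map f.op := P.map_comp g.op f.op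
  exact (congrArg (fun k : InfTopHom (Fib P E) (Fib P A) => k α) h).symm

theorem re_mono {A B : C} (f : A ⟶ B) {α β : Fib P B} (h : α ≤ β) : re P f α ≤ re P f β :=
  OrderHomClass.mono (re P f) h

/-- The left adjoint `∃_f` of `P_f` (a junk value when `P_f` has no left adjoint). -/
def ex {A B : C} (f : A ⟶ B) : Fib P A → Fib P B :=
  Classical.epsilon fun E => GaloisConnection E (re P f)

/-- `pr : X ⟶ A` is a projection: it is one of the two legs of a binary product diagram. -/
def IsProj {X A : C} (pr : X ⟶ A) : Prop :=
  ∃ (B : C) (q : X ⟶ B), Nonempty (IsLimit (BinaryFan.mk pr q))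

/-- Existential doctrines: left adjoints along projections, with the Beck-Chevalley condition and
Frobenius reciprocity. -/
class IsExistential : Prop where
  exists_adj : ∀ {X A : C} (pr : X ⟶ A), IsProj pr →
    ∃ E : Fib P X → Fib P A, GaloisConnection E (re P pr)
  beck_chevalley : ∀ {X' A' X A : C} {pr' : X' ⟶ A'} {f' : X' ⟶ X} {f : A' ⟶ A} {pr : X ⟶ A},
    IsPullback pr' f' f pr → IsProj pr →
      ∀ β : Fib P X, ex P pr' (re P f' β) = re P f (ex P pr β)
  frobenius : ∀ {X A : C} (pr : X ⟶ A), IsProj pr →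
    ∀ (α : Fib P A) (β : Fib P X), ex P pr (re P pr α ⊓ β) = α ⊓ ex P pr β

/-- `c : X ⟶ A` is a comprehension of `α ∈ P(A)`. -/
structure IsComprehension {X A : C} (c : X ⟶ A) (α : Fib P A) : Prop where
  re_eq_top : re P c α = ⊤
  existsUnique_lift : ∀ {Z : C} (f : Z ⟶ A), re P f α = ⊤ → ∃! g : Z ⟶ X, g ≫ c = f

/-- `P` has full comprehensions. -/
class HasFullComprehensions : Prop where
  exists_comprehension : ∀ {A : C} (α : Fib P A), ∃ (X : C) (c : X ⟶ A), IsComprehension P c α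
  full : ∀ {A X Y : C} {α β : Fib P A} {c : X ⟶ A} {d : Y ⟶ A},
    IsComprehension P c α → IsComprehension P d β → (∃ g : X ⟶ Y, g ≫ d = c) → α ≤ β

/-- The domain of a chosen comprehension of `α`. -/
def cmpObj [HasFullComprehensions P] {A : C} (α : Fib P A) : C :=
  (HasFullComprehensions.exists_comprehension α).choose

/-- A chosen comprehension of `α`. -/
def cmp [HasFullComprehensions P] {A : C} (α : Fib P A) : cmpObj P α ⟶ A :=
  (HasFullComprehensions.exists_comprehension α).choose_spec.choose

end Basic

section Elementary

variable {C : Type u} [Category.{v} C] [HasBinaryProducts C] (P : Doctrine.{w} C)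

/-- `δ ∈ P(A × A)` satisfies the two conditions required of the equality predicate of `A`:
(i) `α ↦ P_{pr₁}(α) ∧ δ` is left adjoint to reindexing along the diagonal of `A`;
(ii) `α ↦ P_{⟨pr₁,pr₂⟩}(α) ∧ P_{⟨pr₂,pr₃⟩}(δ)` is left adjoint to reindexing along
`⟨pr₁,pr₂,pr₂⟩ : X × A ⟶ X × A × A`, for every `X`. -/
structure IsEqualityPredicate (A : C) (δ : Fib P (A ⨯ A)) : Prop where
  diag_adj : GaloisConnection
    (fun α : Fib P A => re P (prod.fst : A ⨯ A ⟶ A) α ⊓ δ)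
    (re P (prod.lift (𝟙 A) (𝟙 A)))
  param_adj : ∀ X : C, GaloisConnection
    (fun α : Fib P (X ⨯ A) =>
      re P (prod.fst : (X ⨯ A) ⨯ A ⟶ X ⨯ A) α ⊓
        re P (prod.lift (prod.fst ≫ prod.snd) prod.snd : (X ⨯ A) ⨯ A ⟶ A ⨯ A) δ)
    (re P (prod.lift (𝟙 (X ⨯ A)) prod.snd : X ⨯ A ⟶ (X ⨯ A) ⨯ A))

/-- Elementary doctrines. -/
class IsElementary : Prop where
  exists_equality : ∀ A : C, ∃ δ, IsEqualityPredicate P A δ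

/-- The (unique, if it exists) equality predicate `δ_A ∈ P(A × A)`. -/
def delta (A : C) : Fib P (A ⨯ A) := Classical.epsilon (IsEqualityPredicate P A)

/-- Elementary existential doctrines with full comprehensions: the objects of `CEED`. -/
class IsCEED : Prop extends IsElementary P, IsExistential P, HasFullComprehensions P

end Elementary

/-! ### Basic facts about the logic of a doctrine -/

section Logic

variable {C : Type u} [Category.{v} C] (P : Doctrine.{w} C)

theorem isProj_fst [HasBinaryProducts C] (A B : C) : IsProj (prod.fst : A ⨯ B ⟶ A) :=
  ⟨B, prod.snd, ⟨prodIsProd A B⟩⟩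

theorem ex_gc [IsExistential P] {X A : C} {pr : X ⟶ A} (h : IsProj pr) :
    GaloisConnection (ex P pr) (re P pr) :=
  Classical.epsilon_spec (IsExistential.exists_adj pr h)

variable [HasBinaryProducts C]

theorem delta_spec [IsElementary P] (A : C) : IsEqualityPredicate P A (delta P A) :=
  Classical.epsilon_spec (IsElementary.exists_equality A)

/-- The value `φ(a, b)` of a binary predicate at generalized elements. -/
def at₂ {A B Γ : C} (φ : Fib P (A ⨯ B)) (a : Γ ⟶ A) (b : Γ ⟶ B) : Fib P Γ :=
  re P (prod.lift a b) φ

theorem re_at₂ {A B Γ Δ : C} (φ : Fib P (A ⨯ B)) (a : Γ ⟶ A) (b : Γ ⟶ B) (s : Δ ⟶ Γ) :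
    re P s (at₂ P φ a b) = at₂ P φ (s ≫ a) (s ≫ b) := by
  simp only [at₂, re_comp, prod.comp_lift]

theorem at₂_re_lift {A B A' B' Γ : C} (φ : Fib P (A' ⨯ B')) (a : Γ ⟶ A) (b : Γ ⟶ B)
    (f : A ⨯ B ⟶ A') (g : A ⨯ B ⟶ B') :
    at₂ P (re P (prod.lift f g) φ) a b = at₂ P φ (prod.lift a b ≫ f) (prod.lift a b ≫ g) := by
  simp only [at₂, re_comp, prod.comp_lift]

theorem at₂_re_map {A B A' B' Γ : C} (φ : Fib P (A' ⨯ B')) (a : Γ ⟶ A) (b : Γ ⟶ B)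
    (f : A ⟶ A') (g : B ⟶ B') :
    at₂ P (re P (prod.map f g) φ) a b = at₂ P φ (a ≫ f) (b ≫ g) := by
  simp only [at₂, re_comp, prod.lift_map]

theorem at₂_fst_snd {A B : C} (φ : Fib P (A ⨯ B)) :
    at₂ P φ prod.fst prod.snd = φ := by
  simp only [at₂, prod.lift_fst_snd, re_id]

theorem delta_refl [IsElementary P] {A Γ : C} (a : Γ ⟶ A) : at₂ P (delta P A) a a = ⊤ := by
  have h : (⊤ : Fib P A) ≤ re P (prod.lift (𝟙 A) (𝟙 A)) (delta P A) :=
    ((delta_spec P A).diag_adj _ _).1 inf_le_right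
  have h' := re_mono P a h
  rw [map_top, re_comp, prod.comp_lift, Category.comp_id] at h'
  exact top_le_iff.1 h'

/-- Substitution of equals in a predicate with a parameter. -/
theorem delta_subst [IsElementary P] {X A Γ : C} (ζ : Fib P (X ⨯ A)) (x : Γ ⟶ X) (a a' : Γ ⟶ A) :
    at₂ P ζ x a ⊓ at₂ P (delta P A) a a' ≤ at₂ P ζ x a' := by
  have h := ((delta_spec P A).param_adj X ζ
    (re P (prod.lift (prod.fst ≫ prod.fst) prod.snd) ζ)).2 (by
      rw [re_comp, prod.comp_lift, prod.lift_fst_assoc, prod.lift_snd, Category.id_comp,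
        prod.lift_fst_snd, re_id])
  have h' := re_mono P (prod.lift (prod.lift x a) a') h
  simpa only [at₂, map_inf, re_comp, prod.comp_lift, prod.lift_fst_assoc, prod.lift_snd,
    prod.lift_fst] using h'

theorem delta_symm [IsElementary P] {A Γ : C} (a a' : Γ ⟶ A) :
    at₂ P (delta P A) a a' ≤ at₂ P (delta P A) a' a := by
  have h := delta_subst P (re P (prod.lift prod.snd prod.fst) (delta P A)) a a a'
  simpa only [at₂_re_lift, prod.lift_fst, prod.lift_snd, delta_refl, top_inf_eq] using h

theorem delta_trans [IsElementary P] {A Γ : C} (a b d : Γ ⟶ A) :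
    at₂ P (delta P A) a b ⊓ at₂ P (delta P A) b d ≤ at₂ P (delta P A) a d :=
  delta_subst P (delta P A) a b d

/-- Substitution of equals in an argument to which an arrow is applied. -/
theorem delta_map [IsElementary P] {A B Γ : C} (f : A ⟶ B) (a a' : Γ ⟶ A) :
    at₂ P (delta P A) a a' ≤ at₂ P (delta P B) (a ≫ f) (a' ≫ f) := by
  have h := delta_subst P (re P (prod.map f f) (delta P B)) a a a'
  simpa only [at₂_re_map, delta_refl, top_inf_eq] using h

theorem le_ex_fst [IsExistential P] {A B Γ : C} (φ : Fib P (A ⨯ B)) (a : Γ ⟶ A) (b : Γ ⟶ B) :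
    at₂ P φ a b ≤ re P a (ex P (prod.fst : A ⨯ B ⟶ A) φ) := by
  have h := re_mono P (prod.lift a b) ((ex_gc P (isProj_fst A B)).le_u_l φ)
  rwa [re_comp, prod.lift_fst] at h

theorem ex_fst_elim [IsExistential P] {A B Γ : C} (φ : Fib P (A ⨯ B)) (a : Γ ⟶ A)
    (χ ω : Fib P Γ)
    (h : re P (prod.fst : Γ ⨯ B ⟶ Γ) χ ⊓ at₂ P φ (prod.fst ≫ a) prod.snd ≤ re P prod.fst ω) :
    χ ⊓ re P a (ex P (prod.fst : A ⨯ B ⟶ A) φ) ≤ ω := by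
  rw [← IsExistential.beck_chevalley (IsPullback.of_prod_fst_with_id a B) (isProj_fst A B),
    ← IsExistential.frobenius _ (isProj_fst Γ B)]
  refine (ex_gc P (isProj_fst Γ B) _ _).2 (le_trans (le_of_eq ?_) h)
  have e : prod.map a (𝟙 B) = prod.lift (prod.fst ≫ a) prod.snd := by
    apply Limits.prod.hom_ext
    · rw [prod.map_fst, prod.lift_fst]
    · rw [prod.map_snd, prod.lift_snd, Category.comp_id]
  rw [at₂, e]

end Logic

end Doctrine

open Doctrine

/-! ### The category of `P`-equivalence relations and functional relations -/

section ER

variable {C : Type u} [Category.{v} C] [HasBinaryProducts C]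

/-- An object of `ER P`: an object `A` of the base with a `P`-equivalence relation `ρ` on `A`. -/
structure ER (P : Doctrine.{w} C) where
  carrier : C
  rel : Fib P (carrier ⨯ carrier)
  refl : ⊤ ≤ re P (prod.lift (𝟙 carrier) (𝟙 carrier)) rel
  symm : rel ≤ re P (prod.lift prod.snd prod.fst) rel
  trans :
    re P (prod.fst : (carrier ⨯ carrier) ⨯ carrier ⟶ carrier ⨯ carrier) rel ⊓
      re P (prod.lift (prod.fst ≫ prod.snd) prod.snd) rel ≤
    re P (prod.lift (prod.fst ≫ prod.fst) prod.snd) rel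

namespace ER

variable {P : Doctrine.{w} C}

/-- An arrow of `ER P`: a functional relation `φ ∈ P(A × B)` from `(A, ρ)` to `(B, σ)`. -/
@[ext]
structure Hom (S T : ER P) where
  rel : Fib P (S.carrier ⨯ T.carrier)
  left_ext :
    re P (prod.fst : (S.carrier ⨯ S.carrier) ⨯ T.carrier ⟶ S.carrier ⨯ S.carrier) S.rel ⊓
      re P (prod.lift (prod.fst ≫ prod.snd) prod.snd) rel ≤
    re P (prod.lift (prod.fst ≫ prod.fst) prod.snd) rel
  right_ext :
    re P (prod.fst : (S.carrier ⨯ T.carrier) ⨯ T.carrier ⟶ S.carrier ⨯ T.carrier) rel ⊓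
      re P (prod.lift (prod.fst ≫ prod.snd) prod.snd) T.rel ≤
    re P (prod.lift (prod.fst ≫ prod.fst) prod.snd) rel
  single_valued :
    re P (prod.fst : (S.carrier ⨯ T.carrier) ⨯ T.carrier ⟶ S.carrier ⨯ T.carrier) rel ⊓
      re P (prod.lift (prod.fst ≫ prod.fst) prod.snd) rel ≤
    re P (prod.lift (prod.fst ≫ prod.snd) prod.snd) T.rel
  total : ⊤ ≤ ex P (prod.fst : S.carrier ⨯ T.carrier ⟶ S.carrier) rel

section Elements

variable {Γ : C}

theorem at₂_refl (S : ER P) (a : Γ ⟶ S.carrier) : at₂ P S.rel a a = ⊤ := by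
  have h := re_mono P a S.refl
  rw [map_top, re_comp, prod.comp_lift, Category.comp_id] at h
  exact top_le_iff.1 h

theorem at₂_symm (S : ER P) (a a' : Γ ⟶ S.carrier) : at₂ P S.rel a a' ≤ at₂ P S.rel a' a := by
  have h := re_mono P (prod.lift a a') S.symm
  simpa only [at₂, re_comp, prod.comp_lift, prod.lift_fst, prod.lift_snd] using h

/-- An inequality between predicates on `(A × B) × E` may be evaluated at generalized elements. -/
theorem eval₃ {A B E : C} {α : Fib P (A ⨯ B)} {β : Fib P (B ⨯ E)} {γ : Fib P (A ⨯ E)}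
    (h : re P (prod.fst : (A ⨯ B) ⨯ E ⟶ A ⨯ B) α ⊓
      re P (prod.lift (prod.fst ≫ prod.snd) prod.snd) β ≤
        re P (prod.lift (prod.fst ≫ prod.fst) prod.snd) γ)
    (a : Γ ⟶ A) (b : Γ ⟶ B) (e : Γ ⟶ E) :
    at₂ P α a b ⊓ at₂ P β b e ≤ at₂ P γ a e := by
  have h' := re_mono P (prod.lift (prod.lift a b) e) h
  simpa only [at₂, map_inf, re_comp, prod.comp_lift, prod.lift_fst_assoc, prod.lift_snd,
    prod.lift_fst] using h'

/-- Conversely, such an inequality holds if it holds at the generic elements. -/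
theorem of_eval₃ {A B E : C} {α : Fib P (A ⨯ B)} {β : Fib P (B ⨯ E)} {γ : Fib P (A ⨯ E)}
    (h : ∀ {Γ : C} (a : Γ ⟶ A) (b : Γ ⟶ B) (e : Γ ⟶ E),
      at₂ P α a b ⊓ at₂ P β b e ≤ at₂ P γ a e) :
    re P (prod.fst : (A ⨯ B) ⨯ E ⟶ A ⨯ B) α ⊓
      re P (prod.lift (prod.fst ≫ prod.snd) prod.snd) β ≤
        re P (prod.lift (prod.fst ≫ prod.fst) prod.snd) γ := by
  have h' := h (prod.fst ≫ prod.fst : (A ⨯ B) ⨯ E ⟶ A) (prod.fst ≫ prod.snd) prod.snd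
  have e : (prod.lift (prod.fst ≫ prod.fst) (prod.fst ≫ prod.snd) : (A ⨯ B) ⨯ E ⟶ A ⨯ B) =
      prod.fst := by
    apply Limits.prod.hom_ext
    · rw [prod.lift_fst]
    · rw [prod.lift_snd]
  rw [at₂, e] at h'
  exact h'

theorem of_single {A B : C} {φ : Fib P (A ⨯ B)} {τ : Fib P (B ⨯ B)}
    (h : ∀ {Γ : C} (a : Γ ⟶ A) (b b' : Γ ⟶ B),
      at₂ P φ a b ⊓ at₂ P φ a b' ≤ at₂ P τ b b') :
    re P (prod.fst : (A ⨯ B) ⨯ B ⟶ A ⨯ B) φ ⊓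
      re P (prod.lift (prod.fst ≫ prod.fst) prod.snd) φ ≤
        re P (prod.lift (prod.fst ≫ prod.snd) prod.snd) τ := by
  have h' := h (prod.fst ≫ prod.fst : (A ⨯ B) ⨯ B ⟶ A) (prod.fst ≫ prod.snd) prod.snd
  have e : (prod.lift (prod.fst ≫ prod.fst) (prod.fst ≫ prod.snd) : (A ⨯ B) ⨯ B ⟶ A ⨯ B) =
      prod.fst := by
    apply Limits.prod.hom_ext
    · rw [prod.lift_fst]
    · rw [prod.lift_snd]
  rw [at₂, e] at h'
  exact h'

theorem at₂_trans (S : ER P) (a b d : Γ ⟶ S.carrier) :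
    at₂ P S.rel a b ⊓ at₂ P S.rel b d ≤ at₂ P S.rel a d := eval₃ S.trans a b d

variable {S T : ER P}

theorem Hom.at_left (φ : Hom S T) (a a' : Γ ⟶ S.carrier) (b : Γ ⟶ T.carrier) :
    at₂ P S.rel a a' ⊓ at₂ P φ.rel a' b ≤ at₂ P φ.rel a b := eval₃ φ.left_ext a a' b

theorem Hom.at_right (φ : Hom S T) (a : Γ ⟶ S.carrier) (b b' : Γ ⟶ T.carrier) :
    at₂ P φ.rel a b ⊓ at₂ P T.rel b b' ≤ at₂ P φ.rel a b' := eval₃ φ.right_ext a b b'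

theorem Hom.at_single (φ : Hom S T) (a : Γ ⟶ S.carrier) (b b' : Γ ⟶ T.carrier) :
    at₂ P φ.rel a b ⊓ at₂ P φ.rel a b' ≤ at₂ P T.rel b b' := by
  have h' := re_mono P (prod.lift (prod.lift a b) b') φ.single_valued
  simpa only [at₂, map_inf, re_comp, prod.comp_lift, prod.lift_fst_assoc, prod.lift_snd,
    prod.lift_fst] using h'

/-- Totality as an elimination rule. -/
theorem Hom.total_elim [IsExistential P] (φ : Hom S T) (a : Γ ⟶ S.carrier) (χ ω : Fib P Γ)
    (h : re P (prod.fst : Γ ⨯ T.carrier ⟶ Γ) χ ⊓ at₂ P φ.rel (prod.fst ≫ a) prod.snd ≤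
      re P prod.fst ω) : χ ≤ ω := by
  have h1 := ex_fst_elim P φ.rel a χ ω h
  have h2 := re_mono P a φ.total
  rw [map_top] at h2
  rwa [top_le_iff.1 h2, inf_top_eq] at h1

/-- Relational composition: `∃ b, φ(a, b) ∧ ψ(b, c)`, the quantifier being along the projection
`(A × E) × B ⟶ A × E`. -/
def compRel {A B E : C} (φ : Fib P (A ⨯ B)) (ψ : Fib P (B ⨯ E)) : Fib P (A ⨯ E) :=
  ex P (prod.fst : (A ⨯ E) ⨯ B ⟶ A ⨯ E)
    (re P (prod.lift (prod.fst ≫ prod.fst) prod.snd) φ ⊓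
      re P (prod.lift prod.snd (prod.fst ≫ prod.snd)) ψ)

theorem le_compRel [IsExistential P] {A B E : C} (φ : Fib P (A ⨯ B)) (ψ : Fib P (B ⨯ E))
    (a : Γ ⟶ A) (b : Γ ⟶ B) (e : Γ ⟶ E) :
    at₂ P φ a b ⊓ at₂ P ψ b e ≤ at₂ P (compRel φ ψ) a e := by
  have h := le_ex_fst P (re P (prod.lift (prod.fst ≫ prod.fst) prod.snd) φ ⊓
      re P (prod.lift prod.snd (prod.fst ≫ prod.snd)) ψ) (prod.lift a e) b
  refine le_trans (le_of_eq ?_) h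
  simp only [at₂, map_inf, re_comp, prod.comp_lift, prod.lift_fst_assoc, prod.lift_snd,
    prod.lift_fst]

theorem compRel_elim [IsExistential P] {A B E : C} (φ : Fib P (A ⨯ B)) (ψ : Fib P (B ⨯ E))
    (a : Γ ⟶ A) (e : Γ ⟶ E) (χ ω : Fib P Γ)
    (h : re P (prod.fst : Γ ⨯ B ⟶ Γ) χ ⊓
      (at₂ P φ (prod.fst ≫ a) prod.snd ⊓ at₂ P ψ prod.snd (prod.fst ≫ e)) ≤ re P prod.fst ω) :
    χ ⊓ at₂ P (compRel φ ψ) a e ≤ ω := by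
  refine ex_fst_elim P _ (prod.lift a e) χ ω (le_trans (le_of_eq ?_) h)
  simp only [at₂, map_inf, re_comp, prod.comp_lift, prod.lift_fst_assoc, prod.lift_snd,
    prod.lift_fst]

theorem compRel_le [IsExistential P] {A B E : C} (φ : Fib P (A ⨯ B)) (ψ : Fib P (B ⨯ E))
    (ω : Fib P (A ⨯ E))
    (h : ∀ {Γ : C} (a : Γ ⟶ A) (b : Γ ⟶ B) (e : Γ ⟶ E),
      at₂ P φ a b ⊓ at₂ P ψ b e ≤ at₂ P ω a e) (a : Γ ⟶ A) (e : Γ ⟶ E) :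
    at₂ P (compRel φ ψ) a e ≤ at₂ P ω a e := by
  have := compRel_elim φ ψ a e ⊤ (at₂ P ω a e) (by
    rw [re_at₂]
    exact inf_le_right.trans (h _ _ _))
  rwa [top_inf_eq] at this

theorem ext_at {A B : C} {φ ψ : Fib P (A ⨯ B)}
    (h₁ : ∀ {Γ : C} (a : Γ ⟶ A) (b : Γ ⟶ B), at₂ P φ a b ≤ at₂ P ψ a b)
    (h₂ : ∀ {Γ : C} (a : Γ ⟶ A) (b : Γ ⟶ B), at₂ P ψ a b ≤ at₂ P φ a b) : φ = ψ := by
  rw [← at₂_fst_snd P φ, ← at₂_fst_snd P ψ]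
  exact le_antisymm (h₁ _ _) (h₂ _ _)

end Elements

/-- The functional relation given by the equivalence relation itself. -/
@[simps]
def Hom.id [IsExistential P] (S : ER P) : Hom S S where
  rel := S.rel
  left_ext := S.trans
  right_ext := S.trans
  single_valued := of_single fun a b b' =>
    (inf_le_inf_right _ (at₂_symm S a b)).trans (at₂_trans S b a b')
  total := by
    have h := le_ex_fst P S.rel (𝟙 S.carrier) (𝟙 S.carrier)
    rwa [at₂_refl, re_id] at h

/-- Composition of functional relations. -/
@[simps]
def Hom.comp [IsExistential P] {S T U : ER P} (φ : Hom S T) (ψ : Hom T U) : Hom S U where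
  rel := compRel φ.rel ψ.rel
  left_ext := of_eval₃ fun a a' e => by
    refine compRel_elim φ.rel ψ.rel a' e _ _ ?_
    rw [re_at₂, re_at₂, ← inf_assoc]
    exact (inf_le_inf_right _ (φ.at_left _ _ _)).trans (le_compRel _ _ _ _ _)
  right_ext := of_eval₃ fun a e e' => by
    rw [inf_comm]
    refine compRel_elim φ.rel ψ.rel a e _ _ ?_
    rw [re_at₂, re_at₂, inf_comm, inf_assoc]
    exact (inf_le_inf_left _ (ψ.at_right _ _ _)).trans (le_compRel _ _ _ _ _)
  single_valued := of_single fun a e e' => by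
    refine compRel_elim φ.rel ψ.rel a e' _ _ ?_
    rw [re_at₂, re_at₂, inf_comm]
    refine compRel_elim φ.rel ψ.rel _ _ _ _ ?_
    simp only [re_at₂, map_inf]
    refine le_trans ?_ (ψ.at_single
      (prod.snd : (_ ⨯ T.carrier) ⨯ T.carrier ⟶ T.carrier) _ _)
    refine le_inf (inf_le_right.trans inf_le_right) ?_
    refine le_trans (le_inf ?_ (inf_le_left.trans inf_le_right)) (ψ.at_left _ (prod.fst ≫ prod.snd) _)
    exact (le_inf (inf_le_right.trans inf_le_left) (inf_le_left.trans inf_le_left)).trans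
      (φ.at_single _ _ _)
  total := by
    refine φ.total_elim (𝟙 S.carrier) _ _ ?_
    rw [map_top, top_inf_eq, Category.comp_id]
    refine ψ.total_elim prod.snd _ _ ?_
    have h := le_ex_fst P (compRel φ.rel ψ.rel)
      ((prod.fst : (S.carrier ⨯ T.carrier) ⨯ U.carrier ⟶ _) ≫ prod.fst) prod.snd
    rw [re_comp]
    refine le_trans ?_ h
    rw [re_at₂]
    exact le_compRel _ _ _ _ _

/-- The category `ER P`. -/
instance [IsExistential P] : Category.{w} (ER P) where
  Hom := Hom
  id := Hom.id
  comp := Hom.comp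
  id_comp {S T} φ := Hom.ext (ext_at (compRel_le _ _ _ fun a a' b => φ.at_left a a' b)
    fun a b => by
      have h := le_compRel S.rel φ.rel a a b
      rwa [at₂_refl, top_inf_eq] at h)
  comp_id {S T} φ := Hom.ext (ext_at (compRel_le _ _ _ fun a b b' => φ.at_right a b b')
    fun a b => by
      have h := le_compRel φ.rel T.rel a b b
      rwa [at₂_refl, inf_top_eq] at h)
  assoc {S T U V} φ ψ χ := Hom.ext (ext_at
    (compRel_le _ _ _ fun a e d => by
      rw [inf_comm]
      refine compRel_elim φ.rel ψ.rel a e _ _ ?_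
      rw [re_at₂, re_at₂, inf_comm, inf_assoc]
      exact (inf_le_inf_left _ (le_compRel _ _ _ _ _)).trans (le_compRel _ _ _ _ _))
    (compRel_le _ _ _ fun a b d => by
      refine compRel_elim ψ.rel χ.rel b d _ _ ?_
      rw [re_at₂, re_at₂, ← inf_assoc]
      exact (inf_le_inf_right _ (le_compRel _ _ _ _ _)).trans (le_compRel _ _ _ _ _)))

section Embedding

theorem at₂_graph {A B Γ : C} (f : A ⟶ B) (a : Γ ⟶ A) (b : Γ ⟶ B) :
    at₂ P (re P (prod.map f (𝟙 B)) (delta P B)) a b = at₂ P (delta P B) (a ≫ f) b := by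
  rw [at₂_re_map, Category.comp_id]

variable [IsElementary P]

theorem graph_right {A B Γ : C} (f : A ⟶ B) (a : Γ ⟶ A) (b b' : Γ ⟶ B) :
    at₂ P (re P (prod.map f (𝟙 B)) (delta P B)) a b ⊓ at₂ P (delta P B) b b' ≤
      at₂ P (re P (prod.map f (𝟙 B)) (delta P B)) a b' := by
  rw [at₂_graph, at₂_graph]
  exact delta_trans P _ _ _

theorem graph_single {A B Γ : C} (f : A ⟶ B) (a : Γ ⟶ A) (b b' : Γ ⟶ B) :
    at₂ P (re P (prod.map f (𝟙 B)) (delta P B)) a b ⊓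
      at₂ P (re P (prod.map f (𝟙 B)) (delta P B)) a b' ≤ at₂ P (delta P B) b b' := by
  rw [at₂_graph, at₂_graph]
  exact (inf_le_inf_right _ (delta_symm P _ _)).trans (delta_trans P _ _ _)

theorem graph_left {A B Γ : C} (f : A ⟶ B) (a a' : Γ ⟶ A) (b : Γ ⟶ B) :
    at₂ P (re P (prod.map f f) (delta P B)) a a' ⊓
      at₂ P (re P (prod.map f (𝟙 B)) (delta P B)) a' b ≤
        at₂ P (re P (prod.map f (𝟙 B)) (delta P B)) a b := by
  rw [at₂_graph, at₂_graph, at₂_re_map]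
  exact delta_trans P _ _ _

theorem graph_total [IsExistential P] {A B : C} (f : A ⟶ B) :
    ⊤ ≤ ex P (prod.fst : A ⨯ B ⟶ A) (re P (prod.map f (𝟙 B)) (delta P B)) := by
  have h := le_ex_fst P (re P (prod.map f (𝟙 B)) (delta P B)) (𝟙 A) f
  rwa [at₂_graph, Category.id_comp, delta_refl, re_id] at h

/-- For `f : X ⟶ A`, the object `(X, P_{f × f}(δ_A))` of `ER P`. -/
def ker (P : Doctrine.{w} C) [IsElementary P] {X A : C} (f : X ⟶ A) : ER P where
  carrier := X
  rel := re P (prod.map f f) (delta P A)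
  refl := by
    have h := at₂_re_map P (delta P A) (𝟙 X) (𝟙 X) f f
    rw [delta_refl] at h
    exact h.ge
  symm := by
    have h := delta_symm P ((prod.fst : X ⨯ X ⟶ X) ≫ f) (prod.snd ≫ f)
    rw [← at₂_re_map, ← at₂_re_map, at₂_fst_snd] at h
    exact h
  trans := of_eval₃ fun a b d => by
    rw [at₂_re_map, at₂_re_map, at₂_re_map]
    exact delta_trans P _ _ _

/-- The object `(A, δ_A)` of `ER P`. -/
def diag (P : Doctrine.{w} C) [IsElementary P] (A : C) : ER P where
  carrier := A
  rel := delta P A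
  refl := (delta_refl P (𝟙 A)).ge
  symm := by
    have h := delta_symm P (prod.fst : A ⨯ A ⟶ A) prod.snd
    rwa [at₂_fst_snd] at h
  trans := of_eval₃ fun a b d => delta_trans P a b d

variable [IsExistential P]

/-- The functional relation `P_{f × id}(δ_B)` from `(A, δ_A)` to `(B, δ_B)`. -/
def diagMap (P : Doctrine.{w} C) [IsElementary P] [IsExistential P] {A B : C} (f : A ⟶ B) :
    diag P A ⟶ diag P B where
  rel := re P (prod.map f (𝟙 B)) (delta P B)
  left_ext := of_eval₃ fun a a' b =>
    (inf_le_inf_right _ ((delta_map P f a a').trans_eq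
      (at₂_re_map P (delta P B) a a' f f).symm)).trans (graph_left f a a' b)
  right_ext := of_eval₃ fun a b b' => graph_right f a b b'
  single_valued := of_single fun a b b' => graph_single f a b b'
  total := graph_total f

/-- The functor `D : C ⥤ ER P` with `D A = (A, δ_A)` and `D f = P_{f × id}(δ_B)`. -/
def D (P : Doctrine.{w} C) [IsElementary P] [IsExistential P] : C ⥤ ER P where
  obj := diag P
  map := diagMap P
  map_id A := Hom.ext (by
    change re P (prod.map (𝟙 A) (𝟙 A)) (delta P A) = delta P A
    rw [prod.map_id_id, re_id])
  map_comp {A B E} f g := Hom.ext (ext_at (A := A) (B := E)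
    (φ := re P (prod.map (f ≫ g) (𝟙 E)) (delta P E))
    (ψ := compRel (re P (prod.map f (𝟙 B)) (delta P B)) (re P (prod.map g (𝟙 E)) (delta P E)))
    (fun a e => by
      refine le_trans ?_ (le_compRel _ _ a (a ≫ f) e)
      rw [at₂_graph, at₂_graph, at₂_graph, delta_refl, top_inf_eq, Category.assoc])
    (compRel_le _ _ _ fun a b e => by
      rw [at₂_graph, at₂_graph, at₂_graph]
      have h := delta_map P g (a ≫ f) b
      rw [Category.assoc] at h
      exact (inf_le_inf_right _ h).trans (delta_trans P _ _ _)))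

/-- The arrow `(X, P_{f × f}(δ_A)) ⟶ (A, δ_A)` given by `P_{f × id}(δ_A)`. -/
def kerι (P : Doctrine.{w} C) [IsElementary P] [IsExistential P] {X A : C} (f : X ⟶ A) :
    ker P f ⟶ (D P).obj A where
  rel := re P (prod.map f (𝟙 A)) (delta P A)
  left_ext := of_eval₃ fun a a' b => graph_left f a a' b
  right_ext := of_eval₃ fun a b b' => graph_right f a b b'
  single_valued := of_single fun a b b' => graph_single f a b b'
  total := graph_total f

instance {X A : C} (f : X ⟶ A) : Mono (kerι P f) where
  right_cancellation {S} φ ψ h := by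
    have key : ∀ φ ψ : Fib P (S.carrier ⨯ X),
        (∀ {Γ : C} (a : Γ ⟶ S.carrier) (x x' : Γ ⟶ X),
          at₂ P ψ a x ⊓ at₂ P (re P (prod.map f f) (delta P A)) x x' ≤ at₂ P ψ a x') →
        compRel φ (re P (prod.map f (𝟙 A)) (delta P A)) =
          compRel ψ (re P (prod.map f (𝟙 A)) (delta P A)) →
        ∀ {Γ : C} (a : Γ ⟶ S.carrier) (x : Γ ⟶ X), at₂ P φ a x ≤ at₂ P ψ a x := by
      intro φ ψ hψ h Γ a x
      have h1 := le_compRel φ (re P (prod.map f (𝟙 A)) (delta P A)) a x (x ≫ f)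
      rw [at₂_graph, delta_refl, inf_top_eq, h] at h1
      refine h1.trans ?_
      have h3 := compRel_elim ψ (re P (prod.map f (𝟙 A)) (delta P A)) a (x ≫ f) ⊤
        (at₂ P ψ a x) (by
          rw [map_top, top_inf_eq, re_at₂]
          refine le_trans (inf_le_inf_left _ (le_of_eq ?_)) (hψ _ prod.snd _)
          rw [at₂_graph, at₂_re_map, Category.assoc])
      rwa [top_inf_eq] at h3
    exact Hom.ext (ext_at
      (key φ.rel ψ.rel (fun a x x' => ψ.at_right a x x') (congrArg Hom.rel h))
      (key ψ.rel φ.rel (fun a x x' => φ.at_right a x x') (congrArg Hom.rel h.symm)))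

/-- The canonical map from `P(A)` to the subobjects of `(A, δ_A)` in `ER P`: if `c : X ⟶ A` is the
comprehension of `α`, it sends `α` to the subobject represented by the monomorphism
`(X, P_{c × c}(δ_A)) ⟶ (A, δ_A)` given by the functional relation `P_{c × id}(δ_A)`. -/
def ι (P : Doctrine.{w} C) [IsElementary P] [IsExistential P] [HasFullComprehensions P] (A : C)
    (α : Fib P A) : Subobject ((D P).obj A) :=
  Subobject.mk (kerι P (cmp P α))

end Embedding

end ER

end ER

/-! ### Subobjects, exact categories -/

section Sub

/-- The indexed inf-semilattice of subobjects of `X`, reindexing being pullback. -/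
def SubDoctrine (X : Type u) [Category.{v} X] [HasPullbacks X] : Doctrine.{max u v} X where
  obj A := SemilatInfCat.of (Subobject A.unop)
  map f := (
    { toFun := fun m => (Subobject.pullback f.unop).obj m
      map_inf' := fun m n => Subobject.inf_pullback f.unop m n
      map_top' := Subobject.pullback_top f.unop } : InfTopHom (Subobject _) (Subobject _))
  map_id _ := InfTopHom.ext fun m => Subobject.pullback_id m
  map_comp f g := InfTopHom.ext fun m => Subobject.pullback_comp g.unop f.unop m

/-- Exact categories (in the sense of Barr): regular categories in which every internal
equivalence relation is effective. -/
class IsExact (X : Type u) [Category.{v} X] : Prop extends Regular X where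
  effective : ∀ {R A : X} (p₁ p₂ : R ⟶ A), IsEquivalenceRelation p₁ p₂ →
    IsEffectiveEquivalenceRelation p₁ p₂

/-- `F` preserves terminal objects. -/
abbrev PreservesTerminal {C : Type u₁} [Category.{v₁} C] {X : Type u₂} [Category.{v₂} X]
    (F : C ⥤ X) : Prop :=
  PreservesLimitsOfShape (Discrete PEmpty.{1}) F

/-- Regular functors: they preserve finite limits and regular epimorphisms. -/
structure IsRegularFunctor {Y : Type u₁} [Category.{v₁} Y] {X : Type u₂} [Category.{v₂} X]
    (F : Y ⥤ X) : Prop where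
  preservesFiniteLimits : PreservesFiniteLimits F
  map_regularEpi : ∀ {A B : Y} (f : A ⟶ B), IsRegularEpi f → IsRegularEpi (F.map f)

end Sub

/-! ### The 2-category of elementary existential doctrines -/

section TwoCategory

variable {C : Type u₁} [Category.{v₁} C] [HasBinaryProducts C]
variable {X : Type u₂} [Category.{v₂} X] [HasBinaryProducts X]
variable {Y : Type u₃} [Category.{v₃} Y] [HasBinaryProducts Y]

/-- `(F, b)` is a 1-arrow of elementary existential doctrines from `P` to `R`: `F` preserves binary
products, the `b_A : P(A) → R(F A)` are homomorphisms of inf-semilattices, natural in `A`, and they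
preserve the equality predicates and the existential quantifiers. -/
structure IsArrow (P : Doctrine.{w₁} C) (R : Doctrine.{w₂} X) (F : C ⥤ X)
    (b : ∀ A : C, Fib P A → Fib R (F.obj A)) : Prop where
  preservesProducts : PreservesLimitsOfShape (Discrete WalkingPair) F
  map_top : ∀ A : C, b A ⊤ = ⊤
  map_inf : ∀ (A : C) (α β : Fib P A), b A (α ⊓ β) = b A α ⊓ b A β
  natural : ∀ {A B : C} (f : A ⟶ B) (β : Fib P B), b A (re P f β) = re R (F.map f) (b B β)
  map_delta : ∀ A : C, b (A ⨯ A) (delta P A) =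
    re R (prod.lift (F.map prod.fst) (F.map prod.snd)) (delta R (F.obj A))
  map_ex : ∀ {A B : C} (pr : A ⟶ B), IsProj pr → ∀ α : Fib P A,
    b B (ex P pr α) = ex R (F.map pr) (b A α)

/-- 1-arrows of elementary existential doctrines. Between doctrines with full comprehensions, these
are also the 1-arrows of `CEED`. -/
structure OneArrow (P : Doctrine.{w₁} C) (R : Doctrine.{w₂} X) where
  F : C ⥤ X
  b : ∀ A : C, Fib P A → Fib R (F.obj A)
  isArrow : IsArrow P R F b

namespace OneArrow

/-- 2-arrows `(F, b) ⟶ (G, c)`: natural transformations `θ : F ⟶ G` with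
`b_A(α) ≤ R_{θ_A}(c_A(α))`. -/
@[ext]
structure Hom {P : Doctrine.{w₁} C} {R : Doctrine.{w₂} X} (K L : OneArrow P R) where
  θ : K.F ⟶ L.F
  le : ∀ (A : C) (α : Fib P A), K.b A α ≤ re R (θ.app A) (L.b A α)

/-- The category of 1-arrows from `P` to `R` and 2-arrows between them. -/
instance (P : Doctrine.{w₁} C) (R : Doctrine.{w₂} X) : Category (OneArrow P R) where
  Hom := Hom
  id K := ⟨𝟙 K.F, fun A α => by rw [NatTrans.id_app, re_id]⟩
  comp {K L M} s t := ⟨s.θ ≫ t.θ, fun A α => by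
    rw [NatTrans.comp_app, ← re_comp]
    exact (s.le A α).trans (re_mono R _ (t.le A α))⟩
  id_comp s := Hom.ext (Category.id_comp s.θ)
  comp_id s := Hom.ext (Category.comp_id s.θ)
  assoc s t r := Hom.ext (Category.assoc s.θ t.θ r.θ)

/-- Composition of 1-arrows. -/
@[simps]
def comp {P : Doctrine.{w₁} C} {S : Doctrine.{w₃} Y} {R : Doctrine.{w₂} X}
    (K : OneArrow P S) (G : OneArrow S R) : OneArrow P R where
  F := K.F ⋙ G.F
  b A α := G.b (K.F.obj A) (K.b A α)
  isArrow :=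
    { preservesProducts := by
        have := K.isArrow.preservesProducts
        have := G.isArrow.preservesProducts
        infer_instance
      map_top := fun A => by rw [K.isArrow.map_top, G.isArrow.map_top]
      map_inf := fun A α β => by rw [K.isArrow.map_inf, G.isArrow.map_inf]
      natural := fun f β => by rw [K.isArrow.natural, G.isArrow.natural]; rfl
      map_delta := fun A => by
        rw [K.isArrow.map_delta, G.isArrow.natural, G.isArrow.map_delta, re_comp,
          prod.comp_lift, ← G.F.map_comp, ← G.F.map_comp, prod.lift_fst, prod.lift_snd]
        rfl
      map_ex := fun {A B} pr h α => by
        have := K.isArrow.preservesProducts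
        rw [K.isArrow.map_ex pr h, G.isArrow.map_ex]
        · rfl
        · obtain ⟨B', q, ⟨hq⟩⟩ := h
          exact ⟨K.F.obj B', K.F.map q, ⟨mapIsLimitOfPreservesOfIsLimit K.F pr q hq⟩⟩ }

/-- Precomposition with a 1-arrow `K : P → S`, as a functor from 1-arrows `S → R` to 1-arrows
`P → R`. -/
@[simps]
def precomp {P : Doctrine.{w₁} C} {S : Doctrine.{w₃} Y} (K : OneArrow P S) (R : Doctrine.{w₂} X) :
    OneArrow S R ⥤ OneArrow P R where
  obj G := K.comp G
  map t := ⟨Functor.whiskerLeft K.F t.θ, fun A α => OneArrow.Hom.le t (K.F.obj A) (K.b A α)⟩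
  map_id _ := rfl
  map_comp _ _ := rfl

/-- The functor sending a 1-arrow `(F, b)` to `F`. -/
@[simps]
def forget (P : Doctrine.{w₁} C) (R : Doctrine.{w₂} X) : OneArrow P R ⥤ (C ⥤ X) where
  obj K := K.F
  map t := t.θ
  map_id _ := rfl
  map_comp _ _ := rfl

end OneArrow

end TwoCategory

end

end EED

open EED

/-!
Everything rests on reading a doctrine `P` with full comprehensions through its generalized
elements. A predicate `α ∈ P(A)` is *forced* at `a : Γ ⟶ A` if `P_a(α) = ⊤`. Fullness of
comprehensions says that `α ≤ β` exactly when `β` is forced wherever `α` is (`Doctrine.le_of_sat₁`),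
and an existential statement is forced exactly when it has a witness after pulling back along a
*cover* (`Doctrine.sat₁_ex`), an arrow along which validity of predicates descends. So functional
relations can be handled as locally defined maps, and `ER P` as a category of quotients: every
`(A, ρ)` is the quotient of `(A, δ_A)` (`ER.quot`), products and pullbacks are computed on carriers,
an arrow is a monomorphism (a strong epimorphism, equivalently a regular one) if and only if it is
injective (locally surjective) on generalized elements (`ER.mono_of_eqv`, `ER.strongEpi_iff_surj`),
and the image of an arrow is its domain with a larger relation.

Strong epimorphism–monomorphism factorizations stable under pullback suffice to make subobjects an
elementary existential doctrine with full comprehensions, the quantifiers being images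
(`HasStableImages`, `Sub.mem_ex`); no terminal object is needed. This covers `ER P` and every regular
category. A subobject of `(A, δ_A)` is determined by the predicate that says which elements of `A`
belong to it, which is the bijectivity of `ι` (`ER.incl_bijective`).

A one-arrow into a doctrine of subobjects is determined by its functor, since `b(α)` is the image of
the comprehension of `α` (`OneArrow.exists_chart`); hence every natural transformation is a 2-arrow.
Between doctrines of subobjects the functors that occur are exactly those preserving binary products,
pullbacks and strong epimorphisms (`OneArrow.isLexRegular`, `IsLexRegular.isArrow`).

For the universal property, natural transformations on the image of `D` descend along the quotient
maps `(A, δ_A) ⟶ (A, ρ)`, because elements identified by such a map are locally images of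
`ρ`-related points (`ER.exists_natTrans`). Conversely a one-arrow `K = (F, b)` from `P` to the
subobjects of an exact category interprets `ρ` as an equivalence relation on `F A`, and `(A, ρ)` is
sent to its quotient (`OneArrow.ext`). Sequents forced in `P` remain valid under this interpretation
(`OneArrow.Holds.sequent`), which makes the extension a functor preserving the structure
(`OneArrow.isLexRegular_ext`) and restricting to `K` along `D` (`OneArrow.restrictExtIso`).

If the base has a terminal object then so has `ER P`, which is therefore finitely complete. The
quotient of `(A, ρ)` by an equivalence relation in `ER P` is again carried by `A`
(`ER.effQuotient`), so `ER P` is exact.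
-/

set_option linter.unusedSectionVars false

namespace EED

noncomputable section

open Doctrine

namespace Doctrine

/-! ### Forcing in a doctrine with full comprehensions -/

section Forcing

variable {C : Type u} [Category.{v} C] (P : Doctrine.{w} C)

/-- The predicate `α ∈ P(A)` is forced at the generalized element `a : Γ ⟶ A`. -/
def Sat₁ {A Γ : C} (α : Fib P A) (a : Γ ⟶ A) : Prop := re P a α = ⊤

/-- An arrow `s : Δ ⟶ Γ` of the base is a cover if validity of predicates on `Γ` may be checked
after reindexing along `s`. -/
def PCover {Δ Γ : C} (s : Δ ⟶ Γ) : Prop := ∀ ω : Fib P Γ, re P s ω = ⊤ → ω = ⊤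

variable {P}

theorem Sat₁.pull {A Γ Δ : C} {α : Fib P A} {a : Γ ⟶ A} (h : Sat₁ P α a) (s : Δ ⟶ Γ) :
    Sat₁ P α (s ≫ a) := by
  have h' : re P a α = ⊤ := h
  rw [Sat₁, ← re_comp, h', map_top]

theorem Sat₁.mono {A Γ : C} {α β : Fib P A} {a : Γ ⟶ A} (h : Sat₁ P α a) (hab : α ≤ β) :
    Sat₁ P β a :=
  top_le_iff.1 ((show re P a α = ⊤ from h) ▸ re_mono P a hab)

theorem sat₁_top {A Γ : C} (a : Γ ⟶ A) : Sat₁ P (⊤ : Fib P A) a := map_top _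

theorem sat₁_inf {A Γ : C} {α β : Fib P A} {a : Γ ⟶ A} :
    Sat₁ P (α ⊓ β) a ↔ Sat₁ P α a ∧ Sat₁ P β a := by
  rw [Sat₁, map_inf, inf_eq_top_iff]; rfl

theorem sat₁_re {A B Γ : C} {f : A ⟶ B} {β : Fib P B} {a : Γ ⟶ A} :
    Sat₁ P (re P f β) a ↔ Sat₁ P β (a ≫ f) := by
  rw [Sat₁, re_comp]; rfl

theorem PCover.sat₁ {A Γ Δ : C} {s : Δ ⟶ Γ} (hs : PCover P s) {α : Fib P A} {a : Γ ⟶ A}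
    (h : Sat₁ P α (s ≫ a)) : Sat₁ P α a :=
  hs _ (by rw [re_comp]; exact h)

theorem PCover.id (Γ : C) : PCover P (𝟙 Γ) := fun ω h => by rwa [re_id] at h

theorem PCover.comp {Γ Δ Ξ : C} {s : Δ ⟶ Γ} {t : Ξ ⟶ Δ} (hs : PCover P s) (ht : PCover P t) :
    PCover P (t ≫ s) := fun ω h => hs _ (ht _ (by rwa [re_comp]))

section Comprehension

variable [HasFullComprehensions P]

theorem isComprehension_cmp {A : C} (α : Fib P A) : IsComprehension P (cmp P α) α :=
  (HasFullComprehensions.exists_comprehension α).choose_spec.choose_spec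

theorem sat₁_cmp {A : C} (α : Fib P A) : Sat₁ P α (cmp P α) := (isComprehension_cmp α).re_eq_top

/-- A generalized element forcing `α` factors through the comprehension of `α`. -/
theorem Sat₁.exists_lift {A Γ : C} {α : Fib P A} {a : Γ ⟶ A} (h : Sat₁ P α a) :
    ∃ x : Γ ⟶ cmpObj P α, x ≫ cmp P α = a :=
  ((isComprehension_cmp α).existsUnique_lift a h).exists

/-- Fullness of comprehensions: the order of a fibre is implication of forcing. -/
theorem le_of_sat₁ {A : C} {α β : Fib P A}
    (h : ∀ {Γ : C} (a : Γ ⟶ A), Sat₁ P α a → Sat₁ P β a) : α ≤ β :=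
  HasFullComprehensions.full (isComprehension_cmp α) (isComprehension_cmp β)
    (h _ (sat₁_cmp α)).exists_lift

end Comprehension

section Binary

variable [HasBinaryProducts C]

variable (P) in
/-- The binary predicate `φ ∈ P(A × B)` is forced at the generalized elements `a` and `b`. -/
def Sat {A B Γ : C} (φ : Fib P (A ⨯ B)) (a : Γ ⟶ A) (b : Γ ⟶ B) : Prop := at₂ P φ a b = ⊤

variable {A B Γ Δ : C}

theorem sat_iff {φ : Fib P (A ⨯ B)} {a : Γ ⟶ A} {b : Γ ⟶ B} :
    Sat P φ a b ↔ Sat₁ P φ (prod.lift a b) := Iff.rfl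

theorem sat₁_iff {φ : Fib P (A ⨯ B)} {w : Γ ⟶ A ⨯ B} :
    Sat₁ P φ w ↔ Sat P φ (w ≫ prod.fst) (w ≫ prod.snd) := by
  rw [sat_iff, ← prod.comp_lift, prod.lift_fst_snd, Category.comp_id]

theorem Sat.pull {φ : Fib P (A ⨯ B)} {a : Γ ⟶ A} {b : Γ ⟶ B} (h : Sat P φ a b) (s : Δ ⟶ Γ) :
    Sat P φ (s ≫ a) (s ≫ b) := by
  have h' := Sat₁.pull (sat_iff.1 h) s
  rwa [prod.comp_lift] at h'

theorem PCover.sat {s : Δ ⟶ Γ} (hs : PCover P s) {φ : Fib P (A ⨯ B)} {a : Γ ⟶ A} {b : Γ ⟶ B}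
    (h : Sat P φ (s ≫ a) (s ≫ b)) : Sat P φ a b :=
  hs _ (by rw [re_at₂]; exact h)

theorem sat_inf {φ ψ : Fib P (A ⨯ B)} {a : Γ ⟶ A} {b : Γ ⟶ B} :
    Sat P (φ ⊓ ψ) a b ↔ Sat P φ a b ∧ Sat P ψ a b := sat₁_inf

theorem sat_re_map {A' B' : C} {φ : Fib P (A' ⨯ B')} {f : A ⟶ A'} {g : B ⟶ B'} {a : Γ ⟶ A}
    {b : Γ ⟶ B} : Sat P (re P (prod.map f g) φ) a b ↔ Sat P φ (a ≫ f) (b ≫ g) := by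
  rw [Sat, at₂_re_map]; rfl

theorem sat_re_lift {A' B' : C} {φ : Fib P (A' ⨯ B')} {f : A ⨯ B ⟶ A'} {g : A ⨯ B ⟶ B'}
    {a : Γ ⟶ A} {b : Γ ⟶ B} :
    Sat P (re P (prod.lift f g) φ) a b ↔ Sat P φ (prod.lift a b ≫ f) (prod.lift a b ≫ g) := by
  rw [Sat, at₂_re_lift]; rfl

/-- The opposite relation. -/
abbrev swap (φ : Fib P (A ⨯ B)) : Fib P (B ⨯ A) := re P (prod.lift prod.snd prod.fst) φ

theorem sat_swap {φ : Fib P (A ⨯ B)} {a : Γ ⟶ A} {b : Γ ⟶ B} :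
    Sat P (swap φ) b a ↔ Sat P φ a b := by
  rw [swap, sat_re_lift, prod.lift_snd, prod.lift_fst]

theorem le_of_sat [HasFullComprehensions P] {φ ψ : Fib P (A ⨯ B)}
    (h : ∀ {Γ : C} (a : Γ ⟶ A) (b : Γ ⟶ B), Sat P φ a b → Sat P ψ a b) : φ ≤ ψ :=
  le_of_sat₁ fun _ ha => sat₁_iff.2 (h _ _ (sat₁_iff.1 ha))

theorem sat₁_at₂ {φ : Fib P (A ⨯ B)} {a : Γ ⟶ A} {b : Γ ⟶ B} {s : Δ ⟶ Γ} :
    Sat₁ P (at₂ P φ a b) s ↔ Sat P φ (s ≫ a) (s ≫ b) := by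
  rw [Sat₁, re_at₂]; rfl

section Exists

variable [IsExistential P]

/-- Forcing of an existential statement: a witness exists after passing to a cover. -/
theorem sat₁_ex [HasFullComprehensions P] {φ : Fib P (A ⨯ B)} {a : Γ ⟶ A} :
    Sat₁ P (ex P (prod.fst : A ⨯ B ⟶ A) φ) a ↔
      ∃ (Δ : C) (s : Δ ⟶ Γ) (_ : PCover P s) (b : Δ ⟶ B), Sat P φ (s ≫ a) b := by
  constructor
  · intro h
    -- The cover is the comprehension of `φ(a, -)` followed by the projection to `Γ`.
    let θ : Fib P (Γ ⨯ B) := at₂ P φ (prod.fst ≫ a) prod.snd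
    have hθ := sat₁_cmp θ
    refine ⟨_, cmp P θ ≫ prod.fst, fun ω hω => ?_, cmp P θ ≫ prod.snd, ?_⟩
    · have h1 := ex_fst_elim P φ a ⊤ ω (by
        rw [map_top, top_inf_eq]
        refine le_of_sat₁ fun w hw => ?_
        obtain ⟨x, rfl⟩ := Sat₁.exists_lift hw
        rw [sat₁_re, Category.assoc]
        exact Sat₁.pull hω x)
      rw [show re P a _ = ⊤ from h, inf_top_eq] at h1
      exact top_le_iff.1 h1
    · have : Sat₁ P (at₂ P φ (prod.fst ≫ a) prod.snd) (cmp P θ) := hθ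
      rw [Sat₁, re_at₂] at this
      rwa [Category.assoc]
  · rintro ⟨Δ, s, hs, b, h⟩
    refine hs.sat₁ (top_le_iff.1 ?_)
    have h1 := le_ex_fst P φ (s ≫ a) b
    rwa [show at₂ P φ (s ≫ a) b = ⊤ from h] at h1

theorem sat_compRel [HasFullComprehensions P] {E : C} {φ : Fib P (A ⨯ B)} {ψ : Fib P (B ⨯ E)}
    {a : Γ ⟶ A} {e : Γ ⟶ E} :
    Sat P (ER.compRel φ ψ) a e ↔ ∃ (Δ : C) (s : Δ ⟶ Γ) (_ : PCover P s) (b : Δ ⟶ B),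
      Sat P φ (s ≫ a) b ∧ Sat P ψ b (s ≫ e) := by
  rw [sat_iff, ER.compRel, sat₁_ex]
  simp only [sat_inf, sat_re_lift, prod.lift_fst_assoc, prod.lift_snd, prod.comp_lift,
    prod.lift_fst]

end Exists

section Equality

variable [IsElementary P]

theorem sat_delta_refl (a : Γ ⟶ A) : Sat P (delta P A) a a := delta_refl P a

theorem Sat.subst {φ : Fib P (A ⨯ B)} {a : Γ ⟶ A} {b b' : Γ ⟶ B} (h : Sat P φ a b)
    (e : Sat P (delta P B) b b') : Sat P φ a b' := by
  have h1 := delta_subst P φ a b b'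
  rw [show at₂ P φ a b = ⊤ from h, show at₂ P _ b b' = ⊤ from e, top_inf_eq] at h1
  exact top_le_iff.1 h1

theorem Sat.subst_left {φ : Fib P (A ⨯ B)} {a a' : Γ ⟶ A} {b : Γ ⟶ B} (h : Sat P φ a b)
    (e : Sat P (delta P A) a a') : Sat P φ a' b :=
  sat_swap.1 ((sat_swap.2 h).subst e)

theorem sat_delta_symm {a a' : Γ ⟶ A} (e : Sat P (delta P A) a a') : Sat P (delta P A) a' a :=
  (sat_delta_refl a).subst_left e

theorem sat_delta_map (f : A ⟶ B) {a a' : Γ ⟶ A} (e : Sat P (delta P A) a a') :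
    Sat P (delta P B) (a ≫ f) (a' ≫ f) := by
  have h1 := delta_map P f a a'
  rw [show at₂ P _ a a' = ⊤ from e] at h1
  exact top_le_iff.1 h1

theorem Sat₁.subst {α : Fib P A} {a a' : Γ ⟶ A} (h : Sat₁ P α a)
    (e : Sat P (delta P A) a a') : Sat₁ P α a' := by
  have h1 : Sat P (re P (prod.snd : A ⨯ A ⟶ A) α) a a := by
    rw [sat_iff, sat₁_re, prod.lift_snd]; exact h
  have h2 := h1.subst e
  rwa [sat_iff, sat₁_re, prod.lift_snd] at h2

end Equality

end Binary

end Forcing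

end Doctrine

namespace ER

variable {C : Type u} [Category.{v} C] [HasBinaryProducts C] {P : Doctrine.{w} C}

/-! ### Functional relations in terms of forcing -/

section Forcing

/-- Two generalized elements of the carrier of `S` are equal in `S`. -/
def Eqv (S : ER P) {Γ : C} (a a' : Γ ⟶ S.carrier) : Prop := Sat P S.rel a a'

variable {S T U : ER P} {Γ Δ : C}

theorem Eqv.refl (a : Γ ⟶ S.carrier) : S.Eqv a a := at₂_refl S a

theorem Eqv.symm {a a' : Γ ⟶ S.carrier} (h : S.Eqv a a') : S.Eqv a' a :=
  top_le_iff.1 ((show at₂ P S.rel a a' = ⊤ from h) ▸ at₂_symm S a a')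

theorem Eqv.trans {a b d : Γ ⟶ S.carrier} (h : S.Eqv a b) (h' : S.Eqv b d) : S.Eqv a d := by
  have h1 := at₂_trans S a b d
  rw [show at₂ P S.rel a b = ⊤ from h, show at₂ P S.rel b d = ⊤ from h', top_inf_eq] at h1
  exact top_le_iff.1 h1

theorem Eqv.pull {a b : Γ ⟶ S.carrier} (h : S.Eqv a b) (s : Δ ⟶ Γ) : S.Eqv (s ≫ a) (s ≫ b) :=
  Sat.pull h s

/-- The forcing form of an inequality between predicates in three variables. -/
theorem le_of_sat₃ [HasFullComprehensions P] {A B E : C} {α : Fib P (A ⨯ B)} {β : Fib P (B ⨯ E)}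
    {γ : Fib P (A ⨯ E)}
    (h : ∀ {Γ : C} (a : Γ ⟶ A) (b : Γ ⟶ B) (e : Γ ⟶ E), Sat P α a b → Sat P β b e → Sat P γ a e) :
    re P (prod.fst : (A ⨯ B) ⨯ E ⟶ A ⨯ B) α ⊓
      re P (prod.lift (prod.fst ≫ prod.snd) prod.snd) β ≤
        re P (prod.lift (prod.fst ≫ prod.fst) prod.snd) γ :=
  of_eval₃ fun a b e => le_of_sat₁ fun s hs => by
    rw [sat₁_inf, sat₁_at₂, sat₁_at₂] at hs
    exact sat₁_at₂.2 (h _ _ _ hs.1 hs.2)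

/-- An object of `ER P` from a relation that is an equivalence relation for forcing. -/
abbrev ofSat [HasFullComprehensions P] (A : C) (ρ : Fib P (A ⨯ A))
    (hr : ∀ {Γ : C} (a : Γ ⟶ A), Sat P ρ a a)
    (hs : ∀ {Γ : C} (a b : Γ ⟶ A), Sat P ρ a b → Sat P ρ b a)
    (ht : ∀ {Γ : C} (a b d : Γ ⟶ A), Sat P ρ a b → Sat P ρ b d → Sat P ρ a d) : ER P where
  carrier := A
  rel := ρ
  refl := (hr (𝟙 A)).ge
  symm := le_of_sat fun _ _ h => sat_swap.2 (hs _ _ h)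
  trans := le_of_sat₃ ht

variable [IsExistential P]

/-- The functional relation `φ` maps the generalized element `a` to `b`. -/
def Maps (φ : S ⟶ T) (a : Γ ⟶ S.carrier) (b : Γ ⟶ T.carrier) : Prop := Sat P (Hom.rel φ) a b

theorem Maps.pull {φ : S ⟶ T} {a : Γ ⟶ S.carrier} {b : Γ ⟶ T.carrier} (h : Maps φ a b)
    (s : Δ ⟶ Γ) : Maps φ (s ≫ a) (s ≫ b) := Sat.pull h s

theorem Maps.left {φ : S ⟶ T} {a a' : Γ ⟶ S.carrier} {b : Γ ⟶ T.carrier} (h : Maps φ a b)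
    (e : S.Eqv a' a) : Maps φ a' b := by
  have h1 := Hom.at_left φ a' a b
  rw [show at₂ P _ a b = ⊤ from h, show at₂ P _ a' a = ⊤ from e, top_inf_eq] at h1
  exact top_le_iff.1 h1

theorem Maps.right {φ : S ⟶ T} {a : Γ ⟶ S.carrier} {b b' : Γ ⟶ T.carrier} (h : Maps φ a b)
    (e : T.Eqv b b') : Maps φ a b' := by
  have h1 := Hom.at_right φ a b b'
  rw [show at₂ P _ a b = ⊤ from h, show at₂ P _ b b' = ⊤ from e, top_inf_eq] at h1
  exact top_le_iff.1 h1

theorem Maps.single {φ : S ⟶ T} {a : Γ ⟶ S.carrier} {b b' : Γ ⟶ T.carrier} (h : Maps φ a b)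
    (h' : Maps φ a b') : T.Eqv b b' := by
  have h1 := Hom.at_single φ a b b'
  rw [show at₂ P _ a b = ⊤ from h, show at₂ P _ a b' = ⊤ from h', top_inf_eq] at h1
  exact top_le_iff.1 h1

theorem maps_id {a b : Γ ⟶ S.carrier} : Maps (𝟙 S) a b ↔ S.Eqv a b := Iff.rfl

variable [HasFullComprehensions P]

theorem exists_maps (φ : S ⟶ T) (a : Γ ⟶ S.carrier) :
    ∃ (Δ : C) (s : Δ ⟶ Γ) (_ : PCover P s) (b : Δ ⟶ T.carrier), Maps φ (s ≫ a) b := by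
  refine sat₁_ex.1 ?_
  rw [top_le_iff.1 (Hom.total φ)]
  exact sat₁_top a

/-- An arrow of `ER P` from a relation that is functional for forcing. -/
def homOfSat (S T : ER P) (φ : Fib P (S.carrier ⨯ T.carrier))
    (left : ∀ {Γ : C} (a a' : Γ ⟶ S.carrier) (b : Γ ⟶ T.carrier),
      S.Eqv a a' → Sat P φ a' b → Sat P φ a b)
    (right : ∀ {Γ : C} (a : Γ ⟶ S.carrier) (b b' : Γ ⟶ T.carrier),
      Sat P φ a b → T.Eqv b b' → Sat P φ a b')
    (single : ∀ {Γ : C} (a : Γ ⟶ S.carrier) (b b' : Γ ⟶ T.carrier),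
      Sat P φ a b → Sat P φ a b' → T.Eqv b b')
    (total : ∀ {Γ : C} (a : Γ ⟶ S.carrier),
      ∃ (Δ : C) (s : Δ ⟶ Γ) (_ : PCover P s) (b : Δ ⟶ T.carrier), Sat P φ (s ≫ a) b) :
    S ⟶ T :=
  show Hom S T from
  { rel := φ
    left_ext := le_of_sat₃ left
    right_ext := le_of_sat₃ right
    single_valued := of_single fun a b b' => le_of_sat₁ fun s hs => by
      rw [sat₁_inf, sat₁_at₂, sat₁_at₂] at hs
      exact sat₁_at₂.2 (single _ _ _ hs.1 hs.2)
    total := by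
      have h := sat₁_ex.2 (total (𝟙 S.carrier))
      rw [Sat₁, re_id] at h
      exact h.ge }

/-- Inclusion of functional relations is equality. -/
theorem hom_ext {φ ψ : S ⟶ T}
    (h : ∀ {Γ : C} (a : Γ ⟶ S.carrier) (b : Γ ⟶ T.carrier), Maps φ a b → Maps ψ a b) : φ = ψ := by
  refine Hom.ext (le_antisymm (le_of_sat h) (le_of_sat fun a b hab => ?_))
  obtain ⟨Δ, s, hs, b', hb'⟩ := exists_maps φ a
  exact hs.sat (hb'.right ((h _ _ hb').single (hab.pull s)))

theorem maps_comp {φ : S ⟶ T} {ψ : T ⟶ U} {a : Γ ⟶ S.carrier} {e : Γ ⟶ U.carrier} :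
    Maps (φ ≫ ψ) a e ↔ ∃ (Δ : C) (s : Δ ⟶ Γ) (_ : PCover P s) (b : Δ ⟶ T.carrier),
      Maps φ (s ≫ a) b ∧ Maps ψ b (s ≫ e) := sat_compRel

theorem Maps.comp {φ : S ⟶ T} {ψ : T ⟶ U} {a : Γ ⟶ S.carrier} {b : Γ ⟶ T.carrier}
    {e : Γ ⟶ U.carrier} (h : Maps φ a b) (h' : Maps ψ b e) : Maps (φ ≫ ψ) a e :=
  maps_comp.2 ⟨Γ, 𝟙 Γ, PCover.id Γ, b, by rwa [Category.id_comp], by rwa [Category.id_comp]⟩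

theorem maps_comp_iff {φ : S ⟶ T} {ψ : T ⟶ U} {a : Γ ⟶ S.carrier} {b : Γ ⟶ T.carrier}
    {e : Γ ⟶ U.carrier} (h : Maps φ a b) : Maps (φ ≫ ψ) a e ↔ Maps ψ b e := by
  refine ⟨fun h' => ?_, h.comp⟩
  obtain ⟨Δ, s, hs, b', hb, hb'⟩ := maps_comp.1 h'
  exact hs.sat (hb'.left ((h.pull s).single hb))

/-- An arrow of the base respects the equivalence relations of `S` and `T`. -/
def Respects (S T : ER P) (f : S.carrier ⟶ T.carrier) : Prop :=
  ∀ ⦃Γ : C⦄ (a a' : Γ ⟶ S.carrier), S.Eqv a a' → T.Eqv (a ≫ f) (a' ≫ f)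

/-- An arrow of the base that respects the equivalence relations induces an arrow of `ER P`. -/
def ofMap (S T : ER P) (f : S.carrier ⟶ T.carrier) (hf : Respects S T f) : S ⟶ T :=
  homOfSat S T (re P (prod.map f (𝟙 T.carrier)) T.rel)
    (by
      intro Γ a a' b h h'
      rw [sat_re_map, Category.comp_id] at h' ⊢
      exact (hf _ _ h).trans h')
    (by
      intro Γ a b b' h h'
      rw [sat_re_map, Category.comp_id] at h ⊢
      exact Eqv.trans h h')
    (by
      intro Γ a b b' h h'
      rw [sat_re_map, Category.comp_id] at h h'
      exact (Eqv.symm h).trans h')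
    (by
      intro Γ a
      refine ⟨Γ, 𝟙 Γ, PCover.id Γ, a ≫ f, ?_⟩
      rw [sat_re_map, Category.comp_id, Category.id_comp]
      exact Eqv.refl _)

theorem maps_ofMap {f : S.carrier ⟶ T.carrier} {hf : Respects S T f}
    {a : Γ ⟶ S.carrier} {b : Γ ⟶ T.carrier} : Maps (ofMap S T f hf) a b ↔ T.Eqv (a ≫ f) b := by
  refine Iff.trans sat_re_map ?_
  rw [Category.comp_id]; rfl

theorem maps_ofMap_self {f : S.carrier ⟶ T.carrier} {hf : Respects S T f}
    (a : Γ ⟶ S.carrier) : Maps (ofMap S T f hf) a (a ≫ f) := maps_ofMap.2 (Eqv.refl _)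

theorem maps_ofMap_comp {f : S.carrier ⟶ T.carrier} {hf : Respects S T f} {ψ : T ⟶ U}
    {a : Γ ⟶ S.carrier} {e : Γ ⟶ U.carrier} :
    Maps (ofMap S T f hf ≫ ψ) a e ↔ Maps ψ (a ≫ f) e := maps_comp_iff (maps_ofMap_self a)

end Forcing

/-! ### Lifting along jointly injective pairs -/

section Lifting

variable [IsExistential P] [HasFullComprehensions P] {S S₁ S₂ T E : ER P}

/-- A pair of arrows out of `T` is jointly injective on generalized elements. -/
def JointlyInjective (ψ₁ : T ⟶ S₁) (ψ₂ : T ⟶ S₂) : Prop :=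
  ∀ ⦃Γ : C⦄ (t t' : Γ ⟶ T.carrier) (a : Γ ⟶ S₁.carrier) (b : Γ ⟶ S₂.carrier),
    Maps ψ₁ t a → Maps ψ₁ t' a → Maps ψ₂ t b → Maps ψ₂ t' b → T.Eqv t t'

theorem JointlyInjective.hom_ext {ψ₁ : T ⟶ S₁} {ψ₂ : T ⟶ S₂} (h : JointlyInjective ψ₁ ψ₂)
    {g g' : E ⟶ T} (h₁ : g ≫ ψ₁ = g' ≫ ψ₁) (h₂ : g ≫ ψ₂ = g' ≫ ψ₂) : g = g' := by
  refine ER.hom_ext fun {Γ} e t hg => ?_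
  obtain ⟨Δ, s, hs, t', hg'⟩ := exists_maps g' e
  obtain ⟨Δ₁, s₁, hs₁, a, ha⟩ := exists_maps ψ₁ (s ≫ t)
  obtain ⟨Δ₂, s₂, hs₂, b, hb⟩ := exists_maps ψ₂ (s₁ ≫ s ≫ t)
  refine (hs.comp (hs₁.comp hs₂)).sat ?_
  simp only [Category.assoc]
  have hg1 := ((hg.pull s).pull s₁).pull s₂
  have hg2 := (hg'.pull s₁).pull s₂
  have ha1 := ha.pull s₂
  have ha2 : Maps ψ₁ (s₂ ≫ s₁ ≫ t') (s₂ ≫ a) := by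
    rw [← maps_comp_iff hg2, ← h₁, maps_comp_iff hg1]; exact ha1
  have hb2 : Maps ψ₂ (s₂ ≫ s₁ ≫ t') b := by
    rw [← maps_comp_iff hg2, ← h₂, maps_comp_iff hg1]; exact hb
  exact hg2.right (h _ _ _ _ ha2 ha1 hb2 hb)

/-- A pair of arrows lifts along a jointly injective pair if it does so locally. -/
theorem JointlyInjective.exists_lift {ψ₁ : T ⟶ S₁} {ψ₂ : T ⟶ S₂} (h : JointlyInjective ψ₁ ψ₂)
    (χ₁ : E ⟶ S₁) (χ₂ : E ⟶ S₂)
    (hχ : ∀ {Γ : C} (e : Γ ⟶ E.carrier) (a : Γ ⟶ S₁.carrier) (b : Γ ⟶ S₂.carrier),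
      Maps χ₁ e a → Maps χ₂ e b → ∃ (Δ : C) (s : Δ ⟶ Γ) (_ : PCover P s) (t : Δ ⟶ T.carrier),
        Maps ψ₁ t (s ≫ a) ∧ Maps ψ₂ t (s ≫ b)) :
    ∃ g : E ⟶ T, g ≫ ψ₁ = χ₁ ∧ g ≫ ψ₂ = χ₂ := by
  -- `γ` relates `e` and `t` when they have common values under both legs.
  let γ : Fib P (E.carrier ⨯ T.carrier) :=
    compRel (Hom.rel χ₁) (swap (Hom.rel ψ₁)) ⊓ compRel (Hom.rel χ₂) (swap (Hom.rel ψ₂))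
  have key : ∀ {Γ : C} (e : Γ ⟶ E.carrier) (t : Γ ⟶ T.carrier),
      Sat P γ e t ↔
      ∃ (Δ : C) (s : Δ ⟶ Γ) (_ : PCover P s) (a : Δ ⟶ S₁.carrier) (b : Δ ⟶ S₂.carrier),
        (Maps χ₁ (s ≫ e) a ∧ Maps ψ₁ (s ≫ t) a) ∧ (Maps χ₂ (s ≫ e) b ∧ Maps ψ₂ (s ≫ t) b) := by
    intro Γ e t
    rw [sat_inf]
    constructor
    · rintro ⟨h₁, h₂⟩
      obtain ⟨Δ, s, hs, a, ha, ha'⟩ := sat_compRel.1 h₁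
      obtain ⟨Δ', s', hs', b, hb, hb'⟩ := sat_compRel.1 (h₂.pull s)
      refine ⟨Δ', s' ≫ s, hs.comp hs', s' ≫ a, b, ?_⟩
      simp only [Category.assoc]
      exact ⟨⟨Sat.pull ha s', (sat_swap.1 ha').pull s'⟩, hb, sat_swap.1 hb'⟩
    · rintro ⟨Δ, s, hs, a, b, ⟨ha, ha'⟩, ⟨hb, hb'⟩⟩
      exact ⟨sat_compRel.2 ⟨Δ, s, hs, a, ha, sat_swap.2 ha'⟩,
        sat_compRel.2 ⟨Δ, s, hs, b, hb, sat_swap.2 hb'⟩⟩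
  have single : ∀ {Γ : C} (e : Γ ⟶ E.carrier) (t t' : Γ ⟶ T.carrier),
      Sat P γ e t →
      Sat P γ e t' →
      T.Eqv t t' := by
    intro Γ e t t' ht ht'
    obtain ⟨Δ, s, hs, a, b, ⟨ha, ha'⟩, ⟨hb, hb'⟩⟩ := (key _ _).1 ht
    obtain ⟨Δ₁, s₁, hs₁, a₁, b₁, ⟨ha₁, ha₁'⟩, ⟨hb₁, hb₁'⟩⟩ := (key _ _).1 (ht'.pull s)
    refine (hs.comp hs₁).sat ?_
    simp only [Category.assoc]
    exact h _ _ _ _ (ha'.pull s₁) (ha₁'.right (ha₁.single (ha.pull s₁))) (hb'.pull s₁)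
      (hb₁'.right (hb₁.single (hb.pull s₁)))
  let g : E ⟶ T := homOfSat E T γ
    (fun e e' t he hg => by
      obtain ⟨Δ, s, hs, a, b, ⟨ha, ha'⟩, ⟨hb, hb'⟩⟩ := (key _ _).1 hg
      exact (key _ _).2 ⟨Δ, s, hs, a, b, ⟨ha.left (he.pull s), ha'⟩, ⟨hb.left (he.pull s), hb'⟩⟩)
    (fun e t t' hg ht => by
      obtain ⟨Δ, s, hs, a, b, ⟨ha, ha'⟩, ⟨hb, hb'⟩⟩ := (key _ _).1 hg
      exact (key _ _).2 ⟨Δ, s, hs, a, b, ⟨ha, ha'.left (ht.pull s).symm⟩,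
        ⟨hb, hb'.left (ht.pull s).symm⟩⟩)
    single
    (fun e => by
      obtain ⟨Δ₁, s₁, hs₁, a, ha⟩ := exists_maps χ₁ e
      obtain ⟨Δ₂, s₂, hs₂, b, hb⟩ := exists_maps χ₂ (s₁ ≫ e)
      obtain ⟨Δ, s, hs, t, ht, ht'⟩ := hχ _ _ _ (ha.pull s₂) hb
      refine ⟨Δ, s ≫ s₂ ≫ s₁, (hs₁.comp hs₂).comp hs, t, (key _ _).2 ⟨Δ, 𝟙 Δ, PCover.id _,
        s ≫ s₂ ≫ a, s ≫ b, ?_⟩⟩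
      simp only [Category.id_comp, Category.assoc]
      exact ⟨⟨(ha.pull s₂).pull s, ht⟩, ⟨hb.pull s, ht'⟩⟩)
  refine ⟨g, ER.hom_ext fun e a hm => ?_, ER.hom_ext fun e b hm => ?_⟩ <;>
    obtain ⟨Δ, s, hs, t, ht, ht'⟩ := maps_comp.1 hm <;>
    obtain ⟨Δ₁, s₁, hs₁, a₁, b₁, ⟨ha, ha'⟩, ⟨hb, hb'⟩⟩ := (key _ _).1 ht <;>
    refine (hs.comp hs₁).sat ?_ <;>
    simp only [Category.assoc]
  · exact ha.right (ha'.single (ht'.pull s₁))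
  · exact hb.right (hb'.single (ht'.pull s₁))

end Lifting

end ER

/-! ### Categories with stable images -/

/-- Every arrow factors as a strong epimorphism followed by a monomorphism, and strong epimorphisms
are stable under pullback. No terminal object is required, so this is weaker than regularity. -/
class HasStableImages (Y : Type u) [Category.{v} Y] : Prop where
  exists_fac : ∀ {A B : Y} (f : A ⟶ B),
    ∃ (I : Y) (e : A ⟶ I) (m : I ⟶ B), StrongEpi e ∧ Mono m ∧ e ≫ m = f
  strongEpi_of_isPullback : ∀ {T A B D : Y} {p : T ⟶ A} {q : T ⟶ B} {f : A ⟶ D} {g : B ⟶ D},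
    IsPullback p q f g → StrongEpi g → StrongEpi p

theorem isRegularEpi_iff_strongEpi {X : Type u} [Category.{v} X] [Regular X] {A B : X}
    (f : A ⟶ B) : IsRegularEpi f ↔ StrongEpi f :=
  ⟨fun _ => inferInstance, fun _ => inferInstance⟩

instance {X : Type u} [Category.{v} X] [Regular X] : HasStableImages X where
  exists_fac f := ⟨_, (Regular.strongEpiMonoFactorisation f).e,
    (Regular.strongEpiMonoFactorisation f).m, inferInstance, inferInstance,
    (Regular.strongEpiMonoFactorisation f).fac⟩
  strongEpi_of_isPullback h hg := by
    rw [← isRegularEpi_iff_strongEpi] at hg ⊢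
    exact Regular.regularEpiIsStableUnderBaseChange.of_isPullback h.flip hg

/-! ### The doctrine of subobjects -/

namespace Sub

variable {Y : Type u} [Category.{v} Y] [HasPullbacks Y]

/-- The subobject represented by a monomorphism, as an element of a fibre of the doctrine of
subobjects. -/
def mk {A B : Y} (m : B ⟶ A) [Mono m] : Fib (SubDoctrine Y) A := Subobject.mk m

/-- The domain of a representative of a subobject. -/
def dom {A : Y} (S : Fib (SubDoctrine Y) A) : Y := Subobject.underlying.obj (show Subobject A from S)

/-- A monomorphism representing a subobject. -/
def arr {A : Y} (S : Fib (SubDoctrine Y) A) : dom S ⟶ A := Subobject.arrow (X := A) S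

instance {A : Y} (S : Fib (SubDoctrine Y) A) : Mono (arr S) := Subobject.arrow_mono (X := A) S

/-- A generalized element of `A` belongs to a subobject of `A`. -/
def Mem {A Z : Y} (S : Fib (SubDoctrine Y) A) (x : Z ⟶ A) : Prop := ∃ k : Z ⟶ dom S, k ≫ arr S = x

theorem mem_iff_factors {A Z : Y} {S : Fib (SubDoctrine Y) A} {x : Z ⟶ A} :
    Mem S x ↔ Subobject.Factors (X := Z) (Y := A) S x :=
  ⟨fun ⟨k, hk⟩ => (Subobject.factors_iff (Y := A) S x).2 ⟨k, hk⟩,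
    fun h => ⟨Subobject.factorThru (Y := A) S x h, Subobject.factorThru_arrow (Y := A) S x h⟩⟩

theorem mem_arr {A : Y} (S : Fib (SubDoctrine Y) A) : Mem S (arr S) := ⟨𝟙 _, Category.id_comp _⟩

theorem Mem.pull {A Z Z' : Y} {S : Fib (SubDoctrine Y) A} {x : Z ⟶ A} (h : Mem S x)
    (s : Z' ⟶ Z) : Mem S (s ≫ x) := by
  obtain ⟨k, rfl⟩ := h
  exact ⟨s ≫ k, Category.assoc _ _ _⟩

theorem le_iff {A : Y} {S T : Fib (SubDoctrine Y) A} :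
    S ≤ T ↔ ∀ {Z : Y} (x : Z ⟶ A), Mem S x → Mem T x :=
  ⟨fun h _ _ hx => mem_iff_factors.2 (Subobject.factors_of_le _ h (mem_iff_factors.1 hx)),
    fun h => Subobject.le_of_factors (mem_iff_factors.1 (h _ (mem_arr S)))⟩

theorem Mem.mono {A Z : Y} {S T : Fib (SubDoctrine Y) A} {x : Z ⟶ A} (hx : Mem S x)
    (h : S ≤ T) : Mem T x := le_iff.1 h x hx

protected theorem ext {A : Y} {S T : Fib (SubDoctrine Y) A}
    (h : ∀ {Z : Y} (x : Z ⟶ A), Mem S x ↔ Mem T x) : S = T :=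
  le_antisymm (le_iff.2 fun x => (h x).1) (le_iff.2 fun x => (h x).2)

theorem mem_mk {A B Z : Y} {m : B ⟶ A} [Mono m] {x : Z ⟶ A} :
    Mem (mk m) x ↔ ∃ k : Z ⟶ B, k ≫ m = x :=
  mem_iff_factors.trans (Subobject.mk_factors_iff m x)

theorem mem_re {A B Z : Y} {f : A ⟶ B} {S : Fib (SubDoctrine Y) B} {x : Z ⟶ A} :
    Mem (re (SubDoctrine Y) f S) x ↔ Mem S (x ≫ f) := by
  obtain ⟨p, hp⟩ : ∃ p : dom (re (SubDoctrine Y) f S) ⟶ dom S,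
      IsPullback p (arr (re (SubDoctrine Y) f S)) (arr S) f := ⟨_, Subobject.isPullback f S⟩
  constructor
  · rintro ⟨k, rfl⟩
    exact ⟨k ≫ p, by rw [Category.assoc, Category.assoc, hp.w]⟩
  · rintro ⟨k, hk⟩
    exact ⟨hp.lift k x hk, hp.lift_snd _ _ _⟩

theorem mem_inf {A Z : Y} {S T : Fib (SubDoctrine Y) A} {x : Z ⟶ A} :
    Mem (S ⊓ T) x ↔ Mem S x ∧ Mem T x := by
  rw [mem_iff_factors, mem_iff_factors, mem_iff_factors]
  exact Subobject.inf_factors (B := A) x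

theorem mem_top {A Z : Y} (x : Z ⟶ A) : Mem (⊤ : Fib (SubDoctrine Y) A) x :=
  mem_iff_factors.2 (Subobject.top_factors x)

theorem eq_top {A : Y} {S : Fib (SubDoctrine Y) A} (h : Mem S (𝟙 A)) : S = ⊤ :=
  top_le_iff.1 (le_iff.2 fun x _ => by
    rw [← Category.comp_id x]; exact h.pull x)

/-- Membership in a subobject may be checked after precomposition with a strong epimorphism. -/
theorem mem_of_strongEpi {A Z Z' : Y} {S : Fib (SubDoctrine Y) A} (s : Z' ⟶ Z) [StrongEpi s]
    {x : Z ⟶ A} (h : Mem S (s ≫ x)) : Mem S x := by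
  obtain ⟨k, hk⟩ := h
  have sq : CommSq k s (arr S) x := ⟨hk⟩
  exact ⟨sq.lift, sq.fac_right⟩

section Exists

variable [HasStableImages Y]

theorem exists_gc {A B : Y} (f : A ⟶ B) :
    ∃ E : Fib (SubDoctrine Y) A → Fib (SubDoctrine Y) B,
      GaloisConnection E (re (SubDoctrine Y) f) := by
  have h : ∀ S : Fib (SubDoctrine Y) A, ∃ T : Fib (SubDoctrine Y) B, ∀ V : Fib (SubDoctrine Y) B,
      T ≤ V ↔ S ≤ re (SubDoctrine Y) f V := by
    intro S
    obtain ⟨I, e, m, he, hm, hf⟩ := HasStableImages.exists_fac (arr S ≫ f)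
    refine ⟨mk m, fun V => ?_⟩
    simp only [le_iff, mem_re]
    constructor
    · rintro h Z x ⟨k, rfl⟩
      rw [Category.assoc, ← hf]
      exact h _ (mem_mk.2 ⟨k ≫ e, Category.assoc _ _ _⟩)
    · intro h Z x hx
      obtain ⟨k, rfl⟩ := mem_mk.1 hx
      have h1 := h _ (mem_arr S)
      rw [← hf] at h1
      exact (mem_of_strongEpi e h1).pull k
  choose E hE using h
  exact ⟨E, hE⟩

theorem ex_gc {A B : Y} (f : A ⟶ B) :
    GaloisConnection (ex (SubDoctrine Y) f) (re (SubDoctrine Y) f) :=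
  Classical.epsilon_spec (exists_gc f)

/-- Membership in the image of a subobject. -/
theorem mem_ex {A B Z : Y} {f : A ⟶ B} {S : Fib (SubDoctrine Y) A} {y : Z ⟶ B} :
    Mem (ex (SubDoctrine Y) f S) y ↔
      ∃ (Z' : Y) (s : Z' ⟶ Z) (_ : StrongEpi s) (x : Z' ⟶ A), Mem S x ∧ x ≫ f = s ≫ y := by
  constructor
  · intro h
    obtain ⟨I, e, m, he, hm, hf⟩ := HasStableImages.exists_fac (arr S ≫ f)
    have h1 : ex (SubDoctrine Y) f S ≤ mk m := by
      refine (ex_gc f _ _).2 (le_iff.2 fun x hx => mem_re.2 ?_)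
      obtain ⟨k, rfl⟩ := hx
      exact mem_mk.2 ⟨k ≫ e, by rw [Category.assoc, hf, Category.assoc]⟩
    obtain ⟨k, hk⟩ := mem_mk.1 (h.mono h1)
    refine ⟨_, pullback.fst k e, HasStableImages.strongEpi_of_isPullback
      (IsPullback.of_hasPullback k e) he, pullback.snd k e ≫ arr S, (mem_arr S).pull _, ?_⟩
    rw [Category.assoc, ← hf, ← pullback.condition_assoc, hk]
  · rintro ⟨Z', s, hs, x, hx, hxy⟩
    refine mem_of_strongEpi s ?_
    rw [← hxy, ← mem_re]
    exact hx.mono ((ex_gc f).le_u_l S)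

end Exists

section Elementary

variable [HasBinaryProducts Y]

theorem mem_mk_diag {A Z : Y} {w : Z ⟶ A ⨯ A} :
    Mem (mk (diag A)) w ↔ w ≫ prod.fst = w ≫ prod.snd := by
  rw [mem_mk]
  constructor
  · rintro ⟨k, rfl⟩
    rw [Category.assoc, Category.assoc, prod.lift_fst, prod.lift_snd]
  · intro h
    exact ⟨w ≫ prod.fst, Limits.prod.hom_ext (by simp [prod.lift_fst]) (by simp [prod.lift_snd, h])⟩

theorem isEqualityPredicate_diag (A : Y) :
    IsEqualityPredicate (SubDoctrine Y) A (mk (diag A)) where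
  diag_adj S T := by
    rw [le_iff, le_iff]
    simp only [mem_inf, mem_re, mem_mk_diag]
    constructor
    · intro h Z x hx
      refine h _ ⟨?_, ?_⟩ <;> simp [prod.lift_fst, prod.lift_snd, hx]
    · rintro h Z x ⟨hx, e⟩
      have := h _ hx
      rwa [prod.comp_lift, Category.comp_id,
        show prod.lift (x ≫ prod.fst) (x ≫ prod.fst) = x from
          Limits.prod.hom_ext (prod.lift_fst _ _) ((prod.lift_snd _ _).trans e)] at this
  param_adj X S T := by
    rw [le_iff, le_iff]
    simp only [mem_inf, mem_re, mem_mk_diag]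
    constructor
    · intro h Z x hx
      refine h _ ⟨?_, ?_⟩ <;> simp [prod.lift_fst, prod.lift_snd, prod.lift_fst_assoc, hx]
    · rintro h Z x ⟨hx, e⟩
      have := h _ hx
      simp only [prod.comp_lift, prod.lift_fst, prod.lift_snd] at e
      rwa [prod.comp_lift, Category.comp_id, Category.assoc,
        show prod.lift (x ≫ prod.fst) (x ≫ prod.fst ≫ prod.snd) = x from
          Limits.prod.hom_ext (prod.lift_fst _ _) ((prod.lift_snd _ _).trans e)] at this

instance : IsElementary (SubDoctrine Y) where
  exists_equality A := ⟨_, isEqualityPredicate_diag A⟩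

theorem mem_delta {A Z : Y} {w : Z ⟶ A ⨯ A} :
    Mem (delta (SubDoctrine Y) A) w ↔ w ≫ prod.fst = w ≫ prod.snd := by
  have h := (delta_spec (SubDoctrine Y) A).diag_adj
  have h' := (isEqualityPredicate_diag A).diag_adj
  have e : delta (SubDoctrine Y) A = mk (diag A) := by
    have : re (SubDoctrine Y) (prod.fst : A ⨯ A ⟶ A) ⊤ ⊓ delta (SubDoctrine Y) A =
      re (SubDoctrine Y) (prod.fst : A ⨯ A ⟶ A) ⊤ ⊓ mk (diag A) := h.l_unique h' fun _ => rfl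
    simpa only [map_top, top_inf_eq] using this
  rw [e, mem_mk_diag]

end Elementary

instance : HasFullComprehensions (SubDoctrine Y) where
  exists_comprehension S := by
    refine ⟨_, arr S, eq_top ?_, fun f hf => ?_⟩
    · rw [mem_re, Category.id_comp]
      exact mem_arr S
    · have h : Mem (re (SubDoctrine Y) f S) (𝟙 _) := hf ▸ mem_top _
      rw [mem_re, Category.id_comp] at h
      obtain ⟨k, hk⟩ := h
      exact ⟨k, hk, fun g hg => by
        rw [← cancel_mono (arr S), hk]; exact hg⟩
  full {A X Z S T c d} hc hd := by
    rintro ⟨g, rfl⟩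
    have h : Mem (re (SubDoctrine Y) d T) g := hd.re_eq_top ▸ mem_top _
    rw [mem_re] at h
    have h1 : re (SubDoctrine Y) (arr S) S = ⊤ := eq_top (by
      rw [mem_re, Category.id_comp]
      exact mem_arr S)
    obtain ⟨k, hk, -⟩ := hc.existsUnique_lift _ h1
    refine le_iff.2 fun x hx => ?_
    obtain ⟨l, rfl⟩ := hx
    rw [← hk]
    exact (h.pull k).pull l

instance [HasStableImages Y] : IsExistential (SubDoctrine Y) where
  exists_adj f _ := exists_gc f
  beck_chevalley {X' A' X A pr' f' f pr} hp _ S := by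
    refine Sub.ext fun y => ?_
    rw [mem_re, mem_ex, mem_ex]
    constructor
    · rintro ⟨Z', s, hs, x, hx, hxy⟩
      refine ⟨Z', s, hs, x ≫ f', mem_re.1 hx, ?_⟩
      rw [Category.assoc, ← hp.w, reassoc_of% hxy]
    · rintro ⟨Z', s, hs, x, hx, hxy⟩
      refine ⟨Z', s, hs, hp.lift (s ≫ y) x (by rw [Category.assoc, hxy]), mem_re.2 ?_, ?_⟩
      · rwa [hp.lift_snd]
      · rw [hp.lift_fst]
  frobenius pr _ S T := by
    refine Sub.ext fun y => ?_
    rw [mem_inf, mem_ex, mem_ex]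
    constructor
    · rintro ⟨Z', s, hs, x, hx, hxy⟩
      rw [mem_inf, mem_re, hxy] at hx
      exact ⟨mem_of_strongEpi s hx.1, Z', s, hs, x, hx.2, hxy⟩
    · rintro ⟨hy, Z', s, hs, x, hx, hxy⟩
      refine ⟨Z', s, hs, x, ?_, hxy⟩
      rw [mem_inf, mem_re, hxy]
      exact ⟨hy.pull s, hx⟩

instance [HasBinaryProducts Y] [HasStableImages Y] : IsCEED (SubDoctrine Y) where

end Sub

namespace ER

variable {C : Type u} [Category.{v} C] [HasBinaryProducts C] {P : Doctrine.{w} C}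
  [IsExistential P] [HasFullComprehensions P]

/-! ### Products and pullbacks of equivalence relations -/

section Limits

variable {S T U E : ER P} {Γ : C}

/-- The restriction of the equivalence relation of `S` along an arrow of the base. -/
abbrev restrict (S : ER P) {X : C} (f : X ⟶ S.carrier) : ER P :=
  ofSat X (re P (prod.map f f) S.rel) (fun _ => sat_re_map.2 (Eqv.refl _))
    (fun _ _ h => sat_re_map.2 (Eqv.symm (sat_re_map.1 h)))
    (fun _ _ _ h h' => sat_re_map.2 (Eqv.trans (sat_re_map.1 h) (sat_re_map.1 h')))

theorem eqv_restrict {X : C} {f : X ⟶ S.carrier} {a b : Γ ⟶ X} :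
    (restrict S f).Eqv a b ↔ S.Eqv (a ≫ f) (b ≫ f) := sat_re_map

/-- The monomorphism `restrict S f ⟶ S` induced by `f`. -/
def restrictι (S : ER P) {X : C} (f : X ⟶ S.carrier) : restrict S f ⟶ S :=
  ofMap (restrict S f) S f fun _ _ _ h => eqv_restrict.1 h

theorem maps_restrictι {X : C} {f : X ⟶ S.carrier} {a : Γ ⟶ X} {b : Γ ⟶ S.carrier} :
    Maps (restrictι S f) a b ↔ S.Eqv (a ≫ f) b := maps_ofMap

/-- The product of two equivalence relations. -/
abbrev prodObj (S T : ER P) : ER P :=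
  ofSat (S.carrier ⨯ T.carrier)
    (re P (prod.map prod.fst prod.fst) S.rel ⊓ re P (prod.map prod.snd prod.snd) T.rel)
    (fun a => by
      rw [sat_inf, sat_re_map, sat_re_map]
      exact ⟨Eqv.refl _, Eqv.refl _⟩)
    (fun a b => by
      simp only [sat_inf, sat_re_map]
      exact fun h => ⟨Eqv.symm h.1, Eqv.symm h.2⟩)
    (fun a b d => by
      simp only [sat_inf, sat_re_map]
      exact fun h h' => ⟨Eqv.trans h.1 h'.1, Eqv.trans h.2 h'.2⟩)

theorem eqv_prodObj {a b : Γ ⟶ S.carrier ⨯ T.carrier} : (prodObj S T).Eqv a b ↔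
    S.Eqv (a ≫ prod.fst) (b ≫ prod.fst) ∧ T.Eqv (a ≫ prod.snd) (b ≫ prod.snd) := by
  refine sat_inf.trans ?_
  rw [sat_re_map, sat_re_map]; rfl

/-- The first projection of the product. -/
def prodFst (S T : ER P) : prodObj S T ⟶ S :=
  ofMap (prodObj S T) S prod.fst fun _ _ _ h => (eqv_prodObj.1 h).1

/-- The second projection of the product. -/
def prodSnd (S T : ER P) : prodObj S T ⟶ T :=
  ofMap (prodObj S T) T prod.snd fun _ _ _ h => (eqv_prodObj.1 h).2

theorem jointlyInjective_prod : JointlyInjective (prodFst S T) (prodSnd S T) := by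
  intro Γ t t' a b h₁ h₁' h₂ h₂'
  exact eqv_prodObj.2 ⟨(maps_ofMap.1 h₁).trans (maps_ofMap.1 h₁').symm,
    (maps_ofMap.1 h₂).trans (maps_ofMap.1 h₂').symm⟩

/-- A span is a product diagram if its legs are jointly injective and pairs of generalized elements
lift locally. -/
theorem isLimit_of_jointlyInjective {p : E ⟶ S} {q : E ⟶ T} (hinj : JointlyInjective p q)
    (h : ∀ {Γ : C} (a : Γ ⟶ S.carrier) (b : Γ ⟶ T.carrier),
      ∃ (Δ : C) (s : Δ ⟶ Γ) (_ : PCover P s) (t : Δ ⟶ E.carrier),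
        Maps p t (s ≫ a) ∧ Maps q t (s ≫ b)) : Nonempty (IsLimit (BinaryFan.mk p q)) := by
  have hl : ∀ {V : ER P} (f : V ⟶ S) (g : V ⟶ T), ∃ l : V ⟶ E, l ≫ p = f ∧ l ≫ q = g :=
    fun {V} f g => hinj.exists_lift f g fun _ a b _ _ => h a b
  exact ⟨BinaryFan.isLimitMk (fun s => (hl s.fst s.snd).choose)
    (fun s => (hl s.fst s.snd).choose_spec.1) (fun s => (hl s.fst s.snd).choose_spec.2)
    fun s m h₁ h₂ => hinj.hom_ext (h₁.trans (hl s.fst s.snd).choose_spec.1.symm)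
      (h₂.trans (hl s.fst s.snd).choose_spec.2.symm)⟩

theorem isLimit_prod (S T : ER P) :
    Nonempty (IsLimit (BinaryFan.mk (prodFst S T) (prodSnd S T))) :=
  isLimit_of_jointlyInjective jointlyInjective_prod fun a b => ⟨_, 𝟙 _, PCover.id _, prod.lift a b,
    maps_ofMap.2 (by rw [prod.lift_fst, Category.id_comp]; exact Eqv.refl _),
    maps_ofMap.2 (by rw [prod.lift_snd, Category.id_comp]; exact Eqv.refl _)⟩

instance : HasBinaryProducts (ER P) :=
  have : ∀ {S T : ER P}, HasLimit (pair S T) := fun {S T} => ⟨⟨⟨_, (isLimit_prod S T).some⟩⟩⟩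
  hasBinaryProducts_of_hasLimit_pair _

/-- A square is a pullback if its legs are jointly injective and compatible generalized elements
lift locally. -/
theorem isPullback_of_jointlyInjective {p : E ⟶ S} {q : E ⟶ T} {φ : S ⟶ U} {ψ : T ⟶ U}
    (w : p ≫ φ = q ≫ ψ) (hinj : JointlyInjective p q)
    (h : ∀ {Γ : C} (a : Γ ⟶ S.carrier) (b : Γ ⟶ T.carrier) (d : Γ ⟶ U.carrier),
      Maps φ a d → Maps ψ b d → ∃ (Δ : C) (s : Δ ⟶ Γ) (_ : PCover P s) (t : Δ ⟶ E.carrier),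
        Maps p t (s ≫ a) ∧ Maps q t (s ≫ b)) : IsPullback p q φ ψ := by
  have hl : ∀ {V : ER P} (f : V ⟶ S) (g : V ⟶ T), f ≫ φ = g ≫ ψ →
      ∃ l : V ⟶ E, l ≫ p = f ∧ l ≫ q = g := fun {V} f g hfg => by
    refine hinj.exists_lift f g fun e a b ha hb => ?_
    obtain ⟨Δ, s, hs, d, hd⟩ := exists_maps φ a
    have h1 : Maps ψ (s ≫ b) d := by
      rw [← maps_comp_iff (hb.pull s), ← hfg]
      exact (ha.pull s).comp hd
    obtain ⟨Δ', s', hs', t, ht, ht'⟩ := h _ _ _ hd h1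
    exact ⟨Δ', s' ≫ s, hs.comp hs', t, by rwa [Category.assoc], by rwa [Category.assoc]⟩
  exact ⟨⟨w⟩, ⟨PullbackCone.IsLimit.mk w (fun s => (hl _ _ s.condition).choose)
    (fun s => (hl _ _ s.condition).choose_spec.1) (fun s => (hl _ _ s.condition).choose_spec.2)
    fun s m h₁ h₂ => hinj.hom_ext (h₁.trans (hl _ _ s.condition).choose_spec.1.symm)
      (h₂.trans (hl _ _ s.condition).choose_spec.2.symm)⟩⟩

/-- The predicate on the product of carriers that describes the pullback of `φ` and `ψ`. -/
def pbRel (φ : S ⟶ U) (ψ : T ⟶ U) : Fib P (S.carrier ⨯ T.carrier) :=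
  compRel (Hom.rel φ) (swap (Hom.rel ψ))

theorem sat_pbRel {φ : S ⟶ U} {ψ : T ⟶ U} {a : Γ ⟶ S.carrier} {b : Γ ⟶ T.carrier} :
    Sat P (pbRel φ ψ) a b ↔ ∃ (Δ : C) (s : Δ ⟶ Γ) (_ : PCover P s) (d : Δ ⟶ U.carrier),
      Maps φ (s ≫ a) d ∧ Maps ψ (s ≫ b) d := by
  refine sat_compRel.trans ?_
  simp only [sat_swap]; rfl

/-- The pullback of `φ` and `ψ`: the restriction of the product along a comprehension. -/
abbrev pbObj (φ : S ⟶ U) (ψ : T ⟶ U) : ER P := restrict (prodObj S T) (cmp P (pbRel φ ψ))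

theorem eqv_pbObj {φ : S ⟶ U} {ψ : T ⟶ U} {a b : Γ ⟶ cmpObj P (pbRel φ ψ)} :
    (pbObj φ ψ).Eqv a b ↔
      S.Eqv (a ≫ cmp P (pbRel φ ψ) ≫ prod.fst) (b ≫ cmp P (pbRel φ ψ) ≫ prod.fst) ∧
      T.Eqv (a ≫ cmp P (pbRel φ ψ) ≫ prod.snd) (b ≫ cmp P (pbRel φ ψ) ≫ prod.snd) := by
  refine (eqv_restrict (S := prodObj S T)).trans (eqv_prodObj.trans ?_)
  simp only [Category.assoc]

/-- The first projection of the pullback. -/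
def pbFst (φ : S ⟶ U) (ψ : T ⟶ U) : pbObj φ ψ ⟶ S :=
  ofMap (pbObj φ ψ) S (cmp P (pbRel φ ψ) ≫ prod.fst) fun _ _ _ h => (eqv_pbObj.1 h).1

/-- The second projection of the pullback. -/
def pbSnd (φ : S ⟶ U) (ψ : T ⟶ U) : pbObj φ ψ ⟶ T :=
  ofMap (pbObj φ ψ) T (cmp P (pbRel φ ψ) ≫ prod.snd) fun _ _ _ h => (eqv_pbObj.1 h).2

theorem isPullback_pb (φ : S ⟶ U) (ψ : T ⟶ U) : IsPullback (pbFst φ ψ) (pbSnd φ ψ) φ ψ := by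
  refine isPullback_of_jointlyInjective ?_ ?_ ?_
  · refine hom_ext fun {Γ} t d h => maps_ofMap_comp.2 ?_
    replace h := maps_ofMap_comp.1 h
    have h1 := sat₁_iff.1 ((sat₁_cmp (pbRel φ ψ)).pull t)
    obtain ⟨Δ, s, hs, d', hd, hd'⟩ := sat_pbRel.1 h1
    simp only [Category.assoc] at hd hd'
    exact hs.sat (hd'.right (hd.single (h.pull s)))
  · intro Γ t t' a b h₁ h₁' h₂ h₂'
    exact eqv_pbObj.2 ⟨(maps_ofMap.1 h₁).trans (maps_ofMap.1 h₁').symm,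
      (maps_ofMap.1 h₂).trans (maps_ofMap.1 h₂').symm⟩
  · intro Γ a b d ha hb
    have h : Sat P (pbRel φ ψ) a b := sat_pbRel.2 ⟨Γ, 𝟙 Γ, PCover.id Γ, d, by
      rw [Category.id_comp, Category.id_comp]; exact ⟨ha, hb⟩⟩
    obtain ⟨t, ht⟩ := Sat₁.exists_lift (sat_iff.1 h)
    refine ⟨Γ, 𝟙 Γ, PCover.id Γ, t, maps_ofMap.2 ?_, maps_ofMap.2 ?_⟩
    · rw [reassoc_of% ht, prod.lift_fst, Category.id_comp]; exact Eqv.refl _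
    · rw [reassoc_of% ht, prod.lift_snd, Category.id_comp]; exact Eqv.refl _

instance : HasPullbacks (ER P) :=
  have : ∀ {S T U : ER P} {φ : S ⟶ U} {ψ : T ⟶ U}, HasLimit (cospan φ ψ) :=
    fun {_ _ _ φ ψ} => (isPullback_pb φ ψ).hasPullback
  hasPullbacks_of_hasLimit_cospan _

end Limits

/-! ### Generalized elements as arrows from discrete objects -/

section Points

variable [IsElementary P] {S T U : ER P} {Γ Δ : C}

theorem Eqv.of_delta {a a' : Γ ⟶ S.carrier} (h : Sat P (delta P S.carrier) a a') : S.Eqv a a' :=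
  Sat.subst (Eqv.refl a) h

/-- The arrow from the discrete object on `Γ` corresponding to a generalized element. -/
def point (S : ER P) (a : Γ ⟶ S.carrier) : (D P).obj Γ ⟶ S :=
  ofMap (ER.diag P Γ) S a fun _ _ _ h => Eqv.of_delta (sat_delta_map a h)

theorem maps_point {a : Γ ⟶ S.carrier} {x : Δ ⟶ Γ} {b : Δ ⟶ S.carrier} :
    Maps (point S a) x b ↔ S.Eqv (x ≫ a) b := maps_ofMap (S := ER.diag P Γ)

theorem D_map_eq_point {A B : C} (f : A ⟶ B) : (D P).map f = point ((D P).obj B) f :=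
  hom_ext fun _ _ h => h

theorem point_comp_eq_point_iff {φ : S ⟶ T} {a : Γ ⟶ S.carrier} {b : Γ ⟶ T.carrier} :
    point S a ≫ φ = point T b ↔ Maps φ a b := by
  constructor
  · intro h
    have h1 : Maps (point S a ≫ φ) (𝟙 Γ) b := by
      rw [h, maps_point, Category.id_comp]; exact Eqv.refl _
    have h2 := (maps_ofMap_comp (S := ER.diag P Γ)).1 h1
    exact (Category.id_comp a) ▸ h2
  · intro h
    refine hom_ext fun x d hx => maps_point.2 ?_
    exact (h.pull x).single ((maps_ofMap_comp (S := ER.diag P Γ)).1 hx)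

theorem point_eq_iff {a b : Γ ⟶ S.carrier} : point S a = point S b ↔ S.Eqv a b := by
  rw [← maps_id, ← point_comp_eq_point_iff, Category.comp_id]

theorem D_map_comp_point (s : Δ ⟶ Γ) (a : Γ ⟶ S.carrier) :
    (D P).map s ≫ point S a = point S (s ≫ a) := by
  rw [D_map_eq_point]
  exact point_comp_eq_point_iff.2 (maps_point.2 (Eqv.refl _))

/-- Every arrow out of a discrete object is locally given by a generalized element. -/
theorem exists_point (k : (D P).obj Γ ⟶ S) :
    ∃ (Δ : C) (s : Δ ⟶ Γ) (_ : PCover P s) (a : Δ ⟶ S.carrier),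
      (D P).map s ≫ k = point S a := by
  obtain ⟨Δ, s, hs, a, ha⟩ := exists_maps k (𝟙 Γ)
  refine ⟨Δ, s, hs, a, ?_⟩
  rw [D_map_eq_point]
  exact point_comp_eq_point_iff.2 ((Category.comp_id s) ▸ ha)

/-- An arrow is a monomorphism only if it is injective on generalized elements. -/
theorem eqv_of_mono (φ : S ⟶ T) [Mono φ] {a a' : Γ ⟶ S.carrier} {b : Γ ⟶ T.carrier}
    (h : Maps φ a b) (h' : Maps φ a' b) : S.Eqv a a' := by
  rw [← point_eq_iff, ← cancel_mono φ, point_comp_eq_point_iff.2 h, point_comp_eq_point_iff.2 h']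

theorem jointlyInjective_self {φ : S ⟶ T}
    (h : ∀ {Γ : C} (a a' : Γ ⟶ S.carrier) (b : Γ ⟶ T.carrier),
      Maps φ a b → Maps φ a' b → S.Eqv a a') : JointlyInjective φ φ :=
  fun _ _ _ a _ ha ha' _ _ => h _ _ a ha ha'

theorem mono_of_eqv {φ : S ⟶ T}
    (h : ∀ {Γ : C} (a a' : Γ ⟶ S.carrier) (b : Γ ⟶ T.carrier),
      Maps φ a b → Maps φ a' b → S.Eqv a a') : Mono φ :=
  ⟨fun _ _ e => (jointlyInjective_self h).hom_ext e e⟩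

/-- An arrow factors through a monomorphism if it does so locally. -/
theorem exists_lift_of_mono (m : S ⟶ T) [Mono m] (χ : U ⟶ T)
    (h : ∀ {Γ : C} (e : Γ ⟶ U.carrier) (b : Γ ⟶ T.carrier), Maps χ e b →
      ∃ (Δ : C) (s : Δ ⟶ Γ) (_ : PCover P s) (a : Δ ⟶ S.carrier), Maps m a (s ≫ b)) :
    ∃ g : U ⟶ S, g ≫ m = χ := by
  obtain ⟨g, hg, -⟩ := (jointlyInjective_self
    (fun a a' b => eqv_of_mono m (a := a) (a' := a') (b := b))).exists_lift χ χ (by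
      intro Γ e a b ha hb
      obtain ⟨Δ, s, hs, t, ht⟩ := h e a ha
      exact ⟨Δ, s, hs, t, ht, ht.right ((ha.single hb).pull s)⟩)
  exact ⟨g, hg⟩

/-- Jointly monic arrows are jointly injective on generalized elements. -/
theorem jointlyInjective_of_hom_ext {E : ER P} {p : E ⟶ S} {q : E ⟶ T}
    (h : ∀ {V : ER P} (f g : V ⟶ E), f ≫ p = g ≫ p → f ≫ q = g ≫ q → f = g) :
    JointlyInjective p q := by
  intro Γ t t' a b h₁ h₁' h₂ h₂'
  rw [← point_eq_iff]
  refine h _ _ ?_ ?_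
  · rw [point_comp_eq_point_iff.2 h₁, point_comp_eq_point_iff.2 h₁']
  · rw [point_comp_eq_point_iff.2 h₂, point_comp_eq_point_iff.2 h₂']

end Points

/-! ### Surjective functional relations -/

section Images

variable [IsElementary P] {S T U : ER P} {Γ Δ : C}

/-- A functional relation is surjective if generalized elements of the target have preimages
locally. -/
def Surj (φ : S ⟶ T) : Prop := ∀ ⦃Γ : C⦄ (b : Γ ⟶ T.carrier),
  ∃ (Δ : C) (s : Δ ⟶ Γ) (_ : PCover P s) (a : Δ ⟶ S.carrier), Maps φ a (s ≫ b)

theorem Surj.epi {φ : S ⟶ T} (h : Surj φ) : Epi φ where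
  left_cancellation {U} f g e := by
    refine hom_ext fun b d hb => ?_
    obtain ⟨Δ, s, hs, a, ha⟩ := h b
    refine hs.sat ?_
    have h1 := ha.comp (hb.pull s)
    rw [e] at h1
    exact (maps_comp_iff ha).1 h1

/-- A surjective functional relation is the coequalizer of its kernel pair. -/
theorem Surj.exists_desc {φ : S ⟶ T} (h : Surj φ) (χ : S ⟶ U)
    (hχ : ∀ {Γ : C} (a a' : Γ ⟶ S.carrier) (b : Γ ⟶ T.carrier), Maps φ a b → Maps φ a' b →
      point S a ≫ χ = point S a' ≫ χ) : ∃ g : T ⟶ U, φ ≫ g = χ := by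
  have hχ' : ∀ {Γ : C} {a a' : Γ ⟶ S.carrier} {b : Γ ⟶ T.carrier} {d : Γ ⟶ U.carrier},
      Maps φ a b → Maps φ a' b → Maps χ a d → Maps χ a' d := by
    intro Γ a a' b d ha ha' hd
    rw [← point_comp_eq_point_iff, ← hχ a a' b ha ha']
    exact point_comp_eq_point_iff.2 hd
  have key : ∀ {Γ : C} {b : Γ ⟶ T.carrier} {d : Γ ⟶ U.carrier},
      Sat P (compRel (swap (Hom.rel φ)) (Hom.rel χ)) b d ↔
        ∃ (Δ : C) (s : Δ ⟶ Γ) (_ : PCover P s) (a : Δ ⟶ S.carrier),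
          Maps φ a (s ≫ b) ∧ Maps χ a (s ≫ d) := by
    intro Γ b d
    refine sat_compRel.trans ?_
    simp only [sat_swap]; rfl
  -- The descended arrow is the relation `∃ a, φ(a, b) ∧ χ(a, d)`.
  let g : T ⟶ U := homOfSat T U (compRel (swap (Hom.rel φ)) (Hom.rel χ))
    (fun b b' d hb hd => by
      obtain ⟨Δ, s, hs, a, ha, ha'⟩ := key.1 hd
      exact key.2 ⟨Δ, s, hs, a, ha.right (hb.pull s).symm, ha'⟩)
    (fun b d d' hd hd' => by
      obtain ⟨Δ, s, hs, a, ha, ha'⟩ := key.1 hd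
      exact key.2 ⟨Δ, s, hs, a, ha, ha'.right (hd'.pull s)⟩)
    (fun b d d' hd hd' => by
      obtain ⟨Δ, s, hs, a, ha, ha'⟩ := key.1 hd
      obtain ⟨Δ₁, s₁, hs₁, a₁, ha₁, ha₁'⟩ := key.1 (hd'.pull s)
      refine (hs.comp hs₁).sat ?_
      simp only [Category.assoc]
      exact (hχ' (ha.pull s₁) ha₁ (ha'.pull s₁)).single ha₁')
    (fun b => by
      obtain ⟨Δ, s, hs, a, ha⟩ := h b
      obtain ⟨Δ₁, s₁, hs₁, d, hd⟩ := exists_maps χ a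
      exact ⟨Δ₁, s₁ ≫ s, hs.comp hs₁, d, key.2 ⟨Δ₁, 𝟙 _, PCover.id _, s₁ ≫ a, by
        simp only [Category.id_comp, Category.assoc]
        exact ⟨ha.pull s₁, hd⟩⟩⟩)
  refine ⟨g, hom_ext fun a d hd => ?_⟩
  obtain ⟨Δ, s, hs, b, hb, hb'⟩ := maps_comp.1 hd
  obtain ⟨Δ₁, s₁, hs₁, a₁, ha₁, ha₁'⟩ := key.1 hb'
  refine (hs.comp hs₁).sat ?_
  simp only [Category.assoc]
  exact hχ' ha₁ (hb.pull s₁) ha₁'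

theorem Surj.isRegularEpi {φ : S ⟶ T} (h : Surj φ) : IsRegularEpi φ := by
  have := h.epi
  have hd : ∀ {U : ER P} (χ : S ⟶ U), pullback.fst φ φ ≫ χ = pullback.snd φ φ ≫ χ →
      ∃ g : T ⟶ U, φ ≫ g = χ := fun {U} χ e => h.exists_desc χ fun a a' b ha ha' => by
    have e' : point S a ≫ φ = point S a' ≫ φ := by
      rw [point_comp_eq_point_iff.2 ha, point_comp_eq_point_iff.2 ha']
    rw [← pullback.lift_fst (f := φ) (g := φ) _ _ e', Category.assoc, e, pullback.lift_snd_assoc]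
  exact ⟨⟨{
    W := _
    left := pullback.fst φ φ
    right := pullback.snd φ φ
    w := pullback.condition
    isColimit := Cofork.IsColimit.mk _ (fun s => (hd s.π s.condition).choose)
      (fun s => (hd s.π s.condition).choose_spec) (fun s m hm => by
        rw [← cancel_epi φ]
        exact hm.trans (hd s.π s.condition).choose_spec.symm) }⟩⟩

theorem Surj.strongEpi {φ : S ⟶ T} (h : Surj φ) : StrongEpi φ :=
  have := h.isRegularEpi
  inferInstance

/-- The image of a functional relation, as a predicate on the target. -/
def imPred (φ : S ⟶ T) : Fib P T.carrier :=
  ex P (prod.fst : T.carrier ⨯ S.carrier ⟶ T.carrier) (swap (Hom.rel φ))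

theorem sat₁_imPred {φ : S ⟶ T} {b : Γ ⟶ T.carrier} : Sat₁ P (imPred φ) b ↔
    ∃ (Δ : C) (s : Δ ⟶ Γ) (_ : PCover P s) (a : Δ ⟶ S.carrier), Maps φ a (s ≫ b) := by
  refine sat₁_ex.trans ?_
  simp only [sat_swap]; rfl

instance {X : C} (f : X ⟶ S.carrier) : Mono (restrictι S f) :=
  mono_of_eqv fun _ _ _ h h' =>
    eqv_restrict.2 ((maps_restrictι.1 h).trans (maps_restrictι.1 h').symm)

theorem surj_of_strongEpi (φ : S ⟶ T) [StrongEpi φ] : Surj φ := by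
  -- `φ` factors through the inclusion of its image, which is then an isomorphism.
  obtain ⟨g, hg⟩ := exists_lift_of_mono (restrictι T (cmp P (imPred φ))) φ (by
    intro Γ e b h
    have h1 : Sat₁ P (imPred φ) b := sat₁_imPred.2
      ⟨Γ, 𝟙 Γ, PCover.id Γ, e, by rwa [Category.id_comp]⟩
    obtain ⟨x, hx⟩ := h1.exists_lift
    refine ⟨Γ, 𝟙 Γ, PCover.id Γ, x, maps_restrictι.2 ?_⟩
    rw [hx, Category.id_comp]; exact Eqv.refl _)
  have h1 : StrongEpi (g ≫ restrictι T (cmp P (imPred φ))) := by rw [hg]; infer_instance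
  have h2 := strongEpi_of_strongEpi g (restrictι T (cmp P (imPred φ)))
  have h3 : IsIso (restrictι T (cmp P (imPred φ))) := isIso_of_mono_of_strongEpi _
  intro Γ b
  obtain ⟨Δ, s, hs, x, hx⟩ := exists_maps (inv (restrictι T (cmp P (imPred φ)))) b
  obtain ⟨Δ₁, s₁, hs₁, a, ha⟩ := sat₁_imPred.1 ((sat₁_cmp (imPred φ)).pull x)
  refine ⟨Δ₁, s₁ ≫ s, hs.comp hs₁, a, ha.right ?_⟩
  have h4 : Maps (inv (restrictι T (cmp P (imPred φ))) ≫ restrictι T (cmp P (imPred φ)))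
    (s ≫ b) (x ≫ cmp P (imPred φ)) := hx.comp (maps_restrictι.2 (Eqv.refl _))
  rw [IsIso.inv_hom_id] at h4
  rw [Category.assoc]
  exact ((maps_id.1 h4).pull s₁).symm

theorem strongEpi_iff_surj {φ : S ⟶ T} : StrongEpi φ ↔ Surj φ :=
  ⟨fun _ => surj_of_strongEpi φ, Surj.strongEpi⟩

/-- The object of the image: the carrier of `S` with the kernel of `φ`. -/
abbrev imObj (φ : S ⟶ T) : ER P :=
  ofSat S.carrier (pbRel φ φ)
    (fun a => by
      obtain ⟨Δ, s, hs, b, hb⟩ := exists_maps φ a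
      exact sat_pbRel.2 ⟨Δ, s, hs, b, hb, hb⟩)
    (fun a a' h => by
      obtain ⟨Δ, s, hs, b, hb, hb'⟩ := sat_pbRel.1 h
      exact sat_pbRel.2 ⟨Δ, s, hs, b, hb', hb⟩)
    (fun a a' a'' h h' => by
      obtain ⟨Δ, s, hs, b, hb, hb'⟩ := sat_pbRel.1 h
      obtain ⟨Δ₁, s₁, hs₁, b₁, hb₁, hb₁'⟩ := sat_pbRel.1 (h'.pull s)
      refine sat_pbRel.2 ⟨Δ₁, s₁ ≫ s, hs.comp hs₁, b₁, ?_⟩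
      simp only [Category.assoc]
      exact ⟨(hb.pull s₁).right ((hb'.pull s₁).single hb₁), hb₁'⟩)

theorem eqv_imObj {φ : S ⟶ T} {a a' : Γ ⟶ S.carrier} : (imObj φ).Eqv a a' ↔
    ∃ (Δ : C) (s : Δ ⟶ Γ) (_ : PCover P s) (b : Δ ⟶ T.carrier),
      Maps φ (s ≫ a) b ∧ Maps φ (s ≫ a') b := sat_pbRel

end Images

end ER

/-! ### Functors preserving binary products -/

/-- A functor preserves binary products if it maps the chosen product diagrams to product
diagrams. -/
theorem preservesBinaryProducts_of_isLimit {C : Type u₁} [Category.{v₁} C] [HasBinaryProducts C]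
    {X : Type u₂} [Category.{v₂} X] (F : C ⥤ X)
    (h : ∀ A B : C, Nonempty (IsLimit (BinaryFan.mk (F.map (prod.fst : A ⨯ B ⟶ A))
      (F.map (prod.snd : A ⨯ B ⟶ B))))) : PreservesLimitsOfShape (Discrete WalkingPair) F where
  preservesLimit {K} := by
    have : PreservesLimit (pair (K.obj ⟨WalkingPair.left⟩) (K.obj ⟨WalkingPair.right⟩)) F :=
      preservesLimit_of_preserves_limit_cone (prodIsProd _ _)
        ((isLimitMapConeBinaryFanEquiv F _ _).symm (h _ _).some)
    exact preservesLimit_of_iso_diagram F (diagramIsoPair K).symm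

namespace ER

variable {C : Type u} [Category.{v} C] [HasBinaryProducts C] {P : Doctrine.{w} C}
  [IsElementary P] [IsExistential P] [HasFullComprehensions P]

/-! ### Image factorizations in the category of functional relations -/

section StableImages

variable {S T : ER P}

/-- The coimage of a functional relation. -/
def imπ (φ : S ⟶ T) : S ⟶ imObj φ :=
  ofMap S (imObj φ) (𝟙 S.carrier) fun Γ a a' h => by
    obtain ⟨Δ, s, hs, b, hb⟩ := exists_maps φ a
    rw [Category.comp_id, Category.comp_id]
    exact eqv_imObj.2 ⟨Δ, s, hs, b, hb, hb.left (h.pull s).symm⟩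

/-- The monomorphism of the image factorization. -/
def imι (φ : S ⟶ T) : imObj φ ⟶ T :=
  homOfSat (imObj φ) T (show Fib P (S.carrier ⨯ T.carrier) from Hom.rel φ)
    (fun a a' b h hb => by
      obtain ⟨Δ, s, hs, b', hb', hb''⟩ := eqv_imObj.1 h
      exact hs.sat (hb'.right (hb''.single (Maps.pull hb s))))
    (fun _ _ _ h h' => Maps.right h h')
    (fun _ _ _ h h' => Maps.single h h')
    (fun a => exists_maps φ a)

theorem maps_imι {φ : S ⟶ T} {Γ : C} {a : Γ ⟶ S.carrier} {b : Γ ⟶ T.carrier} :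
    Maps (imι φ) a b ↔ Maps φ a b := Iff.rfl

theorem surj_imπ (φ : S ⟶ T) : Surj (imπ φ) := fun Γ b =>
  ⟨Γ, 𝟙 Γ, PCover.id Γ, b, maps_ofMap.2 (by
    rw [Category.comp_id, Category.id_comp]; exact Eqv.refl _)⟩

instance (φ : S ⟶ T) : Mono (imι φ) := mono_of_eqv fun {Γ} _ _ b h h' =>
  eqv_imObj.2 ⟨Γ, 𝟙 Γ, PCover.id Γ, b, by
    rw [Category.id_comp, Category.id_comp]
    exact ⟨maps_imι.1 h, maps_imι.1 h'⟩⟩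

theorem imπ_comp_imι (φ : S ⟶ T) : imπ φ ≫ imι φ = φ := hom_ext fun a b h => by
  have h1 := maps_ofMap_comp.1 h
  rw [Category.comp_id] at h1
  exact maps_imι.1 h1

theorem Surj.of_isPullback {E U : ER P} {p : E ⟶ S} {q : E ⟶ T} {f : S ⟶ U} {g : T ⟶ U}
    (hp : IsPullback p q f g) (hg : Surj g) : Surj p := by
  intro Γ a
  obtain ⟨Δ, s, hs, d, hd⟩ := exists_maps f a
  obtain ⟨Δ₁, s₁, hs₁, b, hb⟩ := hg d
  have e : point S (s₁ ≫ s ≫ a) ≫ f = point T b ≫ g := by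
    rw [point_comp_eq_point_iff.2 (hd.pull s₁), point_comp_eq_point_iff.2 hb]
  obtain ⟨Δ₂, s₂, hs₂, t, ht⟩ := exists_point (hp.lift _ _ e)
  refine ⟨Δ₂, s₂ ≫ s₁ ≫ s, (hs.comp hs₁).comp hs₂, t, point_comp_eq_point_iff.1 ?_⟩
  rw [← ht, Category.assoc, hp.lift_fst, D_map_comp_point]
  simp only [Category.assoc]

instance : HasStableImages (ER P) where
  exists_fac φ := ⟨_, imπ φ, imι φ, (surj_imπ φ).strongEpi, inferInstance, imπ_comp_imι φ⟩
  strongEpi_of_isPullback hp hg := by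
    rw [strongEpi_iff_surj] at hg ⊢
    exact hg.of_isPullback hp

end StableImages

/-! ### The embedding of a doctrine into its subobject doctrine -/

section Embedding

variable {A B Γ Δ : C}

theorem maps_D_map {f : A ⟶ B} {a : Γ ⟶ A} {b : Γ ⟶ B} :
    Maps ((D P).map f) a b ↔ Sat P (delta P B) (a ≫ f) b := by
  have h : Sat P (re P (prod.map f (𝟙 B)) (delta P B)) a b ↔ _ := sat_re_map
  rwa [Category.comp_id] at h

theorem maps_kerι {X : C} {f : X ⟶ A} {a : Γ ⟶ X} {b : Γ ⟶ A} :
    Maps (kerι P f) a b ↔ Sat P (delta P A) (a ≫ f) b := by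
  have h : Sat P (re P (prod.map f (𝟙 A)) (delta P A)) a b ↔ _ := sat_re_map
  rwa [Category.comp_id] at h

variable (P) in
/-- The map `ι` with values in the fibres of the doctrine of subobjects. -/
def incl (A : C) (α : Fib P A) : Fib (SubDoctrine (ER P)) ((D P).obj A) := ι P A α

/-- The subobject `ι α` consists of the arrows all of whose values satisfy `α`. -/
theorem mem_incl {α : Fib P A} {E : ER P} {φ : E ⟶ (D P).obj A} :
    Sub.Mem (incl P A α) φ ↔
      ∀ ⦃Γ : C⦄ (e : Γ ⟶ E.carrier) (a : Γ ⟶ A), Maps φ e a → Sat₁ P α a := by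
  refine (Sub.mem_mk (m := kerι P (cmp P α))).trans ?_
  constructor
  · rintro ⟨k, rfl⟩ Γ e a h
    obtain ⟨Δ, s, hs, x, hx, hx'⟩ := maps_comp.1 h
    refine hs.sat₁ ?_
    exact Sat₁.subst ((sat₁_cmp α).pull x) (maps_kerι.1 hx')
  · intro h
    refine exists_lift_of_mono (kerι P (cmp P α)) φ fun {Γ} e a ha => ?_
    obtain ⟨x, hx⟩ := (h e a ha).exists_lift
    refine ⟨Γ, 𝟙 Γ, PCover.id Γ, x, maps_kerι.2 ?_⟩
    rw [hx, Category.id_comp]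
    exact sat_delta_refl a

theorem incl_le_iff {α β : Fib P A} :
    incl P A α ≤ incl P A β ↔ α ≤ β := by
  rw [Sub.le_iff]
  constructor
  · intro h
    have h1 := h ((D P).map (cmp P α)) (mem_incl.2 fun Γ e a ha =>
      ((sat₁_cmp α).pull e).subst (maps_D_map.1 ha))
    refine le_of_sat₁ fun a ha => ?_
    obtain ⟨x, rfl⟩ := ha.exists_lift
    exact mem_incl.1 h1 x _ (maps_D_map.2 (sat_delta_refl _))
  · intro h E φ hφ
    exact mem_incl.2 fun Γ e a ha => (mem_incl.1 hφ e a ha).mono h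

/-- A subobject of `(A, δ_A)` is `ι` of the predicate saying which elements of `A` are values of the
inclusion. -/
theorem incl_surjective (A : C) : Function.Surjective (incl P A) := by
  intro S
  refine ⟨imPred (Sub.arr S), Sub.ext fun {E} φ => mem_incl.trans ?_⟩
  constructor
  · intro h
    exact exists_lift_of_mono (Sub.arr S) φ fun e a ha => sat₁_imPred.1 (h e a ha)
  · rintro ⟨k, rfl⟩ Γ e a ha
    obtain ⟨Δ, s, hs, x, -, hx⟩ := maps_comp.1 ha
    exact sat₁_imPred.2 ⟨Δ, s, hs, x, hx⟩

theorem incl_bijective (A : C) : Function.Bijective (incl P A) :=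
  ⟨fun _ _ h => le_antisymm (incl_le_iff.1 h.le) (incl_le_iff.1 h.ge), incl_surjective A⟩

/-- Equality on a product is componentwise. -/
theorem sat_delta_prod {x y : Γ ⟶ A ⨯ B}
    (h₁ : Sat P (delta P A) (x ≫ prod.fst) (y ≫ prod.fst))
    (h₂ : Sat P (delta P B) (x ≫ prod.snd) (y ≫ prod.snd)) : Sat P (delta P (A ⨯ B)) x y := by
  -- The two components are substituted one after the other, with parameters in `Γ`.
  have e : ∀ z : Γ ⟶ A ⨯ B, prod.lift (z ≫ prod.fst) (z ≫ prod.snd) = z := fun z => by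
    rw [← prod.comp_lift, prod.lift_fst_snd, Category.comp_id]
  have s₁ : Sat P (delta P (A ⨯ B)) x (prod.lift (y ≫ prod.fst) (x ≫ prod.snd)) := by
    have h := Sat.subst (φ := re P (prod.lift (prod.fst ≫ x)
      (prod.lift prod.snd (prod.fst ≫ x ≫ prod.snd))) (delta P (A ⨯ B))) (a := 𝟙 Γ)
      (b := x ≫ prod.fst) (b' := y ≫ prod.fst) (by
        simp only [sat_re_lift, prod.comp_lift, prod.lift_fst_assoc, prod.lift_snd,
          Category.id_comp, e]
        exact sat_delta_refl _) h₁
    simpa only [sat_re_lift, prod.comp_lift, prod.lift_fst_assoc, prod.lift_snd,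
      Category.id_comp] using h
  have h := Sat.subst (φ := re P (prod.lift (prod.fst ≫ x)
    (prod.lift (prod.fst ≫ y ≫ prod.fst) prod.snd)) (delta P (A ⨯ B))) (a := 𝟙 Γ)
    (b := x ≫ prod.snd) (b' := y ≫ prod.snd) (by
      simpa only [sat_re_lift, prod.comp_lift, prod.lift_fst_assoc, prod.lift_snd,
        Category.id_comp] using s₁) h₂
  simpa only [sat_re_lift, prod.comp_lift, prod.lift_fst_assoc, prod.lift_snd,
    Category.id_comp, e] using h

theorem D_preservesProducts : PreservesLimitsOfShape (Discrete WalkingPair) (D P) :=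
  preservesBinaryProducts_of_isLimit _ fun A B => isLimit_of_jointlyInjective
    (fun Γ t t' a b h₁ h₁' h₂ h₂' => sat_delta_prod
      ((maps_D_map.1 h₁).subst (sat_delta_symm (maps_D_map.1 h₁')))
      ((maps_D_map.1 h₂).subst (sat_delta_symm (maps_D_map.1 h₂'))))
    fun {Γ} (a : Γ ⟶ A) (b : Γ ⟶ B) => ⟨Γ, 𝟙 Γ, PCover.id Γ, prod.lift a b,
      maps_D_map.2 (show Sat P (delta P A) (prod.lift a b ≫ prod.fst) (𝟙 Γ ≫ a) by
        rw [prod.lift_fst, Category.id_comp]; exact sat_delta_refl _),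
      maps_D_map.2 (show Sat P (delta P B) (prod.lift a b ≫ prod.snd) (𝟙 Γ ≫ b) by
        rw [prod.lift_snd, Category.id_comp]; exact sat_delta_refl _)⟩

theorem incl_natural (f : A ⟶ B) (β : Fib P B) :
    incl P A (re P f β) = re (SubDoctrine (ER P)) ((D P).map f) (incl P B β) := by
  refine Sub.ext fun {E} φ => (mem_incl.trans ?_).trans
    (Sub.mem_re.trans mem_incl).symm
  constructor
  · intro h Γ e b hb
    obtain ⟨Δ, s, hs, a, ha, ha'⟩ := maps_comp.1 hb
    exact hs.sat₁ ((sat₁_re.1 (h _ _ ha)).subst (maps_D_map.1 ha'))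
  · intro h Γ e a ha
    exact sat₁_re.2 (h e _ (ha.comp (maps_D_map.2 (sat_delta_refl _))))

theorem incl_delta (A : C) : incl P (A ⨯ A) (delta P A) =
    re (SubDoctrine (ER P)) (prod.lift ((D P).map prod.fst) ((D P).map prod.snd))
      (delta (SubDoctrine (ER P)) ((D P).obj A)) := by
  refine Sub.ext fun {E} φ => mem_incl.trans ?_
  rw [Sub.mem_re, Sub.mem_delta, Category.assoc, Category.assoc, prod.lift_fst, prod.lift_snd]
  constructor
  · intro h
    refine hom_ext fun e a ha => ?_
    obtain ⟨Δ, s, hs, x, hx, hx'⟩ := maps_comp.1 ha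
    refine hs.sat (hx.comp (maps_D_map.2 ?_))
    exact (maps_D_map.1 hx').subst_left (sat₁_iff.1 (h _ _ hx))
  · intro h Γ e x hx
    have h1 : Maps (φ ≫ (D P).map prod.fst) e (x ≫ prod.fst) :=
      hx.comp (maps_D_map.2 (sat_delta_refl _))
    rw [h] at h1
    exact sat₁_iff.2 (sat_delta_symm (maps_D_map.1 ((maps_comp_iff hx).1 h1)))

theorem incl_ex {pr : A ⟶ B} (hpr : IsProj pr) (α : Fib P A) :
    incl P B (ex P pr α) = ex (SubDoctrine (ER P)) ((D P).map pr) (incl P A α) := by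
  -- Both sides are left adjoint to reindexing, since `ι` is a natural order isomorphism.
  refine le_antisymm ?_ ?_
  · obtain ⟨β, hβ⟩ := incl_surjective B (ex (SubDoctrine (ER P)) ((D P).map pr) (incl P A α))
    have h1 := (Sub.ex_gc ((D P).map pr)).le_u_l (incl P A α)
    rw [← hβ, ← incl_natural] at h1
    have h2 := (ex_gc P hpr _ _).2 (incl_le_iff.1 h1)
    exact (incl_le_iff.2 h2).trans_eq hβ
  · refine (Sub.ex_gc ((D P).map pr) _ _).2 ?_
    rw [← incl_natural]
    exact incl_le_iff.2 ((ex_gc P hpr).le_u_l α)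

theorem isArrow_D_ι : IsArrow P (SubDoctrine (ER P)) (D P) (ι P) where
  preservesProducts := D_preservesProducts
  map_top A := by
    change incl P A ⊤ = ⊤
    obtain ⟨β, hβ⟩ := incl_surjective (P := P) A ⊤
    exact top_le_iff.1 (hβ.ge.trans (incl_le_iff.2 le_top))
  map_inf A α β := by
    change incl P A (α ⊓ β) = incl P A α ⊓ incl P A β
    refine le_antisymm (le_inf (incl_le_iff.2 inf_le_left) (incl_le_iff.2 inf_le_right)) ?_
    refine Sub.le_iff.2 fun φ h => ?_
    obtain ⟨h₁, h₂⟩ := Sub.mem_inf.1 h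
    exact mem_incl.2 fun Γ e a ha =>
      sat₁_inf.2 ⟨mem_incl.1 h₁ e a ha, mem_incl.1 h₂ e a ha⟩
  natural := incl_natural
  map_delta := incl_delta
  map_ex _ h α := incl_ex h α

end Embedding

end ER

/-! ### Local lifting in categories with stable images -/

section LocalLifting

variable {X : Type u} [Category.{v} X] [HasBinaryProducts X] [HasPullbacks X]

/-- A pair of arrows lifts along a jointly monic pair if it does so after precomposition with a
strong epimorphism. -/
theorem exists_lift_of_local {T A B : X} {p : T ⟶ A} {q : T ⟶ B}
    (hinj : ∀ {Z : X} (u v : Z ⟶ T), u ≫ p = v ≫ p → u ≫ q = v ≫ q → u = v)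
    {Z : X} (x : Z ⟶ A) (y : Z ⟶ B)
    (h : ∃ (Z' : X) (s : Z' ⟶ Z) (_ : StrongEpi s) (t : Z' ⟶ T), t ≫ p = s ≫ x ∧ t ≫ q = s ≫ y) :
    ∃ t : Z ⟶ T, t ≫ p = x ∧ t ≫ q = y := by
  have hm : Mono (prod.lift p q) := ⟨fun u v e => hinj u v
    (by simpa only [Category.assoc, prod.lift_fst] using congrArg (· ≫ prod.fst) e)
    (by simpa only [Category.assoc, prod.lift_snd] using congrArg (· ≫ prod.snd) e)⟩
  obtain ⟨Z', s, hs, t, h₁, h₂⟩ := h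
  have h3 : Sub.Mem (Sub.mk (prod.lift p q)) (prod.lift x y) := by
    refine Sub.mem_of_strongEpi s (Sub.mem_mk.2 ⟨t, ?_⟩)
    rw [prod.comp_lift, prod.comp_lift, h₁, h₂]
  obtain ⟨k, hk⟩ := Sub.mem_mk.1 h3
  refine ⟨k, ?_, ?_⟩
  · simpa only [Category.assoc, prod.lift_fst] using congrArg (· ≫ prod.fst) hk
  · simpa only [Category.assoc, prod.lift_snd] using congrArg (· ≫ prod.snd) hk

theorem isPullback_of_local {T A B D : X} {p : T ⟶ A} {q : T ⟶ B} {f : A ⟶ D} {g : B ⟶ D}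
    (w : p ≫ f = q ≫ g)
    (hinj : ∀ {Z : X} (u v : Z ⟶ T), u ≫ p = v ≫ p → u ≫ q = v ≫ q → u = v)
    (h : ∀ {Z : X} (x : Z ⟶ A) (y : Z ⟶ B), x ≫ f = y ≫ g →
      ∃ (Z' : X) (s : Z' ⟶ Z) (_ : StrongEpi s) (t : Z' ⟶ T), t ≫ p = s ≫ x ∧ t ≫ q = s ≫ y) :
    IsPullback p q f g := by
  have hl := fun (s : PullbackCone f g) =>
    exists_lift_of_local hinj s.fst s.snd (h _ _ s.condition)
  exact ⟨⟨w⟩, ⟨PullbackCone.IsLimit.mk w (fun s => (hl s).choose)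
    (fun s => (hl s).choose_spec.1) (fun s => (hl s).choose_spec.2)
    fun s m h₁ h₂ => hinj _ _ (h₁.trans (hl s).choose_spec.1.symm)
      (h₂.trans (hl s).choose_spec.2.symm)⟩⟩

theorem isLimit_of_local {T A B : X} {p : T ⟶ A} {q : T ⟶ B}
    (hinj : ∀ {Z : X} (u v : Z ⟶ T), u ≫ p = v ≫ p → u ≫ q = v ≫ q → u = v)
    (h : ∀ {Z : X} (x : Z ⟶ A) (y : Z ⟶ B),
      ∃ (Z' : X) (s : Z' ⟶ Z) (_ : StrongEpi s) (t : Z' ⟶ T), t ≫ p = s ≫ x ∧ t ≫ q = s ≫ y) :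
    Nonempty (IsLimit (BinaryFan.mk p q)) := by
  have hl := fun (s : BinaryFan A B) => exists_lift_of_local hinj s.fst s.snd (h _ _)
  exact ⟨BinaryFan.isLimitMk (fun s => (hl s).choose)
    (fun s => (hl s).choose_spec.1) (fun s => (hl s).choose_spec.2)
    fun s m h₁ h₂ => hinj _ _ (h₁.trans (hl s).choose_spec.1.symm)
      (h₂.trans (hl s).choose_spec.2.symm)⟩

/-- An arrow is a strong epimorphism if its codomain is covered by elements in the image. -/
theorem strongEpi_of_local {A B Z : X} {f : A ⟶ B} (s : Z ⟶ B) [StrongEpi s] (x : Z ⟶ A)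
    (h : x ≫ f = s) : StrongEpi f := by
  have : StrongEpi (x ≫ f) := by rwa [h]
  exact strongEpi_of_strongEpi x f

/-- Local preimages along a strong epimorphism. -/
theorem exists_local_preimage [HasStableImages X] {A B Z : X} (f : A ⟶ B) [hf : StrongEpi f]
    (y : Z ⟶ B) :
    ∃ (Z' : X) (s : Z' ⟶ Z) (_ : StrongEpi s) (x : Z' ⟶ A), x ≫ f = s ≫ y :=
  ⟨_, pullback.fst y f, HasStableImages.strongEpi_of_isPullback (IsPullback.of_hasPullback y f) hf,
    pullback.snd y f, pullback.condition.symm⟩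

end LocalLifting

/-! ### Pairing for functors preserving binary products -/

section Pairing

variable {C : Type u₁} [Category.{v₁} C] [HasBinaryProducts C] {X : Type u₂} [Category.{v₂} X]
  (F : C ⥤ X) [PreservesLimitsOfShape (Discrete WalkingPair) F]

/-- The arrow into `F(A × B)` with given components. -/
def liftProd {A B : C} {Z : X} (x : Z ⟶ F.obj A) (y : Z ⟶ F.obj B) : Z ⟶ F.obj (A ⨯ B) :=
  (BinaryFan.IsLimit.lift' (mapIsLimitOfPreservesOfIsLimit F _ _ (prodIsProd A B)) x y).1

variable {F} {A B : C} {Z : X}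

theorem liftProd_fst (x : Z ⟶ F.obj A) (y : Z ⟶ F.obj B) : liftProd F x y ≫ F.map prod.fst = x :=
  (BinaryFan.IsLimit.lift' (mapIsLimitOfPreservesOfIsLimit F _ _ (prodIsProd A B)) x y).2.1

theorem liftProd_snd (x : Z ⟶ F.obj A) (y : Z ⟶ F.obj B) : liftProd F x y ≫ F.map prod.snd = y :=
  (BinaryFan.IsLimit.lift' (mapIsLimitOfPreservesOfIsLimit F _ _ (prodIsProd A B)) x y).2.2

theorem liftProd_ext {w w' : Z ⟶ F.obj (A ⨯ B)} (h₁ : w ≫ F.map prod.fst = w' ≫ F.map prod.fst)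
    (h₂ : w ≫ F.map prod.snd = w' ≫ F.map prod.snd) : w = w' :=
  BinaryFan.IsLimit.hom_ext (mapIsLimitOfPreservesOfIsLimit F _ _ (prodIsProd A B)) h₁ h₂

theorem comp_liftProd {Z' : X} (s : Z' ⟶ Z) (x : Z ⟶ F.obj A) (y : Z ⟶ F.obj B) :
    s ≫ liftProd F x y = liftProd F (s ≫ x) (s ≫ y) :=
  liftProd_ext (by rw [Category.assoc, liftProd_fst, liftProd_fst])
    (by rw [Category.assoc, liftProd_snd, liftProd_snd])

end Pairing

/-! ### One-arrows into a doctrine of subobjects -/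

namespace OneArrow

section Chart

variable {C : Type u₁} [Category.{v₁} C] [HasBinaryProducts C] {P : Doctrine.{w} C}
  {X : Type u₂} [Category.{v₂} X] [HasBinaryProducts X] [HasPullbacks X] [HasStableImages X]
  (K : OneArrow P (SubDoctrine X))

instance : PreservesLimitsOfShape (Discrete WalkingPair) K.F := K.isArrow.preservesProducts

theorem b_mono {A : C} {α β : Fib P A} (h : α ≤ β) : K.b A α ≤ K.b A β := by
  have h1 := K.isArrow.map_inf A α β
  rw [inf_eq_left.2 h] at h1
  exact inf_eq_left.1 h1.symm

/-- Forced statements are true in the image of the stage. -/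
theorem mem_b_of_sat₁ {A Γ : C} {α : Fib P A} {a : Γ ⟶ A} (h : Sat₁ P α a) :
    Sub.Mem (K.b A α) (K.F.map a) := by
  have h1 := K.isArrow.natural a α
  rw [show re P a α = ⊤ from h, K.isArrow.map_top] at h1
  have h2 : Sub.Mem (re (SubDoctrine X) (K.F.map a) (K.b A α)) (𝟙 _) := h1 ▸ Sub.mem_top _
  rwa [Sub.mem_re, Category.id_comp] at h2

theorem mem_b_delta [IsElementary P] {A : C} {Z : X} {w : Z ⟶ K.F.obj (A ⨯ A)} :
    Sub.Mem (K.b (A ⨯ A) (delta P A)) w ↔ w ≫ K.F.map prod.fst = w ≫ K.F.map prod.snd := by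
  rw [K.isArrow.map_delta, Sub.mem_re, Sub.mem_delta, Category.assoc, Category.assoc,
    prod.lift_fst, prod.lift_snd]

theorem mem_b_re {A B : C} {f : A ⟶ B} {β : Fib P B} {Z : X} {w : Z ⟶ K.F.obj A} :
    Sub.Mem (K.b A (re P f β)) w ↔ Sub.Mem (K.b B β) (w ≫ K.F.map f) := by
  rw [K.isArrow.natural, Sub.mem_re]

theorem mem_b_inf {A : C} {α β : Fib P A} {Z : X} {w : Z ⟶ K.F.obj A} :
    Sub.Mem (K.b A (α ⊓ β)) w ↔ Sub.Mem (K.b A α) w ∧ Sub.Mem (K.b A β) w := by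
  rw [K.isArrow.map_inf, Sub.mem_inf]

variable [IsElementary P] [IsExistential P] [HasFullComprehensions P]

/-- The subobject `b(α)` is the image under `F` of the comprehension of `α`. -/
theorem exists_chart {A : C} {α : Fib P A} {Z : X} {w : Z ⟶ K.F.obj A} (h : Sub.Mem (K.b A α) w) :
    ∃ (Z' : X) (s : Z' ⟶ Z) (_ : StrongEpi s) (z : Z' ⟶ K.F.obj (cmpObj P α)),
      z ≫ K.F.map (cmp P α) = s ≫ w := by
  let θ : Fib P (A ⨯ cmpObj P α) := re P (prod.map (𝟙 A) (cmp P α)) (delta P A)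
  have hα : α ≤ ex P (prod.fst : A ⨯ cmpObj P α ⟶ A) θ := le_of_sat₁ fun {Γ} a ha => by
    obtain ⟨x, rfl⟩ := ha.exists_lift
    refine sat₁_ex.2 ⟨Γ, 𝟙 Γ, PCover.id Γ, x, sat_re_map.2 ?_⟩
    rw [Category.id_comp, Category.comp_id]
    exact sat_delta_refl _
  have h1 := h.mono (K.b_mono hα)
  rw [K.isArrow.map_ex _ (isProj_fst _ _), Sub.mem_ex] at h1
  obtain ⟨Z', s, hs, y, hy, hy'⟩ := h1
  refine ⟨Z', s, hs, y ≫ K.F.map prod.snd, ?_⟩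
  rw [mem_b_re, mem_b_delta] at hy
  simp only [Category.assoc, ← K.F.map_comp, prod.map_fst, prod.map_snd, Category.comp_id] at hy
  rw [Category.assoc, ← K.F.map_comp, ← hy, hy']

/-- Every natural transformation between one-arrows into a doctrine of subobjects satisfies the
inequality required of a 2-arrow. -/
theorem b_le_re_app {K L : OneArrow P (SubDoctrine X)} (θ : K.F ⟶ L.F) (A : C) (α : Fib P A) :
    K.b A α ≤ re (SubDoctrine X) (θ.app A) (L.b A α) := by
  refine Sub.le_iff.2 fun {Z} w hw => ?_
  obtain ⟨Z', s, hs, z, hz⟩ := K.exists_chart hw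
  refine Sub.mem_re.2 (Sub.mem_of_strongEpi s ?_)
  rw [← reassoc_of% hz, θ.naturality, ← Category.assoc]
  exact (L.mem_b_of_sat₁ (sat₁_cmp α)).pull _

theorem full_forget : (forget P (SubDoctrine X)).Full where
  map_surjective θ := ⟨⟨θ, b_le_re_app θ⟩, rfl⟩

end Chart

theorem faithful_forget {C : Type u₁} [Category.{v₁} C] [HasBinaryProducts C] (P : Doctrine.{w} C)
    {X : Type u₂} [Category.{v₂} X] [HasBinaryProducts X] (R : Doctrine.{w₂} X) :
    (forget P R).Faithful where
  map_injective h := Hom.ext h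

end OneArrow

/-! ### One-arrows between doctrines of subobjects -/

section SubToSub

variable {Y : Type u₁} [Category.{v₁} Y] [HasBinaryProducts Y] [HasPullbacks Y]
  {X : Type u₂} [Category.{v₂} X] [HasBinaryProducts X] [HasPullbacks X]

/-- Functors preserving binary products, pullbacks and strong epimorphisms. -/
structure IsLexRegular (F : Y ⥤ X) : Prop where
  preservesProducts : PreservesLimitsOfShape (Discrete WalkingPair) F
  map_isPullback : ∀ {T A B D : Y} {p : T ⟶ A} {q : T ⟶ B} {f : A ⟶ D} {g : B ⟶ D},
    IsPullback p q f g → IsPullback (F.map p) (F.map q) (F.map f) (F.map g)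
  map_strongEpi : ∀ {A B : Y} (e : A ⟶ B), StrongEpi e → StrongEpi (F.map e)

variable [HasStableImages X] [HasStableImages Y]

/-- The functor of a one-arrow between doctrines of subobjects preserves pullbacks and strong
epimorphisms, because these can be expressed with equality, meets and existential quantifiers. -/
theorem OneArrow.isLexRegular (K : OneArrow (SubDoctrine Y) (SubDoctrine X)) :
    IsLexRegular K.F where
  preservesProducts := K.isArrow.preservesProducts
  map_isPullback {T A B D p q f g} hp := by
    refine isPullback_of_local (by rw [← K.F.map_comp, hp.w, K.F.map_comp]) ?_ ?_
    · -- The pair `(u, v)` belongs to a subobject of `T × T` that lies in the diagonal.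
      intro Z u v h₁ h₂
      let κ : Fib (SubDoctrine Y) (T ⨯ T) :=
        re (SubDoctrine Y) (prod.map p p) (delta (SubDoctrine Y) A) ⊓
          re (SubDoctrine Y) (prod.map q q) (delta (SubDoctrine Y) B)
      have hκ : κ ≤ delta (SubDoctrine Y) T := Sub.le_iff.2 fun w hw => by
        simp only [κ, Sub.mem_inf, Sub.mem_re, Sub.mem_delta, Category.assoc, prod.map_fst,
          prod.map_snd] at hw
        exact Sub.mem_delta.2 (hp.hom_ext (by simpa using hw.1) (by simpa using hw.2))
      have h : Sub.Mem (K.b _ κ) (liftProd K.F u v) := by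
        simp only [κ, K.mem_b_inf, K.mem_b_re, K.mem_b_delta, Category.assoc, ← K.F.map_comp,
          prod.map_fst, prod.map_snd]
        simp only [K.F.map_comp, ← Category.assoc, liftProd_fst, liftProd_snd]
        exact ⟨h₁, h₂⟩
      have h3 := K.mem_b_delta.1 (h.mono (K.b_mono hκ))
      rwa [liftProd_fst, liftProd_snd] at h3
    · -- The pair `(x, y)` belongs to the image of the subobject `f(a) = g(b)` of `A × B`, whose
      -- comprehension factors through the pullback.
      intro Z x y hxy
      let κ : Fib (SubDoctrine Y) (A ⨯ B) :=
        re (SubDoctrine Y) (prod.map f g) (delta (SubDoctrine Y) D)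
      have h : Sub.Mem (K.b _ κ) (liftProd K.F x y) := by
        simp only [κ, K.mem_b_re, K.mem_b_delta, Category.assoc, ← K.F.map_comp,
          prod.map_fst, prod.map_snd]
        simp only [K.F.map_comp, ← Category.assoc, liftProd_fst, liftProd_snd]
        exact hxy
      obtain ⟨Z', s, hs, z, hz⟩ := K.exists_chart h
      have h1 : Sub.Mem κ (cmp _ κ) := by
        have h2 : Sub.Mem (re (SubDoctrine Y) (cmp _ κ) κ) (𝟙 _) :=
          (sat₁_cmp κ).symm ▸ Sub.mem_top _
        rwa [Sub.mem_re, Category.id_comp] at h2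
      simp only [κ, Sub.mem_re, Sub.mem_delta, Category.assoc, prod.map_fst, prod.map_snd] at h1
      refine ⟨Z', s, hs, z ≫ K.F.map (hp.lift (cmp _ κ ≫ prod.fst) (cmp _ κ ≫ prod.snd)
        (by simpa using h1)), ?_, ?_⟩
      · rw [Category.assoc, ← K.F.map_comp, hp.lift_fst, K.F.map_comp, reassoc_of% hz, liftProd_fst]
      · rw [Category.assoc, ← K.F.map_comp, hp.lift_snd, K.F.map_comp, reassoc_of% hz, liftProd_snd]
  map_strongEpi {A B} e he := by
    -- Surjectivity of `e` is the validity of `∃ a, b = e(a)`.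
    let κ : Fib (SubDoctrine Y) (B ⨯ A) :=
      re (SubDoctrine Y) (prod.map (𝟙 B) e) (delta (SubDoctrine Y) B)
    have h : ex (SubDoctrine Y) (prod.fst : B ⨯ A ⟶ B) κ = ⊤ := by
      refine Sub.eq_top (Sub.mem_ex.2 ⟨A, e, he, prod.lift e (𝟙 A), ?_, ?_⟩)
      · simp [κ, Sub.mem_re, Sub.mem_delta, prod.lift_fst, prod.lift_snd]
      · rw [prod.lift_fst, Category.comp_id]
    have h1 := K.isArrow.map_ex _ (isProj_fst B A) κ
    rw [h, K.isArrow.map_top] at h1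
    have h2 : Sub.Mem (ex (SubDoctrine X) (K.F.map prod.fst) (K.b _ κ)) (𝟙 _) := h1 ▸ Sub.mem_top _
    obtain ⟨Z', s, hs, y, hy, hy'⟩ := Sub.mem_ex.1 h2
    rw [K.mem_b_re, K.mem_b_delta] at hy
    simp only [Category.assoc, ← K.F.map_comp, prod.map_fst, prod.map_snd, Category.comp_id] at hy
    refine strongEpi_of_local s (y ≫ K.F.map prod.snd) ?_
    rw [Category.assoc, ← K.F.map_comp, ← hy, hy', Category.comp_id]

namespace IsLexRegular

variable {F : Y ⥤ X} (h : IsLexRegular F)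

theorem mono_map (h : IsLexRegular F) {A B : Y} (m : A ⟶ B) [Mono m] : Mono (F.map m) := by
  have hk := h.map_isPullback (IsKernelPair.id_of_mono m)
  exact IsKernelPair.mono_of_eq_fst_snd hk rfl

/-- The direct image of a subobject. -/
def direct (h : IsLexRegular F) (A : Y) (S : Fib (SubDoctrine Y) A) :
    Fib (SubDoctrine X) (F.obj A) :=
  haveI := h.mono_map (Sub.arr S)
  Sub.mk (F.map (Sub.arr S))

variable (h : IsLexRegular F)

theorem mem_direct {A : Y} {S : Fib (SubDoctrine Y) A} {Z : X} {x : Z ⟶ F.obj A} :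
    Sub.Mem (h.direct A S) x ↔ ∃ k : Z ⟶ F.obj (Sub.dom S), k ≫ F.map (Sub.arr S) = x :=
  haveI := h.mono_map (Sub.arr S)
  Sub.mem_mk

theorem mem_direct_map {A B : Y} {S : Fib (SubDoctrine Y) A} {y : B ⟶ A} (hy : Sub.Mem S y) {Z : X}
    (x : Z ⟶ F.obj B) : Sub.Mem (h.direct A S) (x ≫ F.map y) := by
  obtain ⟨k, rfl⟩ := hy
  exact h.mem_direct.2 ⟨x ≫ F.map k, by rw [Category.assoc, F.map_comp]⟩

theorem mem_direct_re {A B : Y} {f : A ⟶ B} {S : Fib (SubDoctrine Y) B} {Z : X}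
    {x : Z ⟶ F.obj A} :
    Sub.Mem (h.direct A (re (SubDoctrine Y) f S)) x ↔ Sub.Mem (h.direct B S) (x ≫ F.map f) := by
  constructor
  · intro hx
    obtain ⟨k, rfl⟩ := h.mem_direct.1 hx
    rw [Category.assoc, ← F.map_comp]
    exact h.mem_direct_map (Sub.mem_re.1 (Sub.mem_arr _)) _
  · intro hx
    obtain ⟨k, hk⟩ := h.mem_direct.1 hx
    have hp := IsPullback.of_hasPullback f (Sub.arr S)
    rw [← (h.map_isPullback hp).lift_fst x k hk.symm]
    exact h.mem_direct_map (Sub.mem_re.2 ⟨_, hp.w.symm⟩) _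

theorem mem_direct_inf {A : Y} {S T : Fib (SubDoctrine Y) A} {Z : X} {x : Z ⟶ F.obj A} :
    Sub.Mem (h.direct A (S ⊓ T)) x ↔ Sub.Mem (h.direct A S) x ∧ Sub.Mem (h.direct A T) x := by
  constructor
  · intro hx
    obtain ⟨k, rfl⟩ := h.mem_direct.1 hx
    have h1 := Sub.mem_inf.1 (Sub.mem_arr (S ⊓ T))
    exact ⟨h.mem_direct_map h1.1 _, h.mem_direct_map h1.2 _⟩
  · rintro ⟨hS, hT⟩
    obtain ⟨k, rfl⟩ := h.mem_direct.1 hS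
    have h1 := h.mem_direct_re.2 hT
    obtain ⟨l, rfl⟩ := h.mem_direct.1 h1
    rw [Category.assoc, ← F.map_comp]
    exact h.mem_direct_map (Sub.mem_inf.2
      ⟨⟨_, rfl⟩, Sub.mem_re.1 (Sub.mem_arr (re (SubDoctrine Y) (Sub.arr S) T))⟩) _

theorem mem_direct_ex {A B : Y} {f : A ⟶ B} {S : Fib (SubDoctrine Y) A} {Z : X}
    {y : Z ⟶ F.obj B} :
    Sub.Mem (h.direct B (ex (SubDoctrine Y) f S)) y ↔
      Sub.Mem (ex (SubDoctrine X) (F.map f) (h.direct A S)) y := by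
  obtain ⟨j, hj⟩ : Sub.Mem (ex (SubDoctrine Y) f S) (Sub.arr S ≫ f) :=
    Sub.mem_ex.2 ⟨_, 𝟙 _, inferInstance, Sub.arr S, Sub.mem_arr S, (Category.id_comp _).symm⟩
  constructor
  · intro hy
    obtain ⟨k, rfl⟩ := h.mem_direct.1 hy
    have hje : StrongEpi j := by
      obtain ⟨Z', s, hs, x, ⟨l, rfl⟩, hx⟩ := Sub.mem_ex.1 (Sub.mem_arr (ex (SubDoctrine Y) f S))
      refine strongEpi_of_local s l ?_
      rw [← cancel_mono (Sub.arr (ex (SubDoctrine Y) f S)), ← hx, Category.assoc, hj,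
        Category.assoc]
    have := h.map_strongEpi j hje
    obtain ⟨Z', s, hs, x, hx⟩ := exists_local_preimage (F.map j) k
    refine Sub.mem_ex.2 ⟨Z', s, hs, x ≫ F.map (Sub.arr S), h.mem_direct.2 ⟨x, rfl⟩, ?_⟩
    rw [← reassoc_of% hx, Category.assoc, ← F.map_comp, ← F.map_comp, hj]
  · intro hy
    obtain ⟨Z', s, hs, x, hx, hx'⟩ := Sub.mem_ex.1 hy
    obtain ⟨k, rfl⟩ := h.mem_direct.1 hx
    refine Sub.mem_of_strongEpi s ?_
    rw [← hx', Category.assoc, ← F.map_comp]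
    exact h.mem_direct_map ⟨j, hj⟩ _

/-- A functor preserving binary products, pullbacks and strong epimorphisms is a one-arrow between
the doctrines of subobjects, acting on subobjects by direct image. -/
theorem isArrow : IsArrow (SubDoctrine Y) (SubDoctrine X) F h.direct where
  preservesProducts := h.preservesProducts
  map_top A := Sub.eq_top (by
    rw [← F.map_id, ← Category.id_comp (F.map (𝟙 A))]
    exact h.mem_direct_map (Sub.mem_top _) _)
  map_inf A S T := Sub.ext fun x => by rw [h.mem_direct_inf, Sub.mem_inf]
  natural f S := Sub.ext fun x => by rw [h.mem_direct_re, Sub.mem_re]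
  map_delta A := Sub.ext fun x => by
    have := h.preservesProducts
    rw [Sub.mem_re, Sub.mem_delta, Category.assoc, Category.assoc, prod.lift_fst, prod.lift_snd]
    constructor
    · intro hx
      obtain ⟨k, rfl⟩ := h.mem_direct.1 hx
      rw [Category.assoc, Category.assoc, ← F.map_comp, ← F.map_comp,
        Sub.mem_delta.1 (Sub.mem_arr _)]
    · intro hx
      have e : x = (x ≫ F.map prod.fst) ≫ F.map (prod.lift (𝟙 A) (𝟙 A)) :=
        liftProd_ext
          (by rw [Category.assoc _ _ (F.map prod.fst), ← F.map_comp, prod.lift_fst, F.map_id,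
            Category.comp_id])
          (by rw [Category.assoc _ _ (F.map prod.snd), ← F.map_comp, prod.lift_snd, F.map_id,
            Category.comp_id, hx])
      rw [e]
      exact h.mem_direct_map (Sub.mem_delta.2 (by rw [prod.lift_fst, prod.lift_snd])) _
  map_ex f _ S := Sub.ext fun y => h.mem_direct_ex

end IsLexRegular

end SubToSub

/-! ### Descent along strong epimorphisms -/

theorem exists_desc_of_strongEpi {X : Type u} [Category.{v} X] [Regular X] {A B E : X} (q : A ⟶ B)
    [StrongEpi q] (f : A ⟶ E)
    (h : ∀ {Z : X} (x y : Z ⟶ A), x ≫ q = y ≫ q → x ≫ f = y ≫ f) : ∃ g : B ⟶ E, q ≫ g = f :=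
  have : IsRegularEpi q := (isRegularEpi_iff_strongEpi q).2 inferInstance
  ⟨IsRegularEpi.desc q f (h _ _ (IsRegularEpi.w q)), IsRegularEpi.fac q f _⟩

/-! ### Precomposition with the embedding is fully faithful -/

namespace ER

variable {C : Type u} [Category.{v} C] [HasBinaryProducts C] {P : Doctrine.{w} C}
  [IsElementary P] [IsExistential P] [HasFullComprehensions P]

section Covers

variable {S T : ER P}

variable (P) in
/-- The embedding of `P` into the doctrine of subobjects of `ER P`. -/
abbrev embedding : OneArrow P (SubDoctrine (ER P)) := ⟨D P, ι P, isArrow_D_ι⟩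

/-- The quotient map from `(A, δ_A)` to `(A, ρ)`. -/
abbrev quot (S : ER P) : (D P).obj S.carrier ⟶ S := point S (𝟙 S.carrier)

theorem quot_surj (S : ER P) : Surj (quot S) := fun Γ b =>
  ⟨Γ, 𝟙 Γ, PCover.id Γ, b, maps_point.2 (by
    rw [Category.id_comp]
    exact (Category.comp_id b).symm ▸ Eqv.refl b)⟩

theorem D_map_comp_quot {Γ : C} (a : Γ ⟶ S.carrier) : (D P).map a ≫ quot S = point S a := by
  rw [D_map_comp_point, Category.comp_id]

theorem quot_comp_ofMap {f : S.carrier ⟶ T.carrier} {hf : Respects S T f} :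
    quot S ≫ ofMap S T f hf = point T f :=
  point_comp_eq_point_iff.2 (maps_ofMap.2 (by rw [Category.id_comp]; exact Eqv.refl f))

theorem quot_comp_pbFst {U : ER P} (φ : S ⟶ U) (ψ : T ⟶ U) :
    quot (pbObj φ ψ) ≫ pbFst φ ψ = point S (cmp P (pbRel φ ψ) ≫ prod.fst) := quot_comp_ofMap

theorem quot_comp_pbSnd {U : ER P} (φ : S ⟶ U) (ψ : T ⟶ U) :
    quot (pbObj φ ψ) ≫ pbSnd φ ψ = point T (cmp P (pbRel φ ψ) ≫ prod.snd) := quot_comp_ofMap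

theorem quot_D_obj (A : C) : quot ((D P).obj A) = 𝟙 ((D P).obj A) :=
  (D_map_eq_point (𝟙 A)).symm.trans ((D P).map_id A)

/-- Every arrow is given on points along some cover of its domain. -/
theorem exists_cover (φ : S ⟶ T) : ∃ (Γ : C) (a : Γ ⟶ S.carrier) (b : Γ ⟶ T.carrier),
    Surj (point S a) ∧ point S a ≫ φ = point T b := by
  have h : Sat₁ P φ.rel (cmp P φ.rel) := sat₁_cmp φ.rel
  refine ⟨cmpObj P φ.rel, cmp P φ.rel ≫ prod.fst, cmp P φ.rel ≫ prod.snd, fun Γ b => ?_,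
    point_comp_eq_point_iff.2 (sat₁_iff.1 h)⟩
  obtain ⟨Δ, s, hs, d, hd⟩ := exists_maps φ b
  obtain ⟨x, hx⟩ := (sat_iff.1 hd).exists_lift
  refine ⟨Δ, s, hs, x, maps_point.2 ?_⟩
  rw [reassoc_of% hx, prod.lift_fst]
  exact Eqv.refl _

end Covers

section Precomposition

variable {X : Type u₁} [Category.{v₁} X] [Regular X] {G G' : ER P ⥤ X}

theorem strongEpi_map_of_surj (h : IsLexRegular G) {S T : ER P} {φ : S ⟶ T} (hφ : Surj φ) :
    StrongEpi (G.map φ) := h.map_strongEpi φ hφ.strongEpi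

/-- Elements of `G(A, δ_A)` identified in `G(A, ρ)` are locally images of `ρ`-related points. -/
theorem exists_local_eqv (h : IsLexRegular G) (S : ER P) {Z : X}
    (x y : Z ⟶ G.obj ((D P).obj S.carrier)) (hxy : x ≫ G.map (quot S) = y ≫ G.map (quot S)) :
    ∃ (Z' : X) (s : Z' ⟶ Z) (_ : StrongEpi s) (Γ : C) (a b : Γ ⟶ S.carrier)
      (z : Z' ⟶ G.obj ((D P).obj Γ)), point S a = point S b ∧ z ≫ G.map ((D P).map a) = s ≫ x ∧
        z ≫ G.map ((D P).map b) = s ≫ y := by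
  -- The kernel pair of the quotient map is covered by an object `D R` of the base.
  obtain ⟨R, a, b, E, q, p₁, p₂, hp, hq, ha, hb⟩ : ∃ (R : C) (a b : R ⟶ S.carrier) (E : ER P)
      (q : (D P).obj R ⟶ E) (p₁ p₂ : E ⟶ (D P).obj S.carrier),
      IsPullback p₁ p₂ (quot S) (quot S) ∧ Surj q ∧ q ≫ p₁ = (D P).map a ∧
        q ≫ p₂ = (D P).map b :=
    ⟨_, cmp P (pbRel (quot S) (quot S)) ≫ prod.fst, cmp P (pbRel (quot S) (quot S)) ≫ prod.snd,
      pbObj (quot S) (quot S), quot (pbObj (quot S) (quot S)), pbFst (quot S) (quot S),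
      pbSnd (quot S) (quot S), isPullback_pb (quot S) (quot S), quot_surj (pbObj (quot S) (quot S)),
      (quot_comp_pbFst (quot S) (quot S)).trans (D_map_eq_point (B := S.carrier) _).symm,
      (quot_comp_pbSnd (quot S) (quot S)).trans (D_map_eq_point (B := S.carrier) _).symm⟩
  have hp' := h.map_isPullback hp
  have := strongEpi_map_of_surj h hq
  obtain ⟨Z', s, hs, z, hz⟩ := exists_local_preimage (G.map q) (hp'.lift x y hxy)
  refine ⟨Z', s, hs, R, a, b, z, ?_, ?_, ?_⟩
  · rw [← D_map_comp_quot, ← D_map_comp_quot, ← ha, ← hb, Category.assoc, hp.w, Category.assoc]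
  · rw [← ha, G.map_comp, reassoc_of% hz, hp'.lift_fst]
  · rw [← hb, G.map_comp, reassoc_of% hz, hp'.lift_snd]

/-- A natural transformation out of `G` is determined by its components on the image of `D`, since
every object is a quotient of one in this image. -/
theorem natTrans_ext (h : IsLexRegular G) {η η' : G ⟶ G'}
    (e : ∀ A : C, η.app ((D P).obj A) = η'.app ((D P).obj A)) : η = η' := by
  ext S
  have := strongEpi_map_of_surj h (quot_surj S)
  rw [← cancel_epi (G.map (quot S)), η.naturality, η'.naturality]
  exact congrArg (· ≫ G'.map (quot S)) (e S.carrier)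

/-- A natural transformation defined on the objects of the base extends to all of `ER P`: its
components descend along the quotient maps. -/
theorem exists_natTrans (h : IsLexRegular G) (θ : D P ⋙ G ⟶ D P ⋙ G') :
    ∃ η : G ⟶ G', Functor.whiskerLeft (D P) η = θ := by
  have hθ {A B : C} (f : A ⟶ B) : G.map ((D P).map f) ≫ θ.app B = θ.app A ≫ G'.map ((D P).map f) :=
    θ.naturality f
  have key (S : ER P) : ∃ g : G.obj S ⟶ G'.obj S,
      G.map (quot S) ≫ g = θ.app S.carrier ≫ G'.map (quot S) := by
    have := strongEpi_map_of_surj h (quot_surj S)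
    refine exists_desc_of_strongEpi _ _ fun x y hxy => ?_
    obtain ⟨Z', s, hs, Γ, a, b, z, hab, hx, hy⟩ := exists_local_eqv h S x y hxy
    have hz (a : Γ ⟶ S.carrier) : (z ≫ G.map ((D P).map a)) ≫ θ.app S.carrier ≫ G'.map (quot S) =
        z ≫ θ.app Γ ≫ G'.map (point S a) := by
      rw [Category.assoc, reassoc_of% (hθ a), ← G'.map_comp, D_map_comp_quot]
    rw [← cancel_epi s, ← Category.assoc, ← hx, hz, hab, ← hz, hy, Category.assoc]
  choose η hη using key
  have hpt {S : ER P} {Γ : C} (a : Γ ⟶ S.carrier) :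
      G.map (point S a) ≫ η S = θ.app Γ ≫ G'.map (point S a) := by
    rw [← D_map_comp_quot, G.map_comp, Category.assoc, hη, reassoc_of% (hθ a), G'.map_comp]
  refine ⟨⟨η, fun S T φ => ?_⟩, ?_⟩
  · obtain ⟨Γ, a, b, ha, hab⟩ := exists_cover φ
    have := strongEpi_map_of_surj h ha
    rw [← cancel_epi (G.map (point S a)), ← Category.assoc, ← G.map_comp, hab, hpt,
      ← Category.assoc, hpt, Category.assoc, ← G'.map_comp, hab]
  · ext A
    have h1 : G.map (𝟙 ((D P).obj A)) ≫ η ((D P).obj A) = θ.app A ≫ G'.map (𝟙 ((D P).obj A)) := by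
      exact (congrArg (fun k : (D P).obj A ⟶ (D P).obj A =>
        G.map k ≫ η ((D P).obj A) = θ.app A ≫ G'.map k) (quot_D_obj A)).mp (hη ((D P).obj A))
    rw [G.map_id, G'.map_id, Category.id_comp] at h1
    exact h1.trans (Category.comp_id _)

theorem precomp_full :
    ((embedding P).precomp (SubDoctrine X)).Full where
  map_surjective {K _} t := by
    obtain ⟨η, hη⟩ := exists_natTrans K.isLexRegular t.θ
    exact ⟨⟨η, OneArrow.b_le_re_app η⟩, OneArrow.Hom.ext hη⟩

theorem precomp_faithful :
    ((embedding P).precomp (SubDoctrine X)).Faithful where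
  map_injective {K _ _ _} e := OneArrow.Hom.ext (natTrans_ext K.isLexRegular fun A =>
    NatTrans.congr_app (congrArg OneArrow.Hom.θ e) A)

end Precomposition

end ER

/-! ### Interpreting the internal logic along a one-arrow -/

namespace OneArrow

section Holds

variable {C : Type u} [Category.{v} C] [HasBinaryProducts C] {P : Doctrine.{w} C}
  {X : Type u₁} [Category.{v₁} X] [Regular X] (K : OneArrow P (SubDoctrine X))
  {A B E : C} {Z Z' : X}

/-- The interpretation under a one-arrow of a binary predicate holds at a pair of generalized
elements. -/
def Holds (φ : Fib P (A ⨯ B)) (x : Z ⟶ K.F.obj A) (y : Z ⟶ K.F.obj B) : Prop :=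
  Sub.Mem (K.b (A ⨯ B) φ) (liftProd K.F x y)

variable {K} {φ : Fib P (A ⨯ B)} {x : Z ⟶ K.F.obj A} {y : Z ⟶ K.F.obj B}

theorem mem_b_iff {w : Z ⟶ K.F.obj (A ⨯ B)} :
    Sub.Mem (K.b (A ⨯ B) φ) w ↔ K.Holds φ (w ≫ K.F.map prod.fst) (w ≫ K.F.map prod.snd) := by
  have e : w = liftProd K.F (w ≫ K.F.map prod.fst) (w ≫ K.F.map prod.snd) :=
    liftProd_ext (liftProd_fst _ _).symm (liftProd_snd _ _).symm
  conv_lhs => rw [e]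
  rfl

theorem Holds.pull (h : K.Holds φ x y) (s : Z' ⟶ Z) : K.Holds φ (s ≫ x) (s ≫ y) := by
  have h1 := Sub.Mem.pull h s
  rwa [comp_liftProd] at h1

theorem Holds.of_strongEpi (s : Z' ⟶ Z) [StrongEpi s] (h : K.Holds φ (s ≫ x) (s ≫ y)) :
    K.Holds φ x y := by
  refine Sub.mem_of_strongEpi s ?_
  rw [comp_liftProd]
  exact h

theorem Holds.mono {ψ : Fib P (A ⨯ B)} (h : K.Holds φ x y) (hle : φ ≤ ψ) : K.Holds ψ x y :=
  Sub.Mem.mono h (K.b_mono hle)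

/-- What is forced at points of the base holds at their images. -/
theorem holds_of_sat {Γ : C} {a : Γ ⟶ A} {b : Γ ⟶ B} (h : Sat P φ a b) (z : Z ⟶ K.F.obj Γ) :
    K.Holds φ (z ≫ K.F.map a) (z ≫ K.F.map b) := by
  have h1 := (K.mem_b_of_sat₁ (sat_iff.1 h)).pull z
  rw [mem_b_iff] at h1
  simpa only [Category.assoc, ← K.F.map_comp, prod.lift_fst, prod.lift_snd] using h1

/-- The subobject interpreting a predicate, as a jointly monic pair. -/
theorem exists_tabulation (K : OneArrow P (SubDoctrine X)) (φ : Fib P (A ⨯ B)) :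
    ∃ (R : X) (p₁ : R ⟶ K.F.obj A) (p₂ : R ⟶ K.F.obj B), K.Holds φ p₁ p₂ ∧
      (∀ {Z : X} (u v : Z ⟶ R), u ≫ p₁ = v ≫ p₁ → u ≫ p₂ = v ≫ p₂ → u = v) ∧
      ∀ {Z : X} {x : Z ⟶ K.F.obj A} {y : Z ⟶ K.F.obj B}, K.Holds φ x y →
        ∃ u : Z ⟶ R, u ≫ p₁ = x ∧ u ≫ p₂ = y := by
  refine ⟨_, Sub.arr (K.b _ φ) ≫ K.F.map prod.fst, Sub.arr (K.b _ φ) ≫ K.F.map prod.snd,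
    mem_b_iff.1 (Sub.mem_arr _), fun u v h₁ h₂ => ?_, fun h => ?_⟩
  · rw [← cancel_mono (Sub.arr (K.b _ φ))]
    exact liftProd_ext (by rwa [Category.assoc, Category.assoc])
      (by rwa [Category.assoc, Category.assoc])
  · obtain ⟨u, hu⟩ := h
    refine ⟨u, ?_, ?_⟩
    · rw [← Category.assoc, hu, liftProd_fst]
    · rw [← Category.assoc, hu, liftProd_snd]

theorem holds_re_lift {A' B' : C} {θ : Fib P (A' ⨯ B')} {f : A ⟶ A'} {g : A ⟶ B'}
    {x : Z ⟶ K.F.obj A} :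
    Sub.Mem (K.b A (re P (prod.lift f g) θ)) x ↔ K.Holds θ (x ≫ K.F.map f) (x ≫ K.F.map g) := by
  rw [mem_b_re, mem_b_iff, Category.assoc, Category.assoc, ← K.F.map_comp, ← K.F.map_comp,
    prod.lift_fst, prod.lift_snd]

theorem holds_swap : K.Holds (swap φ) y x ↔ K.Holds φ x y := by
  refine holds_re_lift.trans ?_
  rw [liftProd_fst, liftProd_snd]

theorem holds_inf {ψ : Fib P (A ⨯ B)} : K.Holds (φ ⊓ ψ) x y ↔ K.Holds φ x y ∧ K.Holds ψ x y :=
  K.mem_b_inf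

theorem holds_delta [IsElementary P] {x y : Z ⟶ K.F.obj A} : K.Holds (delta P A) x y ↔ x = y := by
  refine K.mem_b_delta.trans ?_
  rw [liftProd_fst, liftProd_snd]

variable [HasFullComprehensions P]

/-- A sequent `α(a, b), β(b, e) ⊢ γ(a, e)` that is forced in `P` is valid under interpretation. -/
theorem Holds.sequent {α : Fib P (A ⨯ B)} {β : Fib P (B ⨯ E)} {γ : Fib P (A ⨯ E)}
    {e : Z ⟶ K.F.obj E} (h₁ : K.Holds α x y) (h₂ : K.Holds β y e)
    (h : ∀ {Γ : C} (a : Γ ⟶ A) (b : Γ ⟶ B) (e : Γ ⟶ E), Sat P α a b → Sat P β b e → Sat P γ a e) :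
    K.Holds γ x e := by
  have h₁' : Sub.Mem (K.b _ (re P (prod.fst : (A ⨯ B) ⨯ E ⟶ A ⨯ B) α))
      (liftProd K.F (liftProd K.F x y) e) := by
    rw [mem_b_re, liftProd_fst]
    exact h₁
  have h₂' : Sub.Mem (K.b _ (re P (prod.lift ((prod.fst : (A ⨯ B) ⨯ E ⟶ A ⨯ B) ≫ prod.snd)
      prod.snd) β)) (liftProd K.F (liftProd K.F x y) e) := by
    rw [holds_re_lift, K.F.map_comp, ← Category.assoc, liftProd_fst, liftProd_snd, liftProd_snd]
    exact h₂
  have h1 := K.mem_b_inf.2 ⟨h₁', h₂'⟩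
  have h2 := h1.mono (K.b_mono (ER.le_of_sat₃ h))
  rw [holds_re_lift, K.F.map_comp, ← Category.assoc, liftProd_fst, liftProd_snd, liftProd_fst] at h2
  exact h2

variable [IsExistential P] [IsElementary P]

/-- What holds is locally the image of something forced at points of the base. -/
theorem Holds.exists_points (h : K.Holds φ x y) :
    ∃ (Z' : X) (s : Z' ⟶ Z) (_ : StrongEpi s) (Γ : C) (a : Γ ⟶ A) (b : Γ ⟶ B)
      (z : Z' ⟶ K.F.obj Γ), Sat P φ a b ∧ z ≫ K.F.map a = s ≫ x ∧ z ≫ K.F.map b = s ≫ y := by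
  obtain ⟨Z', s, hs, z, hz⟩ := K.exists_chart h
  refine ⟨Z', s, hs, cmpObj P φ, cmp P φ ≫ prod.fst, cmp P φ ≫ prod.snd, z,
    sat₁_iff.1 (sat₁_cmp φ), ?_, ?_⟩
  · rw [K.F.map_comp, reassoc_of% hz, liftProd_fst]
  · rw [K.F.map_comp, reassoc_of% hz, liftProd_snd]

/-- The interpretation of a total relation is locally total. -/
theorem exists_holds (hφ : ⊤ ≤ ex P (prod.fst : A ⨯ B ⟶ A) φ) (x : Z ⟶ K.F.obj A) :
    ∃ (Z' : X) (s : Z' ⟶ Z) (_ : StrongEpi s) (y : Z' ⟶ K.F.obj B), K.Holds φ (s ≫ x) y := by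
  have h1 : Sub.Mem (K.b A (ex P (prod.fst : A ⨯ B ⟶ A) φ)) x := by
    rw [top_le_iff.1 hφ, K.isArrow.map_top]
    exact Sub.mem_top x
  rw [K.isArrow.map_ex _ (isProj_fst _ _), Sub.mem_ex] at h1
  obtain ⟨Z', s, hs, w, hw, hw'⟩ := h1
  rw [mem_b_iff, hw'] at hw
  exact ⟨Z', s, hs, _, hw⟩

end Holds

end OneArrow

/-! ### Extending a one-arrow along the embedding -/

/-- A relation which is reflexive, symmetric and transitive on generalized elements has a quotient
in an exact category. -/
theorem exists_quotient {X : Type u₁} [Category.{v₁} X] [IsExact X] {A R : X} (p₁ p₂ : R ⟶ A)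
    (hinj : ∀ {Z : X} (u v : Z ⟶ R), u ≫ p₁ = v ≫ p₁ → u ≫ p₂ = v ≫ p₂ → u = v)
    (hr : ∃ r : A ⟶ R, r ≫ p₁ = 𝟙 A ∧ r ≫ p₂ = 𝟙 A)
    (hs : ∃ s : R ⟶ R, s ≫ p₁ = p₂ ∧ s ≫ p₂ = p₁)
    (ht : ∀ {Z : X} (u v : Z ⟶ R), u ≫ p₂ = v ≫ p₁ →
      ∃ t : Z ⟶ R, t ≫ p₁ = u ≫ p₁ ∧ t ≫ p₂ = v ≫ p₂) :
    ∃ (B : X) (q : A ⟶ B), StrongEpi q ∧ IsKernelPair q p₁ p₂ := by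
  obtain ⟨r, hr₁, hr₂⟩ := hr
  obtain ⟨s, hs₁, hs₂⟩ := hs
  obtain ⟨t, ht₁, ht₂⟩ := ht _ _ (pullback.condition (f := p₂) (g := p₁))
  have h : EquivalenceRelation p₁ p₂ :=
    { right_cancellation := fun _ u v => hinj u v
      r := r, reflexivity₁ := hr₁, reflexivity₂ := hr₂
      s := s, symmetry₁ := hs₁, symmetry₂ := hs₂
      c := _
      isLimit := pullbackIsPullback p₂ p₁
      t := t, transitivity₁ := ht₁, transitivity₂ := ht₂ }
  obtain ⟨e⟩ := (IsExact.effective p₁ p₂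
    h.isEquivalenceRelation).nonempty_effectiveEquivalenceRelation
  exact ⟨e.B, e.π, inferInstance, e.isKernelPair⟩

namespace OneArrow

variable {C : Type u} [Category.{v} C] [HasBinaryProducts C] {P : Doctrine.{w} C}
  [IsElementary P] [IsExistential P] [HasFullComprehensions P]
  {X : Type u₁} [Category.{v₁} X] [IsExact X] (K : OneArrow P (SubDoctrine X))

/-- The interpretation of the relation of an object of `ER P` is the kernel pair of a strong
epimorphism. -/
theorem exists_quot (S : ER P) : ∃ (B : X) (q : K.F.obj S.carrier ⟶ B), StrongEpi q ∧
    ∀ {Z : X} (x y : Z ⟶ K.F.obj S.carrier), x ≫ q = y ≫ q ↔ K.Holds S.rel x y := by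
  obtain ⟨R, p₁, p₂, hp, hinj, hl⟩ := K.exists_tabulation S.rel
  have hrefl : K.Holds S.rel (𝟙 _) (𝟙 _) := by
    have h1 := holds_of_sat (K := K) (ER.Eqv.refl (S := S) (𝟙 S.carrier)) (𝟙 _)
    rwa [K.F.map_id, Category.comp_id] at h1
  have hsymm : K.Holds S.rel p₂ p₁ :=
    holds_swap.1 (hp.mono (le_of_sat fun a b h => sat_swap.2 (ER.Eqv.symm h)))
  obtain ⟨B, q, hq, hk⟩ := exists_quotient p₁ p₂ hinj (hl hrefl) (hl hsymm)
    (fun u v h => hl ((h ▸ hp.pull u).sequent (hp.pull v) fun _ _ _ h h' => ER.Eqv.trans h h'))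
  refine ⟨B, q, hq, fun x y => ⟨fun h => ?_, fun h => ?_⟩⟩
  · have h1 := hp.pull (hk.lift x y h)
    rwa [hk.lift_fst, hk.lift_snd] at h1
  · obtain ⟨u, rfl, rfl⟩ := hl h
    rw [Category.assoc, hk.w, Category.assoc]

/-- The value of the extension of `K` at `(A, ρ)`: the quotient of `K A` by the interpretation of
`ρ`. -/
def extObj (S : ER P) : X := (K.exists_quot S).choose

/-- The quotient map `K A ⟶ K A / ρ`. -/
def extQuot (S : ER P) : K.F.obj S.carrier ⟶ K.extObj S := (K.exists_quot S).choose_spec.choose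

instance (S : ER P) : StrongEpi (K.extQuot S) := (K.exists_quot S).choose_spec.choose_spec.1

variable {K} {S T U : ER P} {Z : X}

theorem comp_extQuot_eq_iff {x y : Z ⟶ K.F.obj S.carrier} :
    x ≫ K.extQuot S = y ≫ K.extQuot S ↔ K.Holds S.rel x y :=
  (K.exists_quot S).choose_spec.choose_spec.2 x y

theorem Holds.maps_single {φ : S ⟶ T} {x : Z ⟶ K.F.obj S.carrier} {y y' : Z ⟶ K.F.obj T.carrier}
    (h : K.Holds φ.rel x y) (h' : K.Holds φ.rel x y') : K.Holds T.rel y y' :=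
  (holds_swap.2 h).sequent h' fun _ _ _ h h' => ER.Maps.single (sat_swap.1 h) h'

theorem Holds.maps_left {φ : S ⟶ T} {x x' : Z ⟶ K.F.obj S.carrier} {y : Z ⟶ K.F.obj T.carrier}
    (h : K.Holds φ.rel x y) (e : K.Holds S.rel x' x) : K.Holds φ.rel x' y :=
  e.sequent h fun _ _ _ h h' => ER.Maps.left h' h

theorem Holds.maps_right {φ : S ⟶ T} {x : Z ⟶ K.F.obj S.carrier} {y y' : Z ⟶ K.F.obj T.carrier}
    (h : K.Holds φ.rel x y) (e : K.Holds T.rel y y') : K.Holds φ.rel x y' :=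
  h.sequent e fun _ _ _ h h' => ER.Maps.right h h'

/-- A functional relation is interpreted as an arrow between the quotients. Its graph `R` maps onto
the domain by totality, and the second projection descends by single-valuedness. -/
theorem exists_extMap (φ : S ⟶ T) : ∃ g : K.extObj S ⟶ K.extObj T,
    ∀ {Z : X} (x : Z ⟶ K.F.obj S.carrier) (y : Z ⟶ K.F.obj T.carrier),
      x ≫ K.extQuot S ≫ g = y ≫ K.extQuot T ↔ K.Holds φ.rel x y := by
  obtain ⟨R, p₁, p₂, hp, -, hl⟩ := K.exists_tabulation φ.rel
  have hs : StrongEpi p₁ := by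
    obtain ⟨Z', s, hs, y, hy⟩ := exists_holds φ.total (𝟙 (K.F.obj S.carrier))
    rw [Category.comp_id] at hy
    obtain ⟨u, hu, -⟩ := hl hy
    exact strongEpi_of_local s u hu
  have hs' : StrongEpi (p₁ ≫ K.extQuot S) := strongEpi_comp _ _
  obtain ⟨g, hg⟩ := exists_desc_of_strongEpi (p₁ ≫ K.extQuot S) (p₂ ≫ K.extQuot T)
    (fun u v h => by
      rw [← Category.assoc, ← Category.assoc] at h ⊢
      rw [comp_extQuot_eq_iff] at h ⊢
      exact (hp.pull u).maps_single ((hp.pull v).maps_left h))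
  have key {Z : X} {x : Z ⟶ K.F.obj S.carrier} {y : Z ⟶ K.F.obj T.carrier}
      (h : K.Holds φ.rel x y) : x ≫ K.extQuot S ≫ g = y ≫ K.extQuot T := by
    obtain ⟨u, rfl, rfl⟩ := hl h
    rw [Category.assoc, Category.assoc, ← hg, Category.assoc]
  refine ⟨g, fun x y => ⟨fun h => ?_, key⟩⟩
  obtain ⟨Z', s, hs, y', hy'⟩ := exists_holds φ.total x
  have h1 := key hy'
  rw [Category.assoc, h, ← Category.assoc, comp_extQuot_eq_iff] at h1
  exact .of_strongEpi s (hy'.maps_right (holds_swap.1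
    (h1.mono (le_of_sat fun _ _ h => sat_swap.2 (ER.Eqv.symm h)))))

/-- The action of the extension on arrows. -/
def extMap (K : OneArrow P (SubDoctrine X)) (φ : S ⟶ T) : K.extObj S ⟶ K.extObj T :=
  (exists_extMap φ).choose

theorem comp_extMap_eq_iff {φ : S ⟶ T} {x : Z ⟶ K.F.obj S.carrier} {y : Z ⟶ K.F.obj T.carrier} :
    x ≫ K.extQuot S ≫ K.extMap φ = y ≫ K.extQuot T ↔ K.Holds φ.rel x y :=
  (exists_extMap φ).choose_spec x y

theorem eq_extMap {φ : S ⟶ T} {g : K.extObj S ⟶ K.extObj T}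
    (h : ∀ {Z : X} (x : Z ⟶ K.F.obj S.carrier) (y : Z ⟶ K.F.obj T.carrier),
      K.Holds φ.rel x y → x ≫ K.extQuot S ≫ g = y ≫ K.extQuot T) : K.extMap φ = g := by
  obtain ⟨Z', s, hs, y, hy⟩ := exists_holds φ.total (𝟙 (K.F.obj S.carrier))
  rw [Category.comp_id] at hy
  rw [← cancel_epi (K.extQuot S), ← cancel_epi s, comp_extMap_eq_iff.2 hy, h _ _ hy]

/-- The extension of a one-arrow `P → Sub_X` to a functor `ER P ⥤ X`. -/
def ext (K : OneArrow P (SubDoctrine X)) : ER P ⥤ X where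
  obj := K.extObj
  map := K.extMap
  map_id S := eq_extMap fun x y h => by
    rw [Category.comp_id]
    exact comp_extQuot_eq_iff.2 h
  map_comp {S T U} φ ψ := by
    obtain ⟨Z, s, hs, y, hy⟩ := exists_holds φ.total (𝟙 (K.F.obj S.carrier))
    obtain ⟨Z', t, ht, e, he⟩ := exists_holds ψ.total y
    rw [Category.comp_id] at hy
    have h : K.Holds (φ ≫ ψ).rel (t ≫ s) e :=
      (hy.pull t).sequent he fun _ _ _ h h' => ER.Maps.comp h h'
    have h1 := comp_extMap_eq_iff.2 hy
    have h2 := comp_extMap_eq_iff.2 he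
    have := strongEpi_comp t s
    rw [← cancel_epi (K.extQuot S), ← cancel_epi (t ≫ s), comp_extMap_eq_iff.2 h, ← h2,
      Category.assoc, ← reassoc_of% h1, Category.assoc]

end OneArrow

/-! ### The extension preserves limits and images -/

namespace ER

variable {C : Type u} [Category.{v} C] [HasBinaryProducts C] {P : Doctrine.{w} C}
  [IsElementary P] [IsExistential P] [HasFullComprehensions P] {S T U : ER P} {Γ : C}

theorem maps_point_comp {φ : S ⟶ T} {a : Γ ⟶ S.carrier} {Δ : C} {x : Δ ⟶ Γ}
    {d : Δ ⟶ T.carrier} : Maps (point S a ≫ φ) x d ↔ Maps φ (x ≫ a) d :=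
  maps_ofMap_comp (S := ER.diag P Γ)

/-- The relation `∃ d, φ(a, d) ∧ ψ(b, d)` carrying a pullback is forced at a pair of points if and
only if the two points agree in `U`. -/
theorem sat_pbRel_iff {φ : S ⟶ U} {ψ : T ⟶ U} {a : Γ ⟶ S.carrier} {b : Γ ⟶ T.carrier} :
    Sat P (pbRel φ ψ) a b ↔ point S a ≫ φ = point T b ≫ ψ := by
  constructor
  · intro h
    refine hom_ext fun x d hd => ?_
    have hd' := maps_point_comp.1 hd
    obtain ⟨Δ, s, hs, d', h₁, h₂⟩ := sat_pbRel.1 (h.pull x)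
    exact maps_point_comp.2 (hs.sat (h₂.right (h₁.single (hd'.pull s))))
  · intro h
    obtain ⟨Δ, s, hs, d, hd⟩ := exists_maps φ a
    refine sat_pbRel.2 ⟨Δ, s, hs, d, hd, ?_⟩
    exact maps_point_comp.1 (h ▸ maps_point_comp.2 hd)

theorem ex_swap_of_surj {φ : S ⟶ T} (h : Surj φ) :
    ⊤ ≤ ex P (prod.fst : T.carrier ⨯ S.carrier ⟶ T.carrier) (swap φ.rel) :=
  le_of_sat₁ fun b _ => by
    obtain ⟨Δ, s, hs, a, ha⟩ := h b
    exact sat₁_ex.2 ⟨Δ, s, hs, a, sat_swap.2 ha⟩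

end ER

namespace OneArrow

open ER

variable {C : Type u} [Category.{v} C] [HasBinaryProducts C] {P : Doctrine.{w} C}
  [IsElementary P] [IsExistential P] [HasFullComprehensions P]
  {X : Type u₁} [Category.{v₁} X] [IsExact X] {K : OneArrow P (SubDoctrine X)}
  {E S T U : ER P} {Z : X} {Γ : C}

variable (K) in
/-- The quotient map from the value of `K` to the value of its extension. -/
def extπ (S : ER P) : K.F.obj S.carrier ⟶ K.ext.obj S := K.extQuot S

variable (K) in
/-- The comparison between `K` and the restriction of its extension. -/
def extUnit (A : C) : K.F.obj A ⟶ K.ext.obj ((D P).obj A) := K.extπ ((D P).obj A)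

instance (S : ER P) : StrongEpi (K.extπ S) := inferInstanceAs (StrongEpi (K.extQuot S))

theorem comp_extπ_eq_iff {x y : Z ⟶ K.F.obj S.carrier} :
    x ≫ K.extπ S = y ≫ K.extπ S ↔ K.Holds S.rel x y := comp_extQuot_eq_iff

theorem comp_ext_map_eq_iff {φ : S ⟶ T} {x : Z ⟶ K.F.obj S.carrier} {y : Z ⟶ K.F.obj T.carrier} :
    x ≫ K.extπ S ≫ K.ext.map φ = y ≫ K.extπ T ↔ K.Holds φ.rel x y :=
  comp_extMap_eq_iff

theorem extUnit_point (a : Γ ⟶ S.carrier) :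
    K.extUnit Γ ≫ K.ext.map (point S a) = K.F.map a ≫ K.extπ S := by
  have h : Sat P (point S a).rel (𝟙 Γ) a := maps_point.2 (by
    rw [Category.id_comp]
    exact Eqv.refl a)
  have h1 : K.Holds (point S a).rel (𝟙 (K.F.obj Γ)) (K.F.map a) := by
    have h2 := holds_of_sat (K := K) h (𝟙 (K.F.obj Γ))
    rw [Category.id_comp, Category.id_comp] at h2
    have e : K.F.map (𝟙 Γ) = 𝟙 (K.F.obj Γ) := K.F.map_id Γ
    exact e ▸ h2
  exact (Category.id_comp _).symm.trans (comp_ext_map_eq_iff.2 h1)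

/-- Elements of two quotients that agree under arrows of `ER P` locally come from points. -/
theorem holds_pbRel {φ : S ⟶ U} {ψ : T ⟶ U} {x : Z ⟶ K.F.obj S.carrier}
    {y : Z ⟶ K.F.obj T.carrier}
    (h : x ≫ K.extπ S ≫ K.ext.map φ = y ≫ K.extπ T ≫ K.ext.map ψ) :
    K.Holds (pbRel φ ψ) x y := by
  obtain ⟨Z', s, hs, d, hd⟩ := exists_holds φ.total x
  have h1 := comp_ext_map_eq_iff.2 hd
  rw [Category.assoc, h, ← Category.assoc, comp_ext_map_eq_iff] at h1
  exact .of_strongEpi s (hd.sequent (holds_swap.2 h1) fun a d b h h' =>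
    sat_pbRel.2 ⟨_, 𝟙 _, PCover.id _, d, by rw [Category.id_comp]; exact h,
      by rw [Category.id_comp]; exact sat_swap.1 h'⟩)

theorem exists_local_extπ (u : Z ⟶ K.ext.obj S) :
    ∃ (Z' : X) (s : Z' ⟶ Z) (_ : StrongEpi s) (x : Z' ⟶ K.F.obj S.carrier),
      x ≫ K.extπ S = s ≫ u := exists_local_preimage (K.extπ S) u

/-- A jointly monic pair in `ER P` stays jointly monic: that its kernel is contained in the relation
of `E` is a statement forced in `P`. -/
theorem ext_jointly_injective {p : E ⟶ S} {q : E ⟶ T}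
    (hinj : ∀ {V : ER P} (f g : V ⟶ E), f ≫ p = g ≫ p → f ≫ q = g ≫ q → f = g)
    (u v : Z ⟶ K.ext.obj E) (h₁ : u ≫ K.ext.map p = v ≫ K.ext.map p)
    (h₂ : u ≫ K.ext.map q = v ≫ K.ext.map q) : u = v := by
  obtain ⟨Z₁, s, hs, x, hx⟩ := exists_local_extπ u
  obtain ⟨Z₂, t, ht, y, hy⟩ := exists_local_extπ (s ≫ v)
  have hx' : (t ≫ x) ≫ K.extπ E = (t ≫ s) ≫ u := by
    rw [Category.assoc, hx, Category.assoc]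
  have hy' : y ≫ K.extπ E = (t ≫ s) ≫ v := by rw [hy, Category.assoc]
  have key {V : ER P} (r : E ⟶ V) (h : u ≫ K.ext.map r = v ≫ K.ext.map r) :
      K.Holds (pbRel r r) (t ≫ x) y := holds_pbRel (by
    rw [← Category.assoc, hx', Category.assoc, h, ← Category.assoc, ← hy', Category.assoc])
  have hE : K.Holds E.rel (t ≫ x) y := (holds_inf.2 ⟨key p h₁, key q h₂⟩).mono
    (le_of_sat fun a b h => point_eq_iff.1 (hinj _ _ (sat_pbRel_iff.1 (sat_inf.1 h).1)
      (sat_pbRel_iff.1 (sat_inf.1 h).2)))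
  have := strongEpi_comp t s
  rw [← cancel_epi (t ≫ s), ← hx', ← hy', comp_extπ_eq_iff]
  exact hE

theorem extUnit_comp_lift {p : E ⟶ S} {a : Γ ⟶ S.carrier} {k : (D P).obj Γ ⟶ E}
    (hk : k ≫ p = point S a) (z : Z ⟶ K.F.obj Γ) :
    (z ≫ K.extUnit Γ ≫ K.ext.map k) ≫ K.ext.map p =
      (z ≫ K.F.map a) ≫ K.extπ S := by
  rw [Category.assoc, Category.assoc, ← K.ext.map_comp, hk, extUnit_point, Category.assoc]

/-- Local elements of a product or pullback in `X` lift to local elements of the values of `K`; for a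
pullback these are images of a pair of points satisfying the relation, to which the universal
property in `ER P` applies. -/
theorem isLexRegular_ext (K : OneArrow P (SubDoctrine X)) : IsLexRegular K.ext where
  preservesProducts := preservesBinaryProducts_of_isLimit _ fun S T => by
    refine isLimit_of_local (ext_jointly_injective fun f g h₁ h₂ => Limits.prod.hom_ext h₁ h₂) ?_
    intro Z x y
    obtain ⟨Z₁, s, hs, a, ha⟩ := exists_local_extπ x
    obtain ⟨Z₂, t, ht, b, hb⟩ := exists_local_extπ (s ≫ y)
    refine ⟨Z₂, t ≫ s, strongEpi_comp t s, liftProd K.F (t ≫ a) b ≫ K.extUnit (S.carrier ⨯ T.carrier) ≫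
      K.ext.map (prod.lift (point S prod.fst) (point T prod.snd)), ?_, ?_⟩
    · rw [extUnit_comp_lift (prod.lift_fst _ _), liftProd_fst, Category.assoc, ha, Category.assoc]
    · rw [extUnit_comp_lift (prod.lift_snd _ _), liftProd_snd, hb, Category.assoc]
  map_isPullback {E S T U p q φ ψ} hp := by
    refine isPullback_of_local (by rw [← K.ext.map_comp, hp.w, K.ext.map_comp])
      (ext_jointly_injective fun f g h₁ h₂ => hp.hom_ext h₁ h₂) ?_
    intro Z x y hxy
    obtain ⟨Z₁, s, hs, a, ha⟩ := exists_local_extπ x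
    obtain ⟨Z₂, t, ht, b, hb⟩ := exists_local_extπ (s ≫ y)
    have h : K.Holds (pbRel φ ψ) (t ≫ a) b := holds_pbRel (by
      rw [Category.assoc, reassoc_of% ha, reassoc_of% hb, hxy])
    obtain ⟨Z₃, r, hr, Γ, a', b', z, hab, hza, hzb⟩ := h.exists_points
    have hl := sat_pbRel_iff.1 hab
    have := strongEpi_comp t s
    refine ⟨Z₃, r ≫ t ≫ s, strongEpi_comp _ _, z ≫ K.extUnit Γ ≫
      K.ext.map (hp.lift _ _ hl), ?_, ?_⟩
    · rw [extUnit_comp_lift (hp.lift_fst _ _ hl), hza]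
      rw [Category.assoc, Category.assoc, ha, Category.assoc, Category.assoc]
    · rw [extUnit_comp_lift (hp.lift_snd _ _ hl), hzb]
      rw [Category.assoc, hb, Category.assoc, Category.assoc]
  map_strongEpi {S T} φ hφ := by
    obtain ⟨Z, s, hs, x, hx⟩ :=
      exists_holds (ex_swap_of_surj (surj_of_strongEpi φ)) (𝟙 (K.F.obj T.carrier))
    rw [Category.comp_id, holds_swap] at hx
    have := strongEpi_comp s (K.extπ T)
    exact strongEpi_of_local (s ≫ K.extπ T) (x ≫ K.extπ S)
      ((Category.assoc _ _ _).trans (comp_ext_map_eq_iff.2 hx))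

/-! ### Precomposition with the embedding is essentially surjective -/

/-- The quotient map is invertible on the objects of the base. -/
theorem isIso_extUnit (K : OneArrow P (SubDoctrine X)) (A : C) :
    IsIso (K.extUnit A) := by
  have : Mono (K.extUnit A) := ⟨fun x y h => by
    have h1 := (comp_extπ_eq_iff (S := (D P).obj A)).1 h
    exact (holds_delta (A := A)).1 h1⟩
  have : StrongEpi (K.extUnit A) := inferInstanceAs (StrongEpi (K.extπ ((D P).obj A)))
  exact isIso_of_mono_of_strongEpi _

/-- The extension of `K` restricts to `K` along the embedding. -/
def restrictExtIso (K : OneArrow P (SubDoctrine X)) : K.F ≅ D P ⋙ K.ext :=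
  have := K.isIso_extUnit
  NatIso.ofComponents (fun A => asIso (K.extUnit A)) fun {A B} f => by
    have h := extUnit_point (K := K) (S := (D P).obj B) f
    rw [← D_map_eq_point] at h
    exact h.symm

/-- The extension of a one-arrow `P → Sub_X` to a one-arrow between doctrines of subobjects. -/
def extArrow (K : OneArrow P (SubDoctrine X)) : OneArrow (SubDoctrine (ER P)) (SubDoctrine X) :=
  ⟨K.ext, K.isLexRegular_ext.direct, K.isLexRegular_ext.isArrow⟩

theorem precomp_essSurj : ((embedding P).precomp (SubDoctrine X)).EssSurj where
  mem_essImage K :=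
    have := full_forget (P := P) (X := X)
    have := faithful_forget P (SubDoctrine X)
    ⟨K.extArrow, ⟨((forget P (SubDoctrine X)).preimageIso (X := K)
      (Y := ((embedding P).precomp (SubDoctrine X)).obj K.extArrow) K.restrictExtIso).symm⟩⟩

theorem precomp_isEquivalence : ((embedding P).precomp (SubDoctrine X)).IsEquivalence where
  faithful := precomp_faithful
  full := precomp_full
  essSurj := precomp_essSurj

end OneArrow

/-! ### Exactness in the presence of a terminal object -/

namespace ER

variable {C : Type u} [Category.{v} C] [HasBinaryProducts C] {P : Doctrine.{w} C}
  [IsElementary P] [IsExistential P] [HasFullComprehensions P]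

theorem eqv_of_isTerminal {t Γ : C} (ht : IsTerminal t) (a b : Γ ⟶ ((D P).obj t).carrier) :
    ((D P).obj t).Eqv a b := by
  have e : a = b := IsTerminal.hom_ext (X := t) ht a b
  exact e ▸ Eqv.refl a

/-- The embedding sends terminal objects to terminal objects. -/
def isTerminalD {t : C} (ht : IsTerminal t) : IsTerminal ((D P).obj t) :=
  IsTerminal.ofUniqueHom
    (fun S => ofMap S ((D P).obj t) (ht.from S.carrier) fun _ _ _ _ => eqv_of_isTerminal ht _ _)
    fun _ _ => hom_ext fun _ _ _ => maps_ofMap.2 (eqv_of_isTerminal ht _ _)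

theorem D_preservesTerminal [HasTerminal C] : PreservesTerminal (D P) := by
  have : PreservesLimit (Functor.empty.{0} C) (D P) :=
    preservesLimit_of_preserves_limit_cone terminalIsTerminal
      ((isLimitMapConeEmptyConeEquiv (D P) (⊤_ C)).symm (isTerminalD terminalIsTerminal))
  exact preservesLimitsOfShape_pempty_of_preservesTerminal (D P)

theorem hasFiniteLimits [HasTerminal C] : HasFiniteLimits (ER P) :=
  have : HasTerminal (ER P) := (isTerminalD (P := P) (terminalIsTerminal (C := C))).hasTerminal
  hasFiniteLimits_of_hasTerminal_and_pullbacks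

theorem regular [HasTerminal C] : Regular (ER P) where
  toHasFiniteLimits := hasFiniteLimits
  hasCoequalizer_of_isKernelPair {S T R φ g₁ g₂} h := by
    have h1 : IsKernelPair (imπ φ ≫ imι φ) g₁ g₂ := by rwa [imπ_comp_imι]
    have := (surj_imπ φ).isRegularEpi
    exact ⟨⟨⟨_, (IsKernelPair.cancel_right_of_mono h1).toCoequalizer'⟩⟩⟩
  regularEpiIsStableUnderBaseChange := ⟨fun sq hg => by
    have hg' : IsRegularEpi _ := hg
    have := HasStableImages.strongEpi_of_isPullback sq.flip inferInstance
    exact (surj_of_strongEpi _).isRegularEpi⟩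

section Effective

variable {R A : ER P} {p₁ p₂ : R ⟶ A} {Γ : C}

/-- The predicate `∃ r, p₁(r, a) ∧ p₂(r, a')` associated with a pair of parallel arrows. -/
def pairRel (p₁ p₂ : R ⟶ A) : Fib P (A.carrier ⨯ A.carrier) :=
  compRel (swap (Hom.rel p₁)) (Hom.rel p₂)

theorem sat_pairRel {a a' : Γ ⟶ A.carrier} : Sat P (pairRel p₁ p₂) a a' ↔
    ∃ (Δ : C) (s : Δ ⟶ Γ) (_ : PCover P s) (r : Δ ⟶ R.carrier),
      Maps p₁ r (s ≫ a) ∧ Maps p₂ r (s ≫ a') := by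
  refine sat_compRel.trans ?_
  simp only [sat_swap]
  rfl

/-- For a jointly monic pair, the local witnesses for the associated predicate glue. -/
theorem sat_pairRel_iff (h : JointlyInjective p₁ p₂) {a a' : Γ ⟶ A.carrier} :
    Sat P (pairRel p₁ p₂) a a' ↔
      ∃ k : (D P).obj Γ ⟶ R, k ≫ p₁ = point A a ∧ k ≫ p₂ = point A a' := by
  constructor
  · intro hs
    refine h.exists_lift _ _ fun {Δ} e b b' hb hb' => ?_
    obtain ⟨Δ, s, hs, r, h₁, h₂⟩ := sat_pairRel.1 (hs.pull e)
    exact ⟨Δ, s, hs, r, h₁.right ((maps_point.1 hb).pull s), h₂.right ((maps_point.1 hb').pull s)⟩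
  · rintro ⟨k, h₁, h₂⟩
    obtain ⟨Δ, s, hs, r, hr⟩ := exists_point k
    refine sat_pairRel.2 ⟨Δ, s, hs, r, point_comp_eq_point_iff.1 ?_,
      point_comp_eq_point_iff.1 ?_⟩
    · rw [← hr, Category.assoc, h₁, D_map_comp_point]
    · rw [← hr, Category.assoc, h₂, D_map_comp_point]

variable (e : EquivalenceRelation p₁ p₂)

theorem jointlyInjective_of_equivalenceRelation (e : EquivalenceRelation p₁ p₂) :
    JointlyInjective p₁ p₂ := jointlyInjective_of_hom_ext fun f g => e.right_cancellation f g

/-- The quotient of an object of `ER P` by an equivalence relation: the carrier is unchanged. -/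
abbrev effQuotient (e : EquivalenceRelation p₁ p₂) : ER P :=
  have hinj := jointlyInjective_of_equivalenceRelation e
  ofSat A.carrier (pairRel p₁ p₂)
    (fun a => (sat_pairRel_iff hinj).2 ⟨point A a ≫ e.r, by
      rw [Category.assoc, e.reflexivity₁, Category.comp_id], by
      rw [Category.assoc, e.reflexivity₂, Category.comp_id]⟩)
    (fun a b h => by
      obtain ⟨k, h₁, h₂⟩ := (sat_pairRel_iff hinj).1 h
      exact (sat_pairRel_iff hinj).2 ⟨k ≫ e.s, by rw [Category.assoc, e.symmetry₁, h₂],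
        by rw [Category.assoc, e.symmetry₂, h₁]⟩)
    (fun a b d h h' => by
      obtain ⟨k, h₁, h₂⟩ := (sat_pairRel_iff hinj).1 h
      obtain ⟨k', h₁', h₂'⟩ := (sat_pairRel_iff hinj).1 h'
      obtain ⟨l, hl, hl'⟩ := PullbackCone.IsLimit.lift' e.isLimit k k' (h₂.trans h₁'.symm)
      exact (sat_pairRel_iff hinj).2 ⟨l ≫ e.t, by
        rw [Category.assoc, e.transitivity₁, reassoc_of% hl, h₁], by
        rw [Category.assoc, e.transitivity₂, reassoc_of% hl', h₂']⟩)

theorem respects_effQuotient : Respects A (effQuotient e) (𝟙 A.carrier) := fun Γ a a' h => by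
  refine (sat_pairRel_iff (jointlyInjective_of_equivalenceRelation e)).2 ⟨point A a ≫ e.r, ?_, ?_⟩
  · rw [Category.assoc, e.reflexivity₁, Category.comp_id, Category.comp_id]
  · rw [Category.assoc, e.reflexivity₂, Category.comp_id, Category.comp_id, point_eq_iff.2 h]

/-- The quotient map, carried by the identity. -/
def effπ (e : EquivalenceRelation p₁ p₂) : A ⟶ effQuotient e :=
  ofMap A (effQuotient e) (𝟙 A.carrier) (respects_effQuotient e)

theorem maps_effπ {a : Γ ⟶ A.carrier} {b : Γ ⟶ A.carrier} :
    Maps (effπ e) a b ↔ Sat P (pairRel p₁ p₂) a b := by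
  refine (maps_ofMap (T := effQuotient e) (hf := respects_effQuotient e)).trans ?_
  rw [Category.comp_id]
  rfl

theorem surj_effπ : Surj (effπ e) := fun Γ b =>
  ⟨Γ, 𝟙 Γ, PCover.id Γ, b, (maps_effπ e).2 (by
    rw [Category.id_comp]
    exact Eqv.refl (S := effQuotient e) b)⟩

/-- The quotient is effective: the predicate `∃ r, p₁(r, a) ∧ p₂(r, a')` recovers `R`. -/
theorem isKernelPair_effπ : IsKernelPair (effπ e) p₁ p₂ := by
  have hinj := jointlyInjective_of_equivalenceRelation e
  refine isPullback_of_jointlyInjective ?_ hinj ?_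
  · refine hom_ext fun r b hb => ?_
    obtain ⟨Δ, s, hs, a, ha, hab⟩ := maps_comp.1 hb
    obtain ⟨Δ', t, ht, a', ha'⟩ := exists_maps p₂ (s ≫ r)
    have h1 : (effQuotient e).Eqv (t ≫ a) a' := (sat_pairRel_iff hinj).2
      ⟨point R (t ≫ s ≫ r), point_comp_eq_point_iff.2 (ha.pull t), point_comp_eq_point_iff.2 ha'⟩
    have h2 : (effQuotient e).Eqv (t ≫ a) (t ≫ s ≫ b) := (maps_effπ e).1 (hab.pull t)
    refine (hs.comp ht).sat ?_
    rw [Category.assoc, Category.assoc]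
    exact ha'.comp ((maps_effπ e).2 (h1.symm.trans h2))
  · intro Γ a b d ha hb
    have h1 : (effQuotient e).Eqv a d := (maps_effπ e).1 ha
    have h2 : (effQuotient e).Eqv b d := (maps_effπ e).1 hb
    exact sat_pairRel.1 (h1.trans h2.symm)

theorem isPushout_effπ : IsPushout p₁ p₂ (effπ e) (effπ e) := by
  have hw := (isKernelPair_effπ e).w
  have hinj := jointlyInjective_of_equivalenceRelation e
  have := (surj_effπ e).epi
  have key (s : PushoutCocone p₁ p₂) : ∃ g : effQuotient e ⟶ s.pt,
      effπ e ≫ g = s.inl ∧ effπ e ≫ g = s.inr := by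
    have h : s.inl = s.inr := by
      rw [← Category.id_comp s.inl, ← e.reflexivity₁, Category.assoc, s.condition,
        ← Category.assoc, e.reflexivity₂, Category.id_comp]
    obtain ⟨g, hg⟩ := (surj_effπ e).exists_desc s.inl fun a a' b ha ha' => by
      have h1 : (effQuotient e).Eqv a b := (maps_effπ e).1 ha
      have h2 : (effQuotient e).Eqv a' b := (maps_effπ e).1 ha'
      obtain ⟨k, h₁, h₂⟩ := (sat_pairRel_iff hinj).1 (h1.trans h2.symm)
      rw [← h₁, ← h₂, Category.assoc, Category.assoc, s.condition, h]
    exact ⟨g, hg, hg.trans h⟩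
  exact ⟨⟨hw⟩, ⟨PushoutCocone.IsColimit.mk hw (fun s => (key s).choose)
    (fun s => (key s).choose_spec.1) (fun s => (key s).choose_spec.2) fun s m hm _ => by
      rw [← cancel_epi (effπ e), hm, (key s).choose_spec.1]⟩⟩

end Effective

theorem isExact [HasTerminal C] : IsExact (ER P) where
  toRegular := regular
  effective p₁ p₂ h := by
    obtain ⟨e⟩ := h.nonempty_equivalenceRelation
    exact ⟨⟨{ e with
      B := effQuotient e
      π := effπ e
      isKernelPair := isKernelPair_effπ e
      isPushout := isPushout_effπ e }⟩⟩

end ER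

/-! ### Regular functors -/

theorem IsLexRegular.preservesPullbacks {Y : Type u₁} [Category.{v₁} Y] [HasPullbacks Y]
    {X : Type u₂} [Category.{v₂} X] {F : Y ⥤ X} (h : IsLexRegular F) :
    PreservesLimitsOfShape WalkingCospan F where
  preservesLimit {K} := by
    have hp := IsPullback.of_hasPullback (K.map WalkingCospan.Hom.inl) (K.map WalkingCospan.Hom.inr)
    have : PreservesLimit (cospan (K.map WalkingCospan.Hom.inl) (K.map WalkingCospan.Hom.inr)) F :=
      preservesLimit_of_preserves_limit_cone hp.isLimit
        ((isLimitMapConePullbackConeEquiv F hp.w).symm (h.map_isPullback hp).isLimit)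
    exact preservesLimit_of_iso_diagram F (diagramIsoCospan K).symm

namespace ER

variable {C : Type u} [Category.{v} C] [HasBinaryProducts C] {P : Doctrine.{w} C}
  [IsElementary P] [IsExistential P] [HasFullComprehensions P]
  {X : Type u₁} [Category.{v₁} X] [Regular X]

/-- The terminal object of `ER P` is the image of the terminal object of the base. -/
theorem preservesTerminal_iff [HasTerminal C] (F : ER P ⥤ X) :
    PreservesTerminal (D P ⋙ F) ↔ PreservesTerminal F := by
  have hD : PreservesTerminal (D P) := D_preservesTerminal
  constructor
  · intro h
    have ht : IsTerminal ((D P ⋙ F).obj (⊤_ C)) :=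
      terminalIsTerminal.isTerminalObj (D P ⋙ F) (⊤_ C)
    have : PreservesLimit (Functor.empty.{0} (ER P)) F :=
      preservesLimit_of_preserves_limit_cone (isTerminalD terminalIsTerminal)
        ((isLimitMapConeEmptyConeEquiv F _).symm ht)
    exact preservesLimitsOfShape_pempty_of_preservesTerminal F
  · intro h
    infer_instance

/-- Regular functors on `ER P` are the functors of terminal-preserving one-arrows, as finite limits
are built from pullbacks and the terminal object. -/
theorem isRegularFunctor_iff [HasTerminal C] (F : ER P ⥤ X) : IsRegularFunctor F ↔
    ∃ G : OneArrow (SubDoctrine (ER P)) (SubDoctrine X), G.F = F ∧ PreservesTerminal G.F := by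
  constructor
  · intro h
    have := h.preservesFiniteLimits
    have hF : IsLexRegular F :=
      { preservesProducts := inferInstance
        map_isPullback := fun hp => hp.map F
        map_strongEpi := fun φ _ =>
          have := h.map_regularEpi φ (surj_of_strongEpi φ).isRegularEpi
          inferInstance }
    exact ⟨⟨F, hF.direct, hF.isArrow⟩, rfl, inferInstance⟩
  · rintro ⟨G, rfl, hG⟩
    have hF := G.isLexRegular
    have := hF.preservesPullbacks
    have : HasTerminal (ER P) := (isTerminalD (P := P) (terminalIsTerminal (C := C))).hasTerminal
    exact
      { preservesFiniteLimits := preservesFiniteLimits_of_preservesTerminal_and_pullbacks G.F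
        map_regularEpi := fun φ _ => (isRegularEpi_iff_strongEpi _).2
          (hF.map_strongEpi φ inferInstance) }

end ER

end

end EED

theorem mainTheorem1 {C : Type u} [Category.{v} C] [HasBinaryProducts C] (P : Doctrine.{w} C)
    [P.IsElementary] [P.IsExistential] [P.HasFullComprehensions] :
    ∃ (_ : HasBinaryProducts (ER P)) (_ : HasPullbacks (ER P)),
      (SubDoctrine (ER P)).IsCEED ∧
      (∀ A : C, Function.Bijective (ER.ι P A)) ∧
      ∃ hD : IsArrow P (SubDoctrine (ER P)) (ER.D P) (ER.ι P),
        (∀ (X : Type u₁) [Category.{v₁} X] [IsExact X],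
          (SubDoctrine X).IsCEED ∧
          (OneArrow.precomp ⟨ER.D P, ER.ι P, hD⟩ (SubDoctrine X) :
            OneArrow (SubDoctrine (ER P)) (SubDoctrine X) ⥤
              OneArrow P (SubDoctrine X)).IsEquivalence) ∧
        (HasTerminal C →
          IsExact (ER P) ∧ PreservesTerminal (ER.D P) ∧
          ∀ (X : Type u₁) [Category.{v₁} X] [IsExact X],
            (∀ G : OneArrow (SubDoctrine (ER P)) (SubDoctrine X),
              PreservesTerminal (ER.D P ⋙ G.F) ↔ PreservesTerminal G.F) ∧
            (OneArrow.forget (SubDoctrine (ER P)) (SubDoctrine X)).Full ∧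
            (OneArrow.forget (SubDoctrine (ER P)) (SubDoctrine X)).Faithful ∧
            ∀ F : ER P ⥤ X, IsRegularFunctor F ↔
              ∃ G : OneArrow (SubDoctrine (ER P)) (SubDoctrine X),
                G.F = F ∧ PreservesTerminal G.F) := by
  refine ⟨inferInstance, inferInstance, inferInstance, ER.incl_bijective, ER.isArrow_D_ι,
    fun X _ _ => ⟨inferInstance, OneArrow.precomp_isEquivalence⟩,
    fun _ => ⟨ER.isExact, ER.D_preservesTerminal, fun X _ _ =>
      ⟨fun G => ER.preservesTerminal_iff G.F, OneArrow.full_forget,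
        OneArrow.faithful_forget _ _, ER.isRegularFunctor_iff⟩⟩⟩
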